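/- There is an algorithm which, given a finite simple undirected graph $G$ on $n$ vertices (by its adjacency matrix), lists all potential maximal cliques of $G$, each exactly once, in time $\mathcal{O}(1.734601^n)$. Here a graph is chordal if every cycle of length at least four has a chord. A minimal triangulation of $G=(V,E)$ is a chordal graph $H=(V,E')$ with $E\subseteq E'$ such that no graph $(V,E'')$ with $E\subseteq E''\subsetneq E'$ is chordal. A set $\Omega\subseteq V$ is a potential maximal clique of $G$ if it is an inclusion-maximal clique of some minimal triangulation of $G$. An algorithm is a program of a random access machine, and its running time is measured by the logarithmic cost criterion (each operation costs one unit plus the bit length of the numbers involved); the constant in $\mathcal{O}$ is absolute, so that one program and one constant serve all $n$ and all $n$-vertex graphs. Each vertex set is output as its characteristic vector. -/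

import Mathlib

/-! ### Potential maximal cliques -/

/-- A graph is chordal if every cycle of length at least four has a chord: an edge joining two
vertices of the cycle that is not one of the edges of the cycle. -/
def SimpleGraph.Chordal {V : Type*} (H : SimpleGraph V) : Prop :=
  ∀ (v : V) (c : H.Walk v v), c.IsCycle → 4 ≤ c.length →
    ∃ x ∈ c.support, ∃ y ∈ c.support, H.Adj x y ∧ s(x, y) ∉ c.edges

/-- `H` is a triangulation of `G`: a chordal supergraph on the same vertex set. -/
def SimpleGraph.IsTriangulation {V : Type*} (G H : SimpleGraph V) : Prop :=
  G ≤ H ∧ H.Chordal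

/-- `H` is a minimal triangulation of `G`: a triangulation with inclusion-minimal edge set. -/
def SimpleGraph.IsMinimalTriangulation {V : Type*} (G H : SimpleGraph V) : Prop :=
  Minimal G.IsTriangulation H

/-- `Ω` is a potential maximal clique of `G`: an inclusion-maximal clique of some minimal
triangulation of `G`. -/
def SimpleGraph.IsPotentialMaximalClique {V : Type*} (G : SimpleGraph V) (Ω : Set V) : Prop :=
  ∃ H : SimpleGraph V, G.IsMinimalTriangulation H ∧ Maximal H.IsClique Ω

/-! ### Random access machines with logarithmic cost

Programs are structured (sequence, conditional, loop). A machine has registers, addressed by the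
program text only, an unbounded memory with indirect addressing, and a write-only output tape.
Every operation is charged one unit plus the bit length of the number it produces or accesses, and
the operands are charged where they are evaluated. -/

namespace RAM

/-- A configuration of the data: registers, memory, and what has been output so far. -/
structure State where
  reg : ℕ → ℕ
  mem : ℕ → ℕ
  out : List ℕ

/-- Arithmetic expressions. -/
inductive Expr where
  | lit (c : ℕ)
  | reg (i : ℕ)
  | mem (a : Expr)
  | add (a b : Expr)
  | sub (a b : Expr)
  | mul (a b : Expr)
  | div (a b : Expr)

/-- The value of an expression. Subtraction is truncated, division rounds down, and division by
zero gives zero. -/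
def Expr.eval (s : State) : Expr → ℕ
  | lit c => c
  | reg i => s.reg i
  | mem a => s.mem (a.eval s)
  | add a b => a.eval s + b.eval s
  | sub a b => a.eval s - b.eval s
  | mul a b => a.eval s * b.eval s
  | div a b => a.eval s / b.eval s

/-- The logarithmic cost of evaluating an expression; `Nat.size` is the bit length. The address of
a memory access is charged as part of the evaluation of the address. -/
def Expr.cost (s : State) : Expr → ℕ
  | lit c => 1 + Nat.size c
  | reg i => 1 + Nat.size (s.reg i)
  | mem a => a.cost s + 1 + Nat.size (s.mem (a.eval s))
  | add a b => a.cost s + b.cost s + 1 + Nat.size (a.eval s + b.eval s)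
  | sub a b => a.cost s + b.cost s + 1 + Nat.size (a.eval s - b.eval s)
  | mul a b => a.cost s + b.cost s + 1 + Nat.size (a.eval s * b.eval s)
  | div a b => a.cost s + b.cost s + 1 + Nat.size (a.eval s / b.eval s)

/-- Programs. Tests in `cond` and `loop` ask whether an expression is nonzero. -/
inductive Program where
  | skip
  | assign (i : ℕ) (e : Expr)
  | store (a e : Expr)
  | write (e : Expr)
  | seq (p q : Program)
  | cond (e : Expr) (p q : Program)
  | loop (e : Expr) (p : Program)

/-- `Exec p s t s'`: started in state `s`, the program `p` halts in state `s'`, and the total cost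
of the run is `t`. -/
inductive Exec : Program → State → ℕ → State → Prop where
  | skip (s : State) : Exec .skip s 1 s
  | assign (s : State) (i : ℕ) (e : Expr) :
      Exec (.assign i e) s (e.cost s + 1) { s with reg := Function.update s.reg i (e.eval s) }
  | store (s : State) (a e : Expr) :
      Exec (.store a e) s (a.cost s + e.cost s + 1)
        { s with mem := Function.update s.mem (a.eval s) (e.eval s) }
  | write (s : State) (e : Expr) :
      Exec (.write e) s (e.cost s + 1) { s with out := s.out ++ [e.eval s] }
  | seq {p q : Program} {s s' s'' : State} {t t' : ℕ} :
      Exec p s t s' → Exec q s' t' s'' → Exec (.seq p q) s (t + t') s''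
  | cond_true {e : Expr} {p q : Program} {s s' : State} {t : ℕ} :
      e.eval s ≠ 0 → Exec p s t s' → Exec (.cond e p q) s (e.cost s + 1 + t) s'
  | cond_false {e : Expr} {p q : Program} {s s' : State} {t : ℕ} :
      e.eval s = 0 → Exec q s t s' → Exec (.cond e p q) s (e.cost s + 1 + t) s'
  | loop_true {e : Expr} {p : Program} {s s' s'' : State} {t t' : ℕ} :
      e.eval s ≠ 0 → Exec p s t s' → Exec (.loop e p) s' t' s'' →
        Exec (.loop e p) s (e.cost s + 1 + t + t') s''
  | loop_false {e : Expr} {p : Program} {s : State} :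
      e.eval s = 0 → Exec (.loop e p) s (e.cost s + 1) s

/-- The machine is deterministic: the final state and the cost of a halting run are determined by
the program and the initial state. -/
theorem Exec.deterministic {p : Program} {s s₁ s₂ : State} {t₁ t₂ : ℕ}
    (h₁ : Exec p s t₁ s₁) (h₂ : Exec p s t₂ s₂) : t₁ = t₂ ∧ s₁ = s₂ := by
  induction h₁ generalizing t₂ s₂ with
  | skip | assign | store | write => cases h₂; exact ⟨rfl, rfl⟩
  | seq _ _ ih ih' =>
    cases h₂ with
    | seq k k' =>
      obtain ⟨rfl, rfl⟩ := ih k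
      obtain ⟨rfl, rfl⟩ := ih' k'
      exact ⟨rfl, rfl⟩
  | cond_true h _ ih =>
    cases h₂ with
    | cond_true _ k => obtain ⟨rfl, rfl⟩ := ih k; exact ⟨rfl, rfl⟩
    | cond_false h' _ => exact absurd h' h
  | cond_false h _ ih =>
    cases h₂ with
    | cond_true h' _ => exact absurd h h'
    | cond_false _ k => obtain ⟨rfl, rfl⟩ := ih k; exact ⟨rfl, rfl⟩
  | loop_true h _ _ ih ih' =>
    cases h₂ with
    | loop_true _ k k' =>
      obtain ⟨rfl, rfl⟩ := ih k
      obtain ⟨rfl, rfl⟩ := ih' k'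
      exact ⟨rfl, rfl⟩
    | loop_false h' => exact absurd h' h
  | loop_false h =>
    cases h₂ with
    | loop_true h' _ _ => exact absurd h h'
    | loop_false _ => exact ⟨rfl, rfl⟩

open Classical in
/-- The initial state for an input graph on `n` vertices: register `0` holds `n`, the memory holds
the adjacency matrix row by row, and everything else is zero. -/
noncomputable def graphInput {n : ℕ} (G : SimpleGraph (Fin n)) : State where
  reg i := if i = 0 then n else 0
  mem a := if ∃ i j : Fin n, a = (i : ℕ) * n + (j : ℕ) ∧ G.Adj i j then 1 else 0
  out := []

/-- The code of a vertex set: its characteristic vector, read as a binary number. -/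
def setCode {n : ℕ} (Ω : Finset (Fin n)) : ℕ :=
  ∑ i ∈ Ω, 2 ^ (i : ℕ)

/-- The output lists the codes of all potential maximal cliques of `G`, each exactly once, and
nothing else. -/
def ListsPotentialMaximalCliques {n : ℕ} (G : SimpleGraph (Fin n)) (out : List ℕ) : Prop :=
  out.Nodup ∧
    ∀ k : ℕ, k ∈ out ↔
      ∃ Ω : Finset (Fin n), G.IsPotentialMaximalClique (Ω : Set (Fin n)) ∧ setCode Ω = k

end RAM

/-! Potential maximal cliques are recognizable in polynomial time by the criterion of Bouchitté and
Todinca (`isPotentialMaximalClique_iff`): no component of `G - Ω` sees all of `Ω`, and any two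
nonadjacent vertices of `Ω` are seen by a common component. So it suffices to generate few enough
candidate sets, test each of them, and suppress repetitions by marks in memory.

Candidates come from short descriptions. A connected set containing `z`, with `i + 1` vertices and
`j` neighbours outside a forbidden set, is determined by `z`, `i`, `j` and a number below `(i +
j).choose i`: exploring from `z`, each new vertex belongs either to the set or to its neighbourhood,
and Pascal's rule encodes these choices (`Stage.exists_advice`). A description of `Ω` consists of at
most three such explorations, each forbidding what the earlier ones found, whose neighbourhoods
together with one extra vertex make up `Ω` (`HasCode`).

Let `m` be the number of vertices outside `Ω`. If for some `z` in `Ω` the components seen by `z`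
have at most `5m/8` vertices in total, they form with `z` one connected set whose neighbourhood is
the rest of `Ω`, and this is cheap enough. Otherwise every union of components missed by a vertex of
`Ω` has fewer than `3m/8` vertices. Now delete a vertex `a`. The criterion survives for `Ω` without
`a` unless either a single component sees all of `Ω` except `a`, which gives a description at once,
or two vertices of `Ω` have a unique common component `C`. In the latter case `C` has more than
`m/4` vertices, and a case distinction describes `Ω` by two components, or by `C`, a second
component and the remaining components seen by one vertex (`hasCode_of_unique`). Entropy bounds keep
the number of descriptions of each shape at most `codeBase ^ n`.

Deleting the vertices in order therefore leads to a set with a description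
(`CliquishNotFull.exists_hasCode`). The deleted vertices can be put back without further
information: of `Ω` and `insert a Ω` at most one meets the criterion
(`CliquishNotFullIn.not_insert`), so the test itself decides membership.

All parameters fit into eleven digits in base `n`, leaving `n ^ 11 * (⌊codeBase ^ n⌋ + 1)` numbers
to decode. Decoding is written in a small language whose only iteration is over the vertices, and
every term of it compiles to a program of polynomial cost (`exists_computes`). Since `codeBase` is
slightly less than `1.734601`, the polynomial factors disappear in the constant. -/

set_option linter.unusedSectionVars false

/-! ### Connected sets, simplicial vertices and chordality. -/

namespace SimpleGraph

variable {V : Type*}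

/-- A finite vertex set is connected: it is nonempty and every proper cut of it is crossed by an
edge. -/
def ConnOn (G : SimpleGraph V) (S : Finset V) : Prop :=
  S.Nonempty ∧ ∀ T ⊆ S, T.Nonempty → T ≠ S → ∃ a ∈ T, ∃ b ∈ S, b ∉ T ∧ G.Adj a b

/-- The neighbours of `v` inside `S` form a clique. -/
def SimplicialIn (H : SimpleGraph V) (S : Finset V) (v : V) : Prop :=
  ∀ a ∈ S, ∀ b ∈ S, H.Adj v a → H.Adj v b → a ≠ b → H.Adj a b

theorem connOn_singleton (G : SimpleGraph V) (v : V) : G.ConnOn {v} := by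
  refine ⟨by simp, fun T hT hn hne => ?_⟩
  exact absurd (Finset.Nonempty.subset_singleton_iff hn |>.1 hT) hne

theorem ConnOn.mono {G H : SimpleGraph V} (h : G ≤ H) {S : Finset V} (hS : G.ConnOn S) :
    H.ConnOn S := by
  refine ⟨hS.1, fun T hT hn hne => ?_⟩
  obtain ⟨a, ha, b, hb, hbT, hab⟩ := hS.2 T hT hn hne
  exact ⟨a, ha, b, hb, hbT, h hab⟩

/-- A subset of a connected set that contains one of its vertices and is closed under adjacency
inside it is the whole set. -/
theorem ConnOn.subset_of_closed [DecidableEq V] {G : SimpleGraph V} {S T : Finset V}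
    (hS : G.ConnOn S)
    (hne : ∃ a ∈ S, a ∈ T) (hcl : ∀ a ∈ S, a ∈ T → ∀ b ∈ S, G.Adj a b → b ∈ T) : S ⊆ T := by
  by_contra hST
  obtain ⟨a, haS, haT⟩ := hne
  obtain ⟨a, ha, b, hb, hbT, hab⟩ := hS.2 (S ∩ T) Finset.inter_subset_left
    ⟨a, by simp [haS, haT]⟩ (fun h => hST (by rw [← h]; exact Finset.inter_subset_right))
  simp only [Finset.mem_inter] at ha hbT
  exact hbT ⟨hb, hcl a ha.1 ha.2 b hb hab⟩

theorem ConnOn.union [DecidableEq V] {G : SimpleGraph V} {S S' : Finset V} (hS : G.ConnOn S)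
    (hS' : G.ConnOn S') {a b : V}
    (ha : a ∈ S) (hb : b ∈ S') (hab : G.Adj a b) : G.ConnOn (S ∪ S') := by
  refine ⟨⟨a, by simp [ha]⟩, fun T hT hn hne => ?_⟩
  by_contra hcon
  push Not at hcon
  have key : ∀ R ⊆ S ∪ S', G.ConnOn R → (∃ x ∈ R, x ∈ T) → R ⊆ T := fun R hR hc h =>
    hc.subset_of_closed h fun a _ haT b hbR hab => by
      by_contra hbT
      exact hcon a haT b (hR hbR) hbT hab
  have hor : S ⊆ T ∨ S' ⊆ T := by
    obtain ⟨x, hx⟩ := hn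
    rcases Finset.mem_union.1 (hT hx) with h | h
    · exact Or.inl (key S Finset.subset_union_left hS ⟨x, h, hx⟩)
    · exact Or.inr (key S' Finset.subset_union_right hS' ⟨x, h, hx⟩)
  apply hne
  refine hT.antisymm (Finset.union_subset ?_ ?_)
  · refine key S Finset.subset_union_left hS ⟨a, ha, ?_⟩
    rcases hor with h | h
    · exact h ha
    · by_contra haT
      exact hcon b (h hb) a (by simp [ha]) haT hab.symm
  · refine key S' Finset.subset_union_right hS' ⟨b, hb, ?_⟩
    rcases hor with h | h
    · by_contra hbT
      exact hcon a (h ha) b (by simp [hb]) hbT hab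
    · exact h hb

/-- The vertices of `S` reachable from `a` are closed under adjacency inside `S`. This is the
passage from cuts to walks, needed only for taking shortest paths. -/
theorem ConnOn.reachable_induce [DecidableEq V] {G : SimpleGraph V} {S : Finset V}
    (hS : G.ConnOn S) {U : Set V} (hSU : (S : Set V) ⊆ U) {a b : V} (ha : a ∈ S) (hb : b ∈ S) :
    (G.induce U).Reachable ⟨a, hSU ha⟩ ⟨b, hSU hb⟩ := by
  classical
  have := hS.subset_of_closed (T := {x ∈ S | ∃ h : x ∈ U, (G.induce U).Reachable ⟨a, hSU ha⟩ ⟨x, h⟩})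
    ⟨a, ha, by simpa [ha] using hSU ha⟩ (by
      intro x _ hx y hy hxy
      simp only [Finset.mem_filter] at hx ⊢
      obtain ⟨_, hxU, hr⟩ := hx
      refine ⟨hy, hSU hy, hr.trans (Adj.reachable ?_)⟩
      simpa using hxy) hb
  simp only [Finset.mem_filter] at this
  exact this.2.2

/-- A walk through a simplicial vertex can bypass it, because its neighbours are adjacent. In terms
of cuts: if `T` is joined only to `v`, look at the cut `insert v T`. -/
theorem ConnOn.erase_simplicial [DecidableEq V] {G : SimpleGraph V} {S : Finset V} {v : V}
    (hS : G.ConnOn S) (hv : v ∈ S) (hs : G.SimplicialIn S v) (hne : S ≠ {v}) :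
    G.ConnOn (S.erase v) := by
  refine ⟨?_, fun T hT hn hTne => ?_⟩
  · rw [Finset.nonempty_iff_ne_empty]
    intro h
    rcases Finset.erase_eq_empty_iff _ _ |>.1 h with h | h
    · simp [h] at hv
    · exact hne h
  · have hvT : v ∉ T := fun h => by simpa using hT h
    obtain ⟨a, ha, b, hb, hbT, hab⟩ := hS.2 T (hT.trans (Finset.erase_subset _ _)) hn
      (fun h => hvT (h ▸ hv))
    by_cases hbv : b = v
    · subst hbv
      obtain ⟨a', ha', b', hb', hbT', hab'⟩ := hS.2 (Insert.insert b T)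
        (Finset.insert_subset hv (hT.trans (Finset.erase_subset _ _))) (by simp) (fun h => by
          apply hTne
          rw [← h, Finset.erase_insert hvT])
      simp only [Finset.mem_insert, not_or] at ha' hbT'
      rcases ha' with rfl | ha'
      · refine ⟨a, ha, b', by simp [hb', hbT'.1], hbT'.2, ?_⟩
        exact hs a (Finset.erase_subset _ _ (hT ha)) b' hb' hab.symm hab'
          (fun h => hbT'.2 (h ▸ ha))
      · exact ⟨a', ha', b', by simp [hb', hbT'.1], hbT'.2, hab'⟩
    · exact ⟨a, ha, b, by simp [hb, hbv], hbT, hab⟩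

/-- A chord would shorten the walk; hence a shortest walk is induced. -/
theorem Walk.mem_edges_of_length_eq_dist [DecidableEq V] {G : SimpleGraph V} {x y : V}
    (p : G.Walk x y) (hp : p.length = G.dist x y) {u w : V} (hu : u ∈ p.support)
    (hw : w ∈ p.support) (huw : G.Adj u w) : s(u, w) ∈ p.edges := by
  have one : ∀ {a b : V} (q : G.Walk a b), G.Adj a b → q.length ≤ 1 → s(a, b) ∈ q.edges := by
    intro a b q hab hq
    cases q with
    | nil => exact absurd hab (by simp)
    | cons h q =>
      cases q with
      | nil => simp
      | cons h' q => simp at hq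
  have hsp := congrArg Walk.length (p.take_spec hu)
  have hed := congrArg Walk.edges (p.take_spec hu)
  have hsu : w ∈ (p.takeUntil u hu).support ∨ w ∈ (p.dropUntil u hu).support := by
    rw [← p.take_spec hu, Walk.mem_support_append_iff] at hw
    exact hw
  rw [Walk.length_append] at hsp
  rw [Walk.edges_append] at hed
  rcases hsu with h | h
  · have hsp' := congrArg Walk.length ((p.takeUntil u hu).take_spec h)
    have hed' := congrArg Walk.edges ((p.takeUntil u hu).take_spec h)
    rw [Walk.length_append] at hsp'
    rw [Walk.edges_append] at hed'
    have hd := G.dist_le (((p.takeUntil u hu).takeUntil w h).append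
      (Walk.cons huw.symm (p.dropUntil u hu)))
    rw [Walk.length_append, Walk.length_cons] at hd
    have := one ((p.takeUntil u hu).dropUntil w h) huw.symm (by omega)
    rw [← hed, ← hed', Sym2.eq_swap]
    simp [this]
  · have hsp' := congrArg Walk.length ((p.dropUntil u hu).take_spec h)
    have hed' := congrArg Walk.edges ((p.dropUntil u hu).take_spec h)
    rw [Walk.length_append] at hsp'
    rw [Walk.edges_append] at hed'
    have hd := G.dist_le ((p.takeUntil u hu).append
      (Walk.cons huw ((p.dropUntil u hu).dropUntil w h)))
    rw [Walk.length_append, Walk.length_cons] at hd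
    have := one ((p.dropUntil u hu).takeUntil w h) huw (by omega)
    rw [← hed, ← hed']
    simp [this]

/-- In a chordal graph, two neighbours of a vertex `b` that both see a connected set away from `b`
are adjacent. -/
theorem Chordal.adj_of_connOn [DecidableEq V] {H : SimpleGraph V} (hH : H.Chordal) {A : Finset V}
    (hA : H.ConnOn A)
    {b x y : V} (hbA : b ∉ A) (hb : ∀ a ∈ A, ¬ H.Adj b a) (hx : H.Adj b x) (hy : H.Adj b y)
    (hxA : ∃ a ∈ A, H.Adj a x) (hyA : ∃ a ∈ A, H.Adj a y) (hxy : x ≠ y) : H.Adj x y := by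
  by_contra hnadj
  obtain ⟨a, ha, hax⟩ := hxA
  obtain ⟨a', ha', hay⟩ := hyA
  -- A shortest path from `x` to `y` inside `U`, closed up through `b`, is a cycle of length at
  -- least four. It has no chord at `b`, which sees only `x` and `y` in `U`, and none on the path,
  -- which is induced.
  set U : Set V := {v | v ∈ A ∨ v = x ∨ v = y} with hU
  have hAU : (A : Set V) ⊆ U := fun v hv => Or.inl hv
  have hxU : x ∈ U := Or.inr (Or.inl rfl)
  have hyU : y ∈ U := Or.inr (Or.inr rfl)
  have hr : (H.induce U).Reachable ⟨x, hxU⟩ ⟨y, hyU⟩ := by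
    refine (Adj.reachable ?_).trans ((hA.reachable_induce hAU ha ha').trans (Adj.reachable ?_))
    · simpa using hax.symm
    · simpa using hay
  obtain ⟨p, hp, hpd⟩ := hr.exists_path_of_dist
  have hbU : b ∉ U := by
    rintro (h | rfl | rfl)
    · exact hbA h
    · exact H.loopless.irrefl _ hx
    · exact H.loopless.irrefl _ hy
  let q : H.Walk x y := p.map (Embedding.induce U).toHom
  have hq : q.IsPath := hp.map Subtype.val_injective
  have hqs : q.support = p.support.map Subtype.val := Walk.support_map _ _
  have hqe : q.edges = p.edges.map (Sym2.map Subtype.val) := Walk.edges_map _ _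
  have hqU : ∀ v ∈ q.support, v ∈ U := by
    intro v hv
    rw [hqs, List.mem_map] at hv
    obtain ⟨w, _, rfl⟩ := hv
    exact w.2
  have hbq : b ∉ q.support := fun h => hbU (hqU b h)
  have hqlen : 2 ≤ q.length := by
    by_contra hlt
    have hlt : q.length ≤ 1 := by omega
    clear_value q
    cases q with
    | nil => exact hxy rfl
    | cons h q' =>
      cases q' with
      | nil => exact hnadj h
      | cons h' q' => simp at hlt
  have hcyc : (Walk.cons hx (q.concat hy.symm)).IsCycle := by
    rw [Walk.cons_isCycle_iff]
    refine ⟨hq.concat hbq _, ?_⟩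
    simp only [Walk.edges_concat, List.concat_eq_append, List.mem_append, List.mem_singleton]
    rintro (h | h)
    · exact hbq (q.fst_mem_support_of_mem_edges h)
    · rcases Sym2.eq_iff.1 h with ⟨rfl, _⟩ | ⟨_, h⟩
      · exact H.loopless.irrefl _ hy
      · exact hxy h
  obtain ⟨u, hu, w, hw, huw, hne⟩ := hH b _ hcyc (by simp; omega)
  have hsupp : ∀ v, v ∈ (Walk.cons hx (q.concat hy.symm)).support → v = b ∨ v ∈ q.support := by
    intro v hv
    simp only [Walk.support_cons, Walk.support_concat, List.mem_cons,
      List.mem_append, List.not_mem_nil, or_false] at hv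
    tauto
  have hedge : ∀ v, v ∈ q.support → H.Adj b v →
      s(b, v) ∈ (Walk.cons hx (q.concat hy.symm)).edges := by
    intro v hv hbv
    rcases hqU v hv with h | rfl | rfl
    · exact absurd hbv (hb v h)
    · simp
    · simp [Walk.edges_concat]
  rcases hsupp u hu with rfl | hu'
  · rcases hsupp w hw with rfl | hw'
    · exact H.loopless.irrefl _ huw
    · exact hne (hedge w hw' huw)
  · rcases hsupp w hw with rfl | hw'
    · exact hne (by rw [Sym2.eq_swap]; exact hedge u hu' huw.symm)
    · have hm : s((⟨u, hqU u hu'⟩ : U), (⟨w, hqU w hw'⟩ : U)) ∈ p.edges := by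
        refine p.mem_edges_of_length_eq_dist hpd ?_ ?_ (by simpa using huw)
        · rw [hqs, List.mem_map] at hu'
          obtain ⟨v, hv, rfl⟩ := hu'
          exact hv
        · rw [hqs, List.mem_map] at hw'
          obtain ⟨v, hv, rfl⟩ := hw'
          exact hv
      apply hne
      have : s(u, w) ∈ q.edges := by
        rw [hqe]
        exact List.mem_map.2 ⟨_, hm, rfl⟩
      simp [Walk.edges_concat, this]

/-- Graphs all of whose nonempty vertex subsets have a simplicial vertex are chordal. -/
theorem chordal_of_simplicial [DecidableEq V] {H : SimpleGraph V}
    (h : ∀ S : Finset V, S.Nonempty → ∃ v ∈ S, H.SimplicialIn S v) : H.Chordal := by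
  intro v₀ c hc hlen
  obtain ⟨v, hv, hs⟩ := h c.support.toFinset ⟨v₀, by simp⟩
  rw [List.mem_toFinset] at hv
  -- Started at a simplicial vertex of its support, the cycle has as a chord the edge between the
  -- two cycle neighbours of that vertex.
  have hc' := hc.rotate hv
  have hl' : (c.rotate v hv).length = c.length := by
    have := congrArg Walk.length (c.take_spec hv)
    simp only [Walk.rotate, Walk.length_append] at this ⊢
    omega
  have hsup : ∀ x, x ∈ (c.rotate v hv).support → x ∈ c.support := by
    intro x hx
    simpa using hx
  have hedg : ∀ e, e ∈ c.edges → e ∈ (c.rotate v hv).edges := fun e he =>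
    (c.rotate_edges v hv).symm.perm.subset he
  generalize c.rotate v hv = d at *
  cases d with
  | nil => simp at hl'; omega
  | @cons _ x _ hvx p =>
    rw [Walk.cons_isCycle_iff] at hc'
    obtain ⟨y, q, hyv, rfl⟩ : ∃ (y : V) (q : H.Walk x y) (hyv : H.Adj y v), p = q.concat hyv := by
      cases p with
      | nil => simp at hl'; omega
      | cons h' p' =>
        obtain ⟨y, q, h'', e⟩ := Walk.exists_cons_eq_concat h' p'
        exact ⟨y, q, h'', e⟩
    have hq := (Walk.concat_isPath_iff hyv).1 hc'.1
    simp only [Walk.length_cons, Walk.length_concat] at hl'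
    have hxy : x ≠ y := by
      rintro rfl
      have := Walk.length_eq_zero_iff.2 (hq.1.nil_iff_eq.2 rfl)
      omega
    have hx : x ∈ c.support := hsup x (by simp [Walk.support_concat])
    have hy : y ∈ c.support := hsup y (by simp [Walk.support_concat])
    have hadj := hs x (by simpa using hx) y (by simpa using hy) hvx hyv.symm hxy
    refine ⟨x, hx, y, hy, hadj, fun he => ?_⟩
    have := hedg _ he
    simp only [Walk.edges_cons, Walk.edges_concat, List.mem_cons, List.concat_eq_append,
      List.mem_append, List.not_mem_nil, or_false] at this
    rcases this with h | h | h
    · rcases Sym2.eq_iff.1 h with ⟨rfl, _⟩ | ⟨_, rfl⟩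
      · exact H.loopless.irrefl _ hvx
      · exact H.loopless.irrefl _ hyv
    · have := hq.1.length_eq_one_of_mem_edges h
      omega
    · rcases Sym2.eq_iff.1 h with ⟨h, _⟩ | ⟨rfl, _⟩
      · exact hxy h
      · exact H.loopless.irrefl _ hvx

end SimpleGraph

/-! ### Components and the characterization of potential maximal cliques. -/

namespace SimpleGraph

variable {V : Type*} [Fintype V] [DecidableEq V]

/-- `C` is a connected component of `G - Ω`. -/
def IsCompOf (G : SimpleGraph V) (Ω C : Finset V) : Prop :=
  G.ConnOn C ∧ Disjoint C Ω ∧ ∀ a ∈ C, ∀ b, G.Adj a b → b ∈ C ∨ b ∈ Ω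

/-- Some vertex of `C` is adjacent to `x`. -/
def Sees (G : SimpleGraph V) (C : Finset V) (x : V) : Prop :=
  ∃ a ∈ C, G.Adj a x

/-- No component of `G - Ω` sees all of `Ω`, and any two distinct vertices of `Ω` are adjacent or
seen by a common component. -/
def CliquishNotFull (G : SimpleGraph V) (Ω : Finset V) : Prop :=
  (∀ C, G.IsCompOf Ω C → ∃ x ∈ Ω, ¬ G.Sees C x) ∧
    ∀ u ∈ Ω, ∀ v ∈ Ω, u ≠ v → ¬ G.Adj u v → ∃ C, G.IsCompOf Ω C ∧ G.Sees C u ∧ G.Sees C v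

/-- A minimal set that contains `v`, avoids `Ω` and is closed under adjacency outside `Ω` is
connected: an uncrossed cut would leave a smaller such set on the side of `v`. -/
theorem exists_isCompOf (G : SimpleGraph V) {Ω : Finset V} {v : V} (hv : v ∉ Ω) :
    ∃ C, G.IsCompOf Ω C ∧ v ∈ C := by
  obtain ⟨C, hC⟩ := exists_minimal_of_wellFoundedLT
    (fun C : Finset V => v ∈ C ∧ Disjoint C Ω ∧ ∀ a ∈ C, ∀ b, G.Adj a b → b ∈ C ∨ b ∈ Ω)
    ⟨Ωᶜ, by simpa using hv, disjoint_compl_left, fun a _ b _ => by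
      by_cases h : b ∈ Ω <;> simp [h]⟩
  refine ⟨C, ⟨⟨⟨v, hC.prop.1⟩, fun T hT hn hne => ?_⟩, hC.prop.2⟩, hC.prop.1⟩
  by_contra hcon
  push Not at hcon
  have key : ∀ R ⊆ C, v ∈ R → (∀ a ∈ R, ∀ b ∈ C, G.Adj a b → b ∈ R) → C ⊆ R := by
    intro R hR hvR hcl
    refine hC.le_of_le ⟨hvR, hC.prop.2.1.mono_left hR, fun a ha b hab => ?_⟩ hR
    rcases hC.prop.2.2 a (hR ha) b hab with h | h
    · exact Or.inl (hcl a ha b h hab)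
    · exact Or.inr h
  by_cases hvT : v ∈ T
  · refine hne (hT.antisymm (key T hT hvT fun a ha b hb hab => ?_))
    by_contra hbT
    exact hcon a ha b hb hbT hab
  · have := key (C \ T) Finset.sdiff_subset (by simp [hC.prop.1, hvT]) fun a ha b hb hab => by
      simp only [Finset.mem_sdiff] at ha ⊢
      refine ⟨hb, fun hbT => ?_⟩
      exact hcon b hbT a ha.1 ha.2 hab.symm
    obtain ⟨x, hx⟩ := hn
    have := this (hT hx)
    simp [hx] at this

theorem IsCompOf.eq_of_mem {G : SimpleGraph V} {Ω C C' : Finset V} (h : G.IsCompOf Ω C)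
    (h' : G.IsCompOf Ω C') {v : V} (hv : v ∈ C) (hv' : v ∈ C') : C = C' := by
  have key : ∀ {C C' : Finset V}, G.IsCompOf Ω C → G.IsCompOf Ω C' → v ∈ C → v ∈ C' → C ⊆ C' :=
    fun {C C'} h h' hv hv' => h.1.subset_of_closed ⟨v, hv, hv'⟩ fun a _ ha b hb hab =>
      (h'.2.2 a ha b hab).resolve_right fun hΩ => Finset.disjoint_left.1 h.2.1 hb hΩ
  exact (key h h' hv hv').antisymm (key h' h hv' hv)

/-- Dirac's theorem, strengthened so that the simplicial vertex avoids a prescribed clique. The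
clique `Q` makes the induction work: it is replaced by a clique separator, which keeps the vertex
found on one side of it. -/
theorem Chordal.exists_simplicial {H : SimpleGraph V} (hH : H.Chordal) (S : Finset V) :
    ∀ Q : Finset V, Q ⊂ S → H.IsClique (Q : Set V) → ∃ v ∈ S, v ∉ Q ∧ H.SimplicialIn S v := by
  classical
  induction S using Finset.strongInduction with
  | H S ih =>
    intro Q hQS hQ
    by_cases hcl : ∀ a ∈ S, ∀ b ∈ S, a ≠ b → H.Adj a b
    · obtain ⟨v, hvS, hvQ⟩ := Finset.exists_of_ssubset hQS
      exact ⟨v, hvS, hvQ, fun a ha b hb _ _ hab => hcl a ha b hb hab⟩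
    push Not at hcl
    obtain ⟨a, ha, b, hb, hab, hnadj⟩ := hcl
    -- With this `Ω`, the component `A` of `a` lies in `S` outside the closed neighbourhood of `b`.
    -- Its neighbours `P` in `S` are then neighbours of `b`, and chordality makes `P` a clique
    -- separating `a` from `b` in `S`.
    set Ω : Finset V := {x ∈ S | x ≠ b ∧ ¬ H.Adj b x}ᶜ with hΩ
    obtain ⟨A, hA, haA⟩ := H.exists_isCompOf (Ω := Ω) (v := a)
      (by simp [hΩ, ha, hab]; exact fun h => hnadj h.symm)
    have hAS : ∀ x ∈ A, x ∈ S ∧ x ≠ b ∧ ¬ H.Adj b x := by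
      intro x hx
      have := Finset.disjoint_left.1 hA.2.1 hx
      simpa [hΩ] using this
    set P : Finset V := {x ∈ S | x ∉ A ∧ H.Sees A x} with hP
    have hbA : b ∉ A := fun h => (hAS b h).2.1 rfl
    have hPb : ∀ x ∈ P, H.Adj b x := by
      intro x hx
      simp only [hP, Finset.mem_filter] at hx
      obtain ⟨hxS, hxA, c, hc, hcx⟩ := hx
      have := (hA.2.2 c hc x hcx).resolve_left hxA
      simp only [hΩ, Finset.mem_compl, Finset.mem_filter, not_and, not_not] at this
      refine this hxS fun hxb => (hAS c hc).2.2 ?_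
      rw [← hxb]
      exact hcx.symm
    have hbP : b ∉ P := fun h => H.loopless.irrefl _ (hPb b h)
    have hPcl : H.IsClique (P : Set V) := by
      intro x hx y hy hxy
      have hx' := Finset.mem_coe.1 hx
      have hy' := Finset.mem_coe.1 hy
      simp only [hP, Finset.mem_filter] at hx' hy'
      exact hH.adj_of_connOn hA.1 hbA (fun c hc => (hAS c hc).2.2) (hPb x hx) (hPb y hy)
        hx'.2.2 hy'.2.2 hxy
    -- No edge joins `A` to the part of `S` outside `A ∪ P`, so the clique `Q` misses one of these
    -- two sides. The induction takes the missed side, together with `P`, and finds a vertex outside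
    -- `P`, all of whose neighbours in `S` stay on that side or in `P`.
    by_cases hQA : ∃ q ∈ Q, q ∈ A
    · obtain ⟨q, hqQ, hqA⟩ := hQA
      obtain ⟨v, hv, hvP, hs⟩ := ih (S \ A)
        (Finset.ssubset_iff_of_subset Finset.sdiff_subset |>.2 ⟨a, ha, by simp [haA]⟩) P
        (Finset.ssubset_iff_of_subset (fun x hx => by
          simp only [hP, Finset.mem_filter] at hx
          simp [hx.1, hx.2.1]) |>.2 ⟨b, by simp [hb, hbA], hbP⟩) hPcl
      simp only [Finset.mem_sdiff] at hv
      have hvA : ∀ c ∈ A, ¬ H.Adj c v := fun c hc hcv => hvP (by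
        simp only [hP, Finset.mem_filter]
        exact ⟨hv.1, hv.2, c, hc, hcv⟩)
      refine ⟨v, hv.1, fun hvQ => ?_, fun c hc d hd hvc hvd hcd => ?_⟩
      · exact hvA q hqA (hQ hqQ hvQ (fun h => hv.2 (h ▸ hqA)))
      · refine hs c ?_ d ?_ hvc hvd hcd
        · simp only [Finset.mem_sdiff]
          exact ⟨hc, fun h => hvA c h hvc.symm⟩
        · simp only [Finset.mem_sdiff]
          exact ⟨hd, fun h => hvA d h hvd.symm⟩
    · push Not at hQA
      have hsub : A ∪ P ⊆ S := by
        intro x hx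
        rcases Finset.mem_union.1 hx with h | h
        · exact (hAS x h).1
        · exact (Finset.mem_filter.1 h).1
      obtain ⟨v, hv, hvP, hs⟩ := ih (A ∪ P)
        (Finset.ssubset_iff_of_subset hsub |>.2 ⟨b, hb, by simp [hbA, hbP]⟩) P
        (Finset.ssubset_iff_of_subset Finset.subset_union_right |>.2
          ⟨a, by simp [haA], fun h => (Finset.mem_filter.1 h).2.1 haA⟩) hPcl
      have hvA : v ∈ A := (Finset.mem_union.1 hv).resolve_right hvP
      have hn : ∀ c ∈ S, H.Adj v c → c ∈ A ∪ P := by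
        intro c hc hvc
        by_cases hcA : c ∈ A
        · simp [hcA]
        · refine Finset.mem_union_right _ ?_
          simp only [hP, Finset.mem_filter]
          exact ⟨hc, hcA, v, hvA, hvc⟩
      exact ⟨v, hsub hv, fun hvQ => hQA v hvQ hvA, fun c hc d hd hvc hvd hcd =>
        hs c (hn c hc hvc) d (hn d hd hvd) hvc hvd hcd⟩

/-- If `x` is seen only from `v`, then a neighbour of `v` in `A` also sees `x`, as `v` is
simplicial. -/
theorem ConnOn.sees_erase {H : SimpleGraph V} {A S : Finset V} (hA : H.ConnOn A) (hAS : A ⊆ S)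
    {v x : V} (hv : v ∈ A) (hne : A ≠ {v}) (hs : H.SimplicialIn S v) (hxS : x ∈ S) (hxA : x ∉ A)
    (hx : H.Sees A x) : H.Sees (A.erase v) x := by
  obtain ⟨a, ha, hax⟩ := hx
  by_cases hav : a = v
  · subst hav
    obtain ⟨c, hc, b, hb, hba, hcb⟩ := hA.2 {a} (by simpa using hv) (by simp) (Ne.symm hne)
    simp only [Finset.mem_singleton] at hc hba
    subst hc
    exact ⟨b, by simp [hb, hba], hs b (hAS hb) x hxS hcb hax (fun h => hxA (h ▸ hb))⟩
  · exact ⟨a, by simp [ha, hav], hax⟩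

theorem SimplicialIn.mono {H : SimpleGraph V} {S T : Finset V} (h : S ⊆ T) {v : V}
    (hs : H.SimplicialIn T v) : H.SimplicialIn S v :=
  fun a ha b hb => hs a (h ha) b (h hb)

/-- In a chordal graph, two vertices seen by two connected sets without edges between them are
adjacent. -/
theorem Chordal.adj_of_sees {H : SimpleGraph V} (hH : H.Chordal) {x y : V} (hxy : x ≠ y) :
    ∀ (k : ℕ) (A B : Finset V), A.card + B.card = k → H.ConnOn A → H.ConnOn B → x ∉ A → x ∉ B →
      y ∉ A → y ∉ B → (∀ a ∈ A, ∀ b ∈ B, a ≠ b ∧ ¬ H.Adj a b) → H.Sees A x → H.Sees A y →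
      H.Sees B x → H.Sees B y → H.Adj x y := by
  intro k
  induction k using Nat.strong_induction_on with
  | _ k ih =>
    have side : ∀ A B : Finset V, A.card + B.card = k → H.ConnOn A → H.ConnOn B → x ∉ A → x ∉ B →
        y ∉ A → y ∉ B → (∀ a ∈ A, ∀ b ∈ B, a ≠ b ∧ ¬ H.Adj a b) → H.Sees A x → H.Sees A y →
        H.Sees B x → H.Sees B y → ∀ v ∈ A,
        H.SimplicialIn (Insert.insert x (Insert.insert y (A ∪ B))) v → H.Adj x y := by
      intro A B hk hA hB hxA hxB hyA hyB hAB hAx hAy hBx hBy v hv hs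
      have hsub : A ⊆ Insert.insert x (Insert.insert y (A ∪ B)) := fun a ha => by simp [ha]
      by_cases hAv : A = {v}
      · subst hAv
        obtain ⟨a, ha, hax⟩ := hAx
        obtain ⟨a', ha', hay⟩ := hAy
        simp only [Finset.mem_singleton] at ha ha'
        subst ha ha'
        exact hs x (by simp) y (by simp) hax hay hxy
      · have hc := Finset.card_erase_lt_of_mem hv
        refine ih _ ?_ (A.erase v) B rfl
          (hA.erase_simplicial hv (hs.mono hsub) hAv) hB (fun h => hxA (Finset.mem_of_mem_erase h))
          hxB (fun h => hyA (Finset.mem_of_mem_erase h)) hyB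
          (fun a ha => hAB a (Finset.mem_of_mem_erase ha))
          (hA.sees_erase hsub hv hAv hs (by simp) hxA hAx)
          (hA.sees_erase hsub hv hAv hs (by simp) hyA hAy) hBx hBy
        omega
    intro A B hk hA hB hxA hxB hyA hyB hAB hAx hAy hBx hBy
    -- The simplicial vertex is neither `x` nor `y`, since these have nonadjacent neighbours in `A`
    -- and `B`. It can be removed from the set containing it, unless it is that whole set, and then
    -- `x` and `y` are two of its neighbours.
    obtain ⟨v, hv, -, hs⟩ := hH.exists_simplicial (Insert.insert x (Insert.insert y (A ∪ B))) ∅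
      (Finset.empty_ssubset.2 (by simp)) (by simp)
    have hxy' : ∀ w, H.Sees A w → H.Sees B w →
        ¬ H.SimplicialIn (Insert.insert x (Insert.insert y (A ∪ B))) w := by
      rintro w ⟨a, ha, haw⟩ ⟨b, hb, hbw⟩ hs
      exact (hAB a ha b hb).2
        (hs a (by simp [ha]) b (by simp [hb]) haw.symm hbw.symm (hAB a ha b hb).1)
    simp only [Finset.mem_insert, Finset.mem_union] at hv
    rcases hv with rfl | rfl | hv | hv
    · exact absurd hs (hxy' _ hAx hBx)
    · exact absurd hs (hxy' _ hAy hBy)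
    · exact side A B hk hA hB hxA hxB hyA hyB hAB hAx hAy hBx hBy v hv hs
    · refine side B A (by omega) hB hA hxB hxA hyB hyA
        (fun b hb a ha => ⟨(hAB a ha b hb).1.symm, fun h => (hAB a ha b hb).2 h.symm⟩)
        hBx hBy hAx hAy v hv ?_
      rwa [Finset.union_comm]

/-- In a chordal graph, a connected set that sees every vertex of a clique contains a vertex
adjacent to the whole clique. -/
theorem Chordal.exists_dominating {H : SimpleGraph V} (hH : H.Chordal) {Q : Finset V}
    (hQ : H.IsClique (Q : Set V)) (C : Finset V) : H.ConnOn C → Disjoint C Q →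
      (∀ x ∈ Q, H.Sees C x) → ∃ c ∈ C, ∀ x ∈ Q, H.Adj c x := by
  induction C using Finset.strongInduction with
  | H C ih =>
    intro hC hd hs
    obtain ⟨c, hc⟩ := hC.1
    -- Removing this vertex from `C` preserves connectedness and what `C` sees; the last vertex that
    -- remains is adjacent to all of `Q`.
    obtain ⟨v, hv, hvQ, hsv⟩ := hH.exists_simplicial (C ∪ Q) Q
      (Finset.ssubset_iff_of_subset Finset.subset_union_right |>.2
        ⟨c, by simp [hc], Finset.disjoint_left.1 hd hc⟩) hQ
    have hvC : v ∈ C := (Finset.mem_union.1 hv).resolve_right hvQ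
    by_cases hne : C = {v}
    · refine ⟨v, hvC, fun x hx => ?_⟩
      obtain ⟨a, ha, hax⟩ := hs x hx
      rw [hne, Finset.mem_singleton] at ha
      exact ha ▸ hax
    · obtain ⟨c, hc, h⟩ := ih (C.erase v) (Finset.erase_ssubset hvC)
        (hC.erase_simplicial hvC (hsv.mono Finset.subset_union_left) hne)
        (hd.mono_left (Finset.erase_subset _ _))
        (fun x hx => hC.sees_erase Finset.subset_union_left hvC hne hsv (by simp [hx])
          (fun h => Finset.disjoint_left.1 hd h hx) (hs x hx))
      exact ⟨c, Finset.mem_of_mem_erase hc, h⟩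

theorem connOn_star {G : SimpleGraph V} {z : V} (𝒯 : Finset (Finset V))
    (h : ∀ C ∈ 𝒯, G.ConnOn C ∧ G.Sees C z) : G.ConnOn (insert z (𝒯.biUnion id)) := by
  induction 𝒯 using Finset.induction_on with
  | empty => simpa using G.connOn_singleton z
  | insert C 𝒯 _ ih =>
    obtain ⟨hC, a, ha, haz⟩ := h C (by simp)
    have := hC.union (ih fun D hD => h D (by simp [hD])) ha (Finset.mem_insert_self _ _) haz
    rwa [Finset.union_insert, ← id_eq C, ← Finset.biUnion_insert] at this

/-- `x` lies in `C` or in the part of `Ω` that `C` sees. -/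
def InClosed (G : SimpleGraph V) (Ω C : Finset V) (x : V) : Prop :=
  x ∈ C ∨ x ∈ Ω ∧ G.Sees C x

theorem IsCompOf.inClosed_of_adj {G : SimpleGraph V} {Ω C : Finset V} (h : G.IsCompOf Ω C)
    {x y : V} (hx : x ∈ C) (hxy : G.Adj x y) : G.InClosed Ω C y :=
  (h.2.2 x hx y hxy).imp id fun hy => ⟨hy, x, hx, hxy⟩

theorem IsCompOf.eq_of_inClosed {G : SimpleGraph V} {Ω C C' : Finset V} (h : G.IsCompOf Ω C)
    (h' : G.IsCompOf Ω C') {x : V} (hx : x ∈ C) (hx' : G.InClosed Ω C' x) : C' = C := by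
  rcases hx' with hx' | ⟨hx', _⟩
  · exact h'.eq_of_mem h hx' hx
  · exact absurd hx' (Finset.disjoint_left.1 h.2.1 hx)

/-- A component seeing all of `Ω` would contain a vertex extending the clique in `H`. A nonadjacent
pair without a common component would be a fill edge that can be spared, against minimality of `H`.
-/
theorem IsPotentialMaximalClique.cliquishNotFull {G : SimpleGraph V} {Ω : Finset V}
    (h : G.IsPotentialMaximalClique (Ω : Set V)) : G.CliquishNotFull Ω := by
  classical
  obtain ⟨H, hmin, hmax⟩ := h
  have hGH : G ≤ H := hmin.prop.1
  have hH : H.Chordal := hmin.prop.2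
  have hcl : H.IsClique (Ω : Set V) := hmax.prop
  refine ⟨fun C hC => ?_, fun u hu v hv huv hnadj => ?_⟩
  · by_contra hcon
    push Not at hcon
    obtain ⟨c, hc, hcx⟩ := hH.exists_dominating hcl C (hC.1.mono hGH) hC.2.1
      (fun x hx => by
        obtain ⟨a, ha, hax⟩ := hcon x hx
        exact ⟨a, ha, hGH hax⟩)
    have hcΩ := Finset.disjoint_left.1 hC.2.1 hc
    have : H.IsClique (insert c (Ω : Set V)) := hcl.insert fun b hb _ => hcx b hb
    exact hcΩ (hmax.le_of_ge this (Set.subset_insert _ _) (Set.mem_insert _ _))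
  · by_contra hcon
    push Not at hcon
    -- From `H`, drop the edge `uv` and every edge that lies neither in `Ω` nor in the union of one
    -- component with the part of `Ω` it sees. No edge of `G` is lost.
    let H' : SimpleGraph V :=
      { Adj := fun x y => H.Adj x y ∧
          ((∃ C, G.IsCompOf Ω C ∧ G.InClosed Ω C x ∧ G.InClosed Ω C y) ∨
            (x ∈ Ω ∧ y ∈ Ω ∧ s(x, y) ≠ s(u, v)))
        symm := ⟨fun x y ⟨h, h'⟩ => ⟨h.symm, h'.imp (fun ⟨C, h1, h2, h3⟩ => ⟨C, h1, h3, h2⟩)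
          (fun ⟨h1, h2, h3⟩ => ⟨h2, h1, by rwa [Sym2.eq_swap]⟩)⟩⟩
        loopless := ⟨fun x h => H.loopless.irrefl x h.1⟩ }
    have hΩ : ∀ x ∈ Ω, ∀ y ∈ Ω, x ≠ y → x ≠ u → y ≠ u → H'.Adj x y := by
      intro x hx y hy hxy hxu hyu
      refine ⟨hcl hx hy hxy, Or.inr ⟨hx, hy, fun h => ?_⟩⟩
      rcases Sym2.eq_iff.1 h with ⟨h, _⟩ | ⟨_, h⟩
      · exact hxu h
      · exact hyu h
    have huv' : ¬ H'.Adj u v := by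
      rintro ⟨_, ⟨C, hC, h1, h2⟩ | ⟨_, _, h⟩⟩
      · have hd := fun x (hx : x ∈ Ω) (hxC : x ∈ C) => Finset.disjoint_left.1 hC.2.1 hxC hx
        exact hcon C hC (h1.resolve_left (hd u hu)).2 (h2.resolve_left (hd v hv)).2
      · exact h rfl
    have hch : H'.Chordal := by
      refine chordal_of_simplicial fun S hS => ?_
      by_cases hSΩ : S ⊆ Ω
      · by_cases huS : u ∈ S
        · refine ⟨u, huS, fun a ha b hb hua hub hab => hΩ a (hSΩ ha) b (hSΩ hb) hab ?_ ?_⟩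
          · exact fun h => H'.loopless.irrefl u (h ▸ hua)
          · exact fun h => H'.loopless.irrefl u (h ▸ hub)
        · obtain ⟨x, hx⟩ := hS
          exact ⟨x, hx, fun a ha b hb _ _ hab => hΩ a (hSΩ ha) b (hSΩ hb) hab
            (fun h => huS (h ▸ ha)) (fun h => huS (h ▸ hb))⟩
      · obtain ⟨s, hsS, hsΩ⟩ := Finset.not_subset.1 hSΩ
        obtain ⟨C, hC, hsC⟩ := G.exists_isCompOf hsΩ
        -- Choosing the simplicial vertex outside the clique `Ω` places it in `C`. Its neighbours in
        -- `H'` then lie in `C` or in the part of `Ω` seen by `C`, where `H'` and `H` coincide.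
        obtain ⟨w, hw, hwQ, hsw⟩ := hH.exists_simplicial {x ∈ S | G.InClosed Ω C x}
          {x ∈ S | G.InClosed Ω C x ∧ x ∈ Ω}
          (Finset.ssubset_iff_of_subset (fun x hx => by
            simp only [Finset.mem_filter] at hx ⊢
            exact ⟨hx.1, hx.2.1⟩) |>.2 ⟨s, by
              simp only [Finset.mem_filter]
              exact ⟨hsS, Or.inl hsC⟩, by simp [hsΩ]⟩)
          (hcl.subset fun x hx => by
            have := (Finset.mem_filter.1 (Finset.mem_coe.1 hx)).2.2
            exact this)
        simp only [Finset.mem_filter, not_and] at hw hwQ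
        have hwΩ := hwQ hw.1 hw.2
        have hwC : w ∈ C := hw.2.resolve_right fun h => hwΩ h.1
        have hn : ∀ a, H'.Adj w a → G.InClosed Ω C a := by
          rintro a ⟨_, ⟨C', hC', h1, h2⟩ | ⟨h, _⟩⟩
          · rwa [hC.eq_of_inClosed hC' hwC h1] at h2
          · exact absurd h hwΩ
        refine ⟨w, hw.1, fun a ha b hb hwa hwb hab => ⟨?_, Or.inl ⟨C, hC, hn a hwa, hn b hwb⟩⟩⟩
        exact hsw a (by simp only [Finset.mem_filter]; exact ⟨ha, hn a hwa⟩) b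
          (by simp only [Finset.mem_filter]; exact ⟨hb, hn b hwb⟩) hwa.1 hwb.1 hab
    have hGH' : G ≤ H' := by
      intro x y hxy
      refine ⟨hGH hxy, ?_⟩
      by_cases hx : x ∈ Ω
      · by_cases hy : y ∈ Ω
        · refine Or.inr ⟨hx, hy, fun h => hnadj ?_⟩
          rcases Sym2.eq_iff.1 h with ⟨rfl, rfl⟩ | ⟨rfl, rfl⟩
          · exact hxy
          · exact hxy.symm
        · obtain ⟨C, hC, hyC⟩ := G.exists_isCompOf hy
          exact Or.inl ⟨C, hC, hC.inClosed_of_adj hyC hxy.symm, Or.inl hyC⟩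
      · obtain ⟨C, hC, hxC⟩ := G.exists_isCompOf hx
        exact Or.inl ⟨C, hC, Or.inl hxC, hC.inClosed_of_adj hxC hxy⟩
    exact huv' (hmin.le_of_le ⟨hGH', hch⟩ (fun x y h => h.1) (hcl hu hv huv))

open Classical in
/-- The components of `G - Ω` that see `w`, together with `w`. -/
noncomputable def star (G : SimpleGraph V) (Ω : Finset V) (w : V) : Finset V :=
  insert w (({C | G.IsCompOf Ω C ∧ G.Sees C w} : Finset (Finset V)).biUnion id)

theorem mem_star {G : SimpleGraph V} {Ω : Finset V} {w x : V} :
    x ∈ G.star Ω w ↔ x = w ∨ ∃ C, G.IsCompOf Ω C ∧ G.Sees C w ∧ x ∈ C := by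
  simp [star, and_assoc]

theorem connOn_star_self (G : SimpleGraph V) (Ω : Finset V) (w : V) : G.ConnOn (G.star Ω w) := by
  classical
  refine connOn_star _ fun C hC => ?_
  simp only [Finset.mem_filter, Finset.mem_univ, true_and] at hC
  exact ⟨hC.1.1, hC.2⟩

theorem CliquishNotFull.sees_star {G : SimpleGraph V} {Ω : Finset V} (h : G.CliquishNotFull Ω)
    {w x : V} (hw : w ∈ Ω) (hx : x ∈ Ω) (hne : x ≠ w) : G.Sees (G.star Ω w) x := by
  by_cases hadj : G.Adj w x
  · exact ⟨w, mem_star.2 (Or.inl rfl), hadj⟩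
  · obtain ⟨C, hC, hCw, a, ha, hax⟩ := h.2 w hw x hx hne.symm hadj
    exact ⟨a, mem_star.2 (Or.inr ⟨C, hC, hCw, ha⟩), hax⟩

/-- Take a minimal triangulation below the graph obtained by completing `Ω` and each component
together with what it sees. `Ω` remains a clique by `Chordal.adj_of_sees`, and it is maximal because
a vertex outside lies in a component that misses some vertex of `Ω`. -/
theorem CliquishNotFull.isPotentialMaximalClique {G : SimpleGraph V} {Ω : Finset V}
    (h : G.CliquishNotFull Ω) : G.IsPotentialMaximalClique (Ω : Set V) := by
  classical
  let H₀ : SimpleGraph V :=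
    { Adj := fun x y => x ≠ y ∧ ((x ∈ Ω ∧ y ∈ Ω) ∨
        ∃ C, G.IsCompOf Ω C ∧ G.InClosed Ω C x ∧ G.InClosed Ω C y)
      symm := ⟨fun x y ⟨h, h'⟩ => ⟨h.symm, h'.imp (fun ⟨a, b⟩ => ⟨b, a⟩)
        (fun ⟨C, h1, h2, h3⟩ => ⟨C, h1, h3, h2⟩)⟩⟩
      loopless := ⟨fun x h => h.1 rfl⟩ }
  have hn : ∀ {C x y}, G.IsCompOf Ω C → x ∈ C → H₀.Adj x y → G.InClosed Ω C y := by
    rintro C x y hC hx ⟨_, ⟨hxΩ, _⟩ | ⟨C', hC', h1, h2⟩⟩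
    · exact absurd hxΩ (Finset.disjoint_left.1 hC.2.1 hx)
    · rwa [hC.eq_of_inClosed hC' hx h1] at h2
  have htri : G.IsTriangulation H₀ := by
    refine ⟨fun x y hxy => ⟨hxy.ne, ?_⟩, chordal_of_simplicial fun S hS => ?_⟩
    · by_cases hx : x ∈ Ω
      · by_cases hy : y ∈ Ω
        · exact Or.inl ⟨hx, hy⟩
        · obtain ⟨C, hC, hyC⟩ := G.exists_isCompOf hy
          exact Or.inr ⟨C, hC, hC.inClosed_of_adj hyC hxy.symm, Or.inl hyC⟩
      · obtain ⟨C, hC, hxC⟩ := G.exists_isCompOf hx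
        exact Or.inr ⟨C, hC, Or.inl hxC, hC.inClosed_of_adj hxC hxy⟩
    · by_cases hSΩ : S ⊆ Ω
      · obtain ⟨x, hx⟩ := hS
        exact ⟨x, hx, fun a ha b hb _ _ hab => ⟨hab, Or.inl ⟨hSΩ ha, hSΩ hb⟩⟩⟩
      · obtain ⟨s, hsS, hsΩ⟩ := Finset.not_subset.1 hSΩ
        obtain ⟨C, hC, hsC⟩ := G.exists_isCompOf hsΩ
        exact ⟨s, hsS, fun a _ b _ hsa hsb hab =>
          ⟨hab, Or.inr ⟨C, hC, hn hC hsC hsa, hn hC hsC hsb⟩⟩⟩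
  obtain ⟨H, hle, hmin⟩ := exists_minimal_le_of_wellFoundedLT G.IsTriangulation H₀ htri
  have hGH : G ≤ H := hmin.prop.1
  have hsee : ∀ {C x}, G.Sees C x → H.Sees C x := fun ⟨a, ha, hax⟩ => ⟨a, ha, hGH hax⟩
  have hcl : H.IsClique (Ω : Set V) := by
    intro u hu v hv huv
    by_cases hadj : G.Adj u v
    · exact hGH hadj
    obtain ⟨C, hC, hCu, hCv⟩ := h.2 u hu v hv huv hadj
    obtain ⟨w, hw, hCw⟩ := h.1 C hC
    have hwu : u ≠ w := fun h => hCw (h ▸ hCu)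
    have hwv : v ≠ w := fun h => hCw (h ▸ hCv)
    have hstar : ∀ x ∈ Ω, x ≠ w → x ∉ G.star Ω w := by
      intro x hx hxw hmem
      rcases mem_star.1 hmem with h | ⟨D, hD, _, hxD⟩
      · exact hxw h
      · exact Finset.disjoint_left.1 hD.2.1 hxD hx
    have hCΩ : ∀ x ∈ Ω, x ∉ C := fun x hx hxC => Finset.disjoint_left.1 hC.2.1 hxC hx
    -- As `C` misses `w`, it is not part of the star of `w`, and `H₀` has no edge between the two
    -- sets. Both are connected and see `u` and `v`.
    refine hmin.prop.2.adj_of_sees huv _ C (G.star Ω w) rfl (hC.1.mono hGH)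
      ((G.connOn_star_self Ω w).mono hGH) (hCΩ u hu) (hstar u hu hwu) (hCΩ v hv)
      (hstar v hv hwv) ?_ (hsee hCu) (hsee hCv) (hsee (h.sees_star hw hu hwu))
      (hsee (h.sees_star hw hv hwv))
    intro a ha b hb
    have hbC : ¬ G.InClosed Ω C b := by
      rcases mem_star.1 hb with rfl | ⟨D, hD, hDw, hbD⟩
      · rintro (h | h)
        · exact hCΩ b hw h
        · exact hCw h.2
      · intro hcl
        have := hD.eq_of_inClosed hC hbD hcl
        exact hCw (this ▸ hDw)
    exact ⟨fun hab => hbC (Or.inl (hab ▸ ha)), fun hab => hbC (hn hC ha (hle hab))⟩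
  refine ⟨H, hmin, hcl, fun T hT hΩT x hx => ?_⟩
  by_contra hxΩ
  obtain ⟨C, hC, hxC⟩ := G.exists_isCompOf (Ω := Ω) (v := x) hxΩ
  obtain ⟨w, hw, hCw⟩ := h.1 C hC
  have hxw : x ≠ w := fun h => hxΩ (h ▸ hw)
  rcases hn hC hxC (hle (hT hx (hΩT hw) hxw)) with h | h
  · exact Finset.disjoint_left.1 hC.2.1 h hw
  · exact hCw h.2

theorem isPotentialMaximalClique_iff {G : SimpleGraph V} {Ω : Finset V} :
    G.IsPotentialMaximalClique (Ω : Set V) ↔ G.CliquishNotFull Ω :=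
  ⟨fun h => h.cliquishNotFull, fun h => h.isPotentialMaximalClique⟩

end SimpleGraph

/-! ### Entropy bounds for products of binomial coefficients -/

/-- The binomial coefficient times `p ^ x * q ^ y` is one term of the expansion of `(p + q) ^ (x +
y) = 1`. The weights are free, so each use below picks numerical values that make the bound linear.
-/
theorem log_choose_le {p q : ℝ} (hp : 0 < p) (hq : 0 < q) (hpq : p + q = 1) (x y : ℕ) :
    Real.log ((x + y).choose x) ≤ x * -Real.log p + y * -Real.log q := by
  have h1 : p ^ x * q ^ y * ((x + y).choose x : ℝ) ≤ 1 := by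
    have h := add_pow p q (x + y)
    rw [hpq, one_pow] at h
    rw [h]
    have := Finset.single_le_sum
      (f := fun m => p ^ m * q ^ (x + y - m) * ((x + y).choose m : ℝ))
      (s := Finset.range (x + y + 1)) (fun m _ => by positivity)
      (Finset.mem_range.2 (show x < x + y + 1 by omega))
    simpa using this
  have hc : (0 : ℝ) < (x + y).choose x := by exact_mod_cast Nat.choose_pos (by omega)
  have h2 := Real.log_le_log (by positivity) h1
  rw [Real.log_mul (by positivity) hc.ne', Real.log_mul (by positivity) (by positivity),
    Real.log_pow, Real.log_pow, Real.log_one] at h2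
  linarith

/-- The base of the exponential bound on the number of codes. -/
noncomputable def codeBase : ℝ := 17346009 / 10000000

theorem le_codeBase_pow {N n : ℕ} (hN : 0 < N) (h : Real.log N ≤ n * Real.log codeBase) :
    (N : ℝ) ≤ codeBase ^ n := by
  have hb : (0 : ℝ) < codeBase := by norm_num [codeBase]
  rw [← Real.log_pow] at h
  exact (Real.log_le_log_iff (by exact_mod_cast hN) (by positivity)).1 h

theorem log_codeBase_nonneg : 0 ≤ Real.log codeBase :=
  Real.log_nonneg (by norm_num [codeBase])

/-- Turns `1 ≤ x ^ k * y ^ l * codeBase ^ j` into a linear inequality between logarithms. -/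
theorem log_ineq {x y : ℝ} (hx : 0 < x) (hy : 0 < y) {k l j : ℕ}
    (h : 1 ≤ x ^ k * y ^ l * codeBase ^ j) :
    k * -Real.log x + l * -Real.log y ≤ j * Real.log codeBase := by
  have hb : (0 : ℝ) < codeBase := by norm_num [codeBase]
  have := Real.log_nonneg h
  rw [Real.log_mul (by positivity) (by positivity), Real.log_mul (by positivity) (by positivity),
    Real.log_pow, Real.log_pow, Real.log_pow] at this
  linarith

theorem neg_log_nonneg {x : ℝ} (hx : 0 < x) (h : x ≤ 1) : 0 ≤ -Real.log x := by
  have := Real.log_nonpos hx.le h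
  linarith

/-- The weight `0.5766` lies just above `1 / codeBase`, so one unit of `j` costs at most one vertex;
`0.4234` is its complement, and five units of `i` then cost at most eight vertices. -/
theorem choose_le_codeBase_pow {i j m f n : ℕ} (hi : 8 * i ≤ 5 * m) (hj : j ≤ f) (hn : m + f ≤ n) :
    ((i + j).choose i : ℝ) ≤ codeBase ^ n := by
  refine le_codeBase_pow (Nat.choose_pos (by omega)) ?_
  have h := log_choose_le (p := 0.4234) (q := 0.5766) (by norm_num) (by norm_num) (by norm_num) i j
  have ha := log_ineq (x := 0.4234) (y := 1) (k := 5) (l := 0) (j := 8) (by norm_num) (by norm_num)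
    (by norm_num [codeBase])
  have hb := log_ineq (x := 0.5766) (y := 1) (k := 1) (l := 0) (j := 1) (by norm_num) (by norm_num)
    (by norm_num [codeBase])
  have ha0 := neg_log_nonneg (x := 0.4234) (by norm_num) (by norm_num)
  have hb0 := neg_log_nonneg (x := 0.5766) (by norm_num) (by norm_num)
  have hL := log_codeBase_nonneg
  generalize -Real.log 0.4234 = a at *
  generalize -Real.log 0.5766 = b at *
  generalize Real.log codeBase = L at *
  have hi' : (8 * i : ℝ) ≤ 5 * m := by exact_mod_cast hi
  have hj' : (j : ℝ) ≤ f := by exact_mod_cast hj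
  have hn' : (m + f : ℝ) ≤ n := by exact_mod_cast hn
  norm_num at ha hb
  have h1 := mul_le_mul_of_nonneg_right hi' ha0
  have h2 := mul_le_mul_of_nonneg_right hj' hb0
  have h3 := mul_le_mul_of_nonneg_right hn' hL
  have h4 := mul_le_mul_of_nonneg_left ha (Nat.cast_nonneg (α := ℝ) m)
  have h5 := mul_le_mul_of_nonneg_left hb (Nat.cast_nonneg (α := ℝ) f)
  linarith

/-- By Vandermonde's identity the product is at most the single coefficient `(i + i' + (j +
j')).choose (i + i')`. -/
theorem choose_mul_choose_le_of_small {i j i' j' m f n : ℕ} (hi : 8 * (i + i') ≤ 5 * m)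
    (hj : j + j' ≤ f) (hn : m + f ≤ n) :
    (((i + j).choose i * (i' + j').choose i' : ℕ) : ℝ) ≤ codeBase ^ n := by
  refine le_trans ?_ (choose_le_codeBase_pow hi hj hn)
  rw [show i + i' + (j + j') = (i + j) + (i' + j') by ring,
    Nat.add_choose_eq (i + j) (i' + j') (i + i')]
  have := Finset.single_le_sum (f := fun ij : ℕ × ℕ => (i + j).choose ij.1 * (i' + j').choose ij.2)
    (s := Finset.HasAntidiagonal.antidiagonal (i + i')) (fun _ _ => Nat.zero_le _)
    (Finset.HasAntidiagonal.mem_antidiagonal.2 (show (i, i').1 + (i, i').2 = i + i' from rfl))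
  exact_mod_cast this

/-- Among three cyclic pairs, one has a small product of binomial coefficients. -/
theorem exists_choose_mul_choose_le {m f n : ℕ} {c s t : Fin 3 → ℕ}
    (hc : c 0 + c 1 + c 2 ≤ m) (hst : ∀ k, s k + t k = f) (ht : t 0 + t 1 + t 2 ≤ f)
    (hn : m + f ≤ n) :
    ∃ k : Fin 3, (((c k + s k).choose (c k) * (c (k + 1) + t k).choose (c (k + 1)) : ℕ) : ℝ) ≤
      codeBase ^ n := by
  have key : ∃ k : Fin 3, Real.log (((c k + s k).choose (c k) *
      (c (k + 1) + t k).choose (c (k + 1)) : ℕ) : ℝ) ≤ n * Real.log codeBase := by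
    by_contra hcon
    push Not at hcon
    -- The three bounds are added up: each `c k` occurs once in a first and once in a second factor,
    -- and the `t k` sum to at most `f`. With these weights both `0.3611 * 0.5306081 * codeBase ^ 3`
    -- and `0.6389 ^ 2 * 0.4693919 * codeBase ^ 3` barely exceed `1`; this is the tight case that
    -- fixes the value of `codeBase`.
    have hpos : ∀ k : Fin 3, Real.log (((c k + s k).choose (c k) *
        (c (k + 1) + t k).choose (c (k + 1)) : ℕ) : ℝ) ≤
        (c k * -Real.log 0.3611 + s k * -Real.log 0.6389) +
        (c (k + 1) * -Real.log 0.5306081 + t k * -Real.log 0.4693919) := by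
      intro k
      have h1 : (0 : ℝ) < (c k + s k).choose (c k) := by
        exact_mod_cast Nat.choose_pos (by omega)
      have h2 : (0 : ℝ) < (c (k + 1) + t k).choose (c (k + 1)) := by
        exact_mod_cast Nat.choose_pos (by omega)
      rw [Nat.cast_mul, Real.log_mul h1.ne' h2.ne']
      exact add_le_add (log_choose_le (by norm_num) (by norm_num) (by norm_num) _ _)
        (log_choose_le (by norm_num) (by norm_num) (by norm_num) _ _)
    have ha := log_ineq (x := 0.3611) (y := 0.5306081) (k := 1) (l := 1) (j := 3) (by norm_num)
      (by norm_num) (by norm_num [codeBase])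
    have hb := log_ineq (x := 0.6389) (y := 0.4693919) (k := 2) (l := 1) (j := 3) (by norm_num)
      (by norm_num) (by norm_num [codeBase])
    have hbb : Real.log 0.4693919 ≤ Real.log 0.6389 := Real.log_le_log (by norm_num) (by norm_num)
    have h0 := (hcon 0).trans_le (hpos 0)
    have h1 := (hcon 1).trans_le (hpos 1)
    have h2 := (hcon 2).trans_le (hpos 2)
    have hL := log_codeBase_nonneg
    have ha1 := neg_log_nonneg (x := 0.3611) (by norm_num) (by norm_num)
    have ha2 := neg_log_nonneg (x := 0.5306081) (by norm_num) (by norm_num)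
    generalize Real.log codeBase = L at *
    generalize Real.log 0.3611 = a₁ at *
    generalize Real.log 0.6389 = b₁ at *
    generalize Real.log 0.5306081 = a₂ at *
    generalize Real.log 0.4693919 = b₂ at *
    rw [show (0 : Fin 3) + 1 = 1 from rfl] at h0
    rw [show (1 : Fin 3) + 1 = 2 from rfl] at h1
    rw [show (2 : Fin 3) + 1 = 0 from rfl] at h2
    have hs : ∀ k, (s k : ℝ) = f - t k := fun k => by
      have := hst k
      rw [eq_sub_iff_add_eq]
      exact_mod_cast this
    rw [hs] at h0 h1 h2
    have hc' : (c 0 + c 1 + c 2 : ℝ) ≤ m := by exact_mod_cast hc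
    have ht' : (t 0 + t 1 + t 2 : ℝ) ≤ f := by exact_mod_cast ht
    have hn' : (m + f : ℝ) ≤ n := by exact_mod_cast hn
    norm_num at ha hb
    have e1 := mul_le_mul_of_nonneg_right hc' (add_nonneg ha1 ha2)
    have e2 := mul_le_mul_of_nonneg_right ht' (sub_nonneg.2 hbb)
    have e3 := mul_le_mul_of_nonneg_right hn' hL
    have e4 := mul_le_mul_of_nonneg_left ha (Nat.cast_nonneg (α := ℝ) m)
    have e5 := mul_le_mul_of_nonneg_left hb (Nat.cast_nonneg (α := ℝ) f)
    linarith
  obtain ⟨k, hk⟩ := key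
  exact ⟨k, le_codeBase_pow (Nat.mul_pos (Nat.choose_pos (by omega)) (Nat.choose_pos (by omega))) hk⟩

/-- The number `p` counts in both of the first two hypotheses, so its weight may cost as much as
those of `c` and `x` together: `0.33 ≥ 0.4234 * 0.56`. The expensive units of `u` are each grouped
with two cheap units of `t`. -/
theorem choose_mul_choose_mul_choose_le {c p x m f s t u n : ℕ} (hcp : 8 * (c + p) ≤ 3 * m)
    (hx : 8 * (x + p) ≤ 3 * m) (hst : s + t + u ≤ f) (hu : 2 * u ≤ t) (hn : m + f ≤ n) :
    (((c + s).choose c * (p + t).choose p * (x + u).choose x : ℕ) : ℝ) ≤ codeBase ^ n := by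
  have p1 : 0 < (c + s).choose c := Nat.choose_pos (by omega)
  have p2 : 0 < (p + t).choose p := Nat.choose_pos (by omega)
  have p3 : 0 < (x + u).choose x := Nat.choose_pos (by omega)
  refine le_codeBase_pow (by positivity) ?_
  push_cast
  rw [Real.log_mul (by positivity) (by positivity), Real.log_mul (by positivity) (by positivity)]
  have h1 := log_choose_le (p := 0.4234) (q := 0.5766) (by norm_num) (by norm_num) (by norm_num) c s
  have h2 := log_choose_le (p := 0.33) (q := 0.67) (by norm_num) (by norm_num) (by norm_num) p t
  have h3 := log_choose_le (p := 0.56) (q := 0.44) (by norm_num) (by norm_num) (by norm_num) x u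
  have ha := log_ineq (x := 0.4234) (y := 0.56) (k := 3) (l := 3) (j := 8) (by norm_num)
    (by norm_num) (by norm_num [codeBase])
  have hb := log_ineq (x := 0.5766) (y := 1) (k := 1) (l := 0) (j := 1) (by norm_num) (by norm_num)
    (by norm_num [codeBase])
  have hb2 := log_ineq (x := 0.67) (y := 0.44) (k := 2) (l := 1) (j := 3) (by norm_num)
    (by norm_num) (by norm_num [codeBase])
  have hb3 := log_ineq (x := 0.67) (y := 1) (k := 1) (l := 0) (j := 1) (by norm_num) (by norm_num)
    (by norm_num [codeBase])
  have hpp : Real.log 0.4234 + Real.log 0.56 ≤ Real.log 0.33 := by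
    rw [← Real.log_mul (by norm_num) (by norm_num)]
    exact Real.log_le_log (by norm_num) (by norm_num)
  have ha1 := neg_log_nonneg (x := 0.4234) (by norm_num) (by norm_num)
  have ha3 := neg_log_nonneg (x := 0.56) (by norm_num) (by norm_num)
  have hL := log_codeBase_nonneg
  generalize Real.log codeBase = L at *
  generalize Real.log 0.4234 = a₁ at *
  generalize Real.log 0.5766 = b₁ at *
  generalize Real.log 0.33 = a₂ at *
  generalize Real.log 0.67 = b₂ at *
  generalize Real.log 0.56 = a₃ at *
  generalize Real.log 0.44 = b₃ at *
  have hcp' : (8 * (c + p) : ℝ) ≤ 3 * m := by exact_mod_cast hcp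
  have hx' : (8 * (x + p) : ℝ) ≤ 3 * m := by exact_mod_cast hx
  have hst' : (s + t + u : ℝ) ≤ f := by exact_mod_cast hst
  have hu' : (2 * u : ℝ) ≤ t := by exact_mod_cast hu
  have hn' : (m + f : ℝ) ≤ n := by exact_mod_cast hn
  norm_num at ha hb hb2 hb3
  have e1 := mul_le_mul_of_nonneg_right hcp' ha1
  have e2 := mul_le_mul_of_nonneg_right hx' ha3
  have e3 := mul_le_mul_of_nonneg_right hn' hL
  have e4 := mul_le_mul_of_nonneg_right hst' hL
  have e5 := mul_le_mul_of_nonneg_left ha (Nat.cast_nonneg (α := ℝ) m)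
  have e6 := mul_le_mul_of_nonneg_left hb (Nat.cast_nonneg (α := ℝ) s)
  have e7 := mul_le_mul_of_nonneg_left hb2 (Nat.cast_nonneg (α := ℝ) u)
  have e8 : (t - 2 * u : ℝ) * -b₂ ≤ (t - 2 * u) * L :=
    mul_le_mul_of_nonneg_left (by linarith) (by linarith)
  have e9 := mul_le_mul_of_nonneg_left hpp (Nat.cast_nonneg (α := ℝ) p)
  linarith

/-! ### Short descriptions of potential maximal cliques. -/

namespace SimpleGraph

section Encoding

variable {V : Type*} [Fintype V] [DecidableEq V]

open scoped Classical

/-- The neighbourhood of a vertex set. -/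
noncomputable def nbr (G : SimpleGraph V) (D : Finset V) : Finset V :=
  {u | u ∉ D ∧ G.Sees D u}

theorem mem_nbr {G : SimpleGraph V} {D : Finset V} {u : V} :
    u ∈ G.nbr D ↔ u ∉ D ∧ G.Sees D u := by
  simp [nbr]

/-- `Ω` satisfies the conditions of `CliquishNotFull` in the graph `G - W`. -/
def CliquishNotFullIn (G : SimpleGraph V) (W Ω : Finset V) : Prop :=
  Disjoint Ω W ∧ (∀ C, G.IsCompOf (Ω ∪ W) C → ∃ x ∈ Ω, ¬ G.Sees C x) ∧
    ∀ u ∈ Ω, ∀ v ∈ Ω, u ≠ v → ¬ G.Adj u v → ∃ C, G.IsCompOf (Ω ∪ W) C ∧ G.Sees C u ∧ G.Sees C v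

theorem cliquishNotFullIn_empty {G : SimpleGraph V} {Ω : Finset V} :
    G.CliquishNotFullIn ∅ Ω ↔ G.CliquishNotFull Ω := by
  simp [CliquishNotFullIn, CliquishNotFull]

/-- Let `C` be the component of `a` for `Ω`, and let `x` in `Ω` be missed by it. Any component for
`insert a Ω` that sees `a` is contained in `C`, so `a` and `x` are neither adjacent nor seen in
common. This makes the reinsertion of deleted vertices deterministic. -/
theorem CliquishNotFullIn.not_insert {G : SimpleGraph V} {W Ω : Finset V} {a : V}
    (haΩ : a ∉ Ω) (haW : a ∉ W) (h : G.CliquishNotFullIn W Ω) :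
    ¬ G.CliquishNotFullIn W (insert a Ω) := by
  intro h'
  obtain ⟨C, hC, haC⟩ := G.exists_isCompOf (Ω := Ω ∪ W) (v := a) (by simp [haΩ, haW])
  obtain ⟨x, hx, hCx⟩ := h.2.1 C hC
  by_cases hadj : G.Adj a x
  · exact hCx ⟨a, haC, hadj⟩
  · obtain ⟨C', hC', ⟨b, hb, hba⟩, d, hd, hdx⟩ := h'.2.2 a (by simp) x (by simp [hx])
      (fun e => haΩ (e ▸ hx)) hadj
    have hC'Ω : ∀ v ∈ C', v ∉ Ω ∪ W := fun v hv hv' =>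
      Finset.disjoint_left.1 hC'.2.1 hv (by
        rw [Finset.insert_union]
        exact Finset.mem_insert_of_mem hv')
    have hbC : b ∈ C := (hC.2.2 a haC b hba.symm).resolve_right (hC'Ω b hb)
    have hsub : C' ⊆ C := hC'.1.subset_of_closed ⟨b, hb, hbC⟩ fun p _ hp q hq hpq =>
      (hC.2.2 p hp q hpq).resolve_right (hC'Ω q hq)
    exact hCx ⟨d, hsub hd, hdx⟩

/-- `D` is a connected set grown from its vertex `z` outside of `X`, and `F` is the part of its
neighbourhood outside of `X`. -/
def Stage (G : SimpleGraph V) (X : Finset V) (z : V) (D F : Finset V) (i j : ℕ) : Prop :=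
  G.ConnOn D ∧ z ∈ D ∧ (∀ v ∈ D, v ≠ z → v ∉ X) ∧ F = G.nbr D \ X ∧ D.card = i + 1 ∧ F.card = j

/-- An empty exploration, used to pad shorter descriptions to three stages at the cost of a factor
`1`. The starting vertex is itself allowed to be forbidden. -/
theorem stage_singleton {G : SimpleGraph V} {X : Finset V} {z : V}
    (h : ∀ u, G.Adj z u → u ∈ X) : G.Stage X z {z} ∅ 0 0 := by
  refine ⟨G.connOn_singleton z, by simp, by simp, ?_, by simp, by simp⟩
  symm
  rw [Finset.sdiff_eq_empty_iff_subset]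
  intro u hu
  obtain ⟨_, a, ha, hau⟩ := mem_nbr.1 hu
  rw [Finset.mem_singleton] at ha
  exact h u (ha ▸ hau)

/-- The number of codes of the given shape. -/
def codeCount (i₁ j₁ i₂ j₂ i₃ j₃ : ℕ) : ℕ :=
  (i₁ + j₁).choose i₁ * (i₂ + j₂).choose i₂ * (i₃ + j₃).choose i₃

/-- `Ω` is described by three connected sets, grown one after the other, and one of its
vertices, and there are few descriptions of this shape. -/
def HasCode (G : SimpleGraph V) (W Ω : Finset V) : Prop :=
  ∃ (z₁ z₂ z₃ e : V) (D₁ F₁ D₂ F₂ D₃ F₃ : Finset V) (i₁ j₁ i₂ j₂ i₃ j₃ : ℕ),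
    G.Stage W z₁ D₁ F₁ i₁ j₁ ∧ G.Stage (W ∪ (D₁ ∪ F₁)) z₂ D₂ F₂ i₂ j₂ ∧
    G.Stage (W ∪ (D₁ ∪ F₁) ∪ (D₂ ∪ F₂)) z₃ D₃ F₃ i₃ j₃ ∧
    Ω = insert e (F₁ ∪ F₂ ∪ F₃) ∧
    (codeCount i₁ j₁ i₂ j₂ i₃ j₃ : ℝ) ≤ codeBase ^ Fintype.card V

theorem Stage.adj_mem {G : SimpleGraph V} {X : Finset V} {z : V} {D F : Finset V} {i j : ℕ}
    (h : G.Stage X z D F i j) {u : V} (hu : G.Adj z u) : u ∈ X ∪ (D ∪ F) := by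
  obtain ⟨_, hz, _, hF, _⟩ := h
  by_cases hD : u ∈ D
  · simp [hD]
  by_cases hX : u ∈ X
  · simp [hX]
  have : u ∈ F := by
    rw [hF, Finset.mem_sdiff, mem_nbr]
    exact ⟨⟨hD, z, hz, hu⟩, hX⟩
  simp [this]

theorem HasCode.of_two {G : SimpleGraph V} {W Ω : Finset V} {z₁ z₂ e : V}
    {D₁ F₁ D₂ F₂ : Finset V} {i₁ j₁ i₂ j₂ : ℕ} (h₁ : G.Stage W z₁ D₁ F₁ i₁ j₁)
    (h₂ : G.Stage (W ∪ (D₁ ∪ F₁)) z₂ D₂ F₂ i₂ j₂) (hΩ : Ω = insert e (F₁ ∪ F₂))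
    (hc : (((i₁ + j₁).choose i₁ * (i₂ + j₂).choose i₂ : ℕ) : ℝ) ≤ codeBase ^ Fintype.card V) :
    G.HasCode W Ω := by
  refine ⟨z₁, z₂, z₁, e, D₁, F₁, D₂, F₂, {z₁}, ∅, i₁, j₁, i₂, j₂, 0, 0, h₁, h₂,
    stage_singleton fun u hu => Finset.mem_union_left _ (h₁.adj_mem hu), by simpa using hΩ, ?_⟩
  simpa [codeCount] using hc

theorem HasCode.of_one {G : SimpleGraph V} {W Ω : Finset V} {z₁ e : V}
    {D₁ F₁ : Finset V} {i₁ j₁ : ℕ} (h₁ : G.Stage W z₁ D₁ F₁ i₁ j₁)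
    (hΩ : Ω = insert e F₁) (hc : ((i₁ + j₁).choose i₁ : ℝ) ≤ codeBase ^ Fintype.card V) :
    G.HasCode W Ω :=
  HasCode.of_two h₁ (stage_singleton fun _ hu => h₁.adj_mem hu) (e := e) (by simpa using hΩ)
    (by simpa using hc)

/-- The vertices of the components of `G - U` that see `z`. -/
noncomputable def seenBy (G : SimpleGraph V) (U : Finset V) (z : V) : Finset V :=
  {v | ∃ C, G.IsCompOf U C ∧ G.Sees C z ∧ v ∈ C}

theorem mem_seenBy {G : SimpleGraph V} {U : Finset V} {z v : V} :
    v ∈ G.seenBy U z ↔ ∃ C, G.IsCompOf U C ∧ G.Sees C z ∧ v ∈ C := by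
  simp [seenBy]

theorem IsCompOf.mem_seenBy {G : SimpleGraph V} {U C : Finset V} (hC : G.IsCompOf U C) {z v : V}
    (hv : v ∈ C) : v ∈ G.seenBy U z ↔ G.Sees C z := by
  rw [SimpleGraph.mem_seenBy]
  constructor
  · rintro ⟨C', hC', hz, hv'⟩
    rwa [hC.eq_of_mem hC' hv hv']
  · exact fun h => ⟨C, hC, h, hv⟩

theorem IsCompOf.subset_seenBy {G : SimpleGraph V} {U C : Finset V} (hC : G.IsCompOf U C) {z : V}
    (h : G.Sees C z) : C ⊆ G.seenBy U z := fun _ hv => (hC.mem_seenBy hv).2 h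

theorem IsCompOf.disjoint_seenBy {G : SimpleGraph V} {U C : Finset V} (hC : G.IsCompOf U C) {z : V}
    (h : ¬ G.Sees C z) : Disjoint C (G.seenBy U z) :=
  Finset.disjoint_left.2 fun _ hv hv' => h ((hC.mem_seenBy hv).1 hv')

theorem seenBy_subset {G : SimpleGraph V} {U : Finset V} {z : V} : G.seenBy U z ⊆ Uᶜ := by
  intro v hv
  obtain ⟨C, hC, _, hvC⟩ := mem_seenBy.1 hv
  exact Finset.mem_compl.2 (Finset.disjoint_left.1 hC.2.1 hvC)

/-- The part of `Ω` that `C` sees. -/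
noncomputable def seenIn (G : SimpleGraph V) (Ω C : Finset V) : Finset V :=
  {x ∈ Ω | G.Sees C x}

theorem mem_seenIn {G : SimpleGraph V} {Ω C : Finset V} {x : V} :
    x ∈ G.seenIn Ω C ↔ x ∈ Ω ∧ G.Sees C x := by
  simp [seenIn]

theorem seenIn_subset {G : SimpleGraph V} {Ω C : Finset V} : G.seenIn Ω C ⊆ Ω :=
  Finset.filter_subset _ _

theorem IsCompOf.nbr_sdiff {G : SimpleGraph V} {W Ω C : Finset V} (hC : G.IsCompOf (Ω ∪ W) C)
    (hd : Disjoint Ω W) : G.nbr C \ W = G.seenIn Ω C := by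
  ext x
  rw [Finset.mem_sdiff, mem_nbr, mem_seenIn]
  constructor
  · rintro ⟨⟨hxC, a, ha, hax⟩, hxW⟩
    have := (hC.2.2 a ha x hax).resolve_left hxC
    exact ⟨(Finset.mem_union.1 this).resolve_right hxW, a, ha, hax⟩
  · rintro ⟨hx, hs⟩
    exact ⟨⟨fun h => Finset.disjoint_left.1 hC.2.1 h (by simp [hx]), hs⟩,
      Finset.disjoint_left.1 hd hx⟩

theorem IsCompOf.stage {G : SimpleGraph V} {W Ω C : Finset V} (hC : G.IsCompOf (Ω ∪ W) C)
    (hd : Disjoint Ω W) : ∃ z, G.Stage W z C (G.seenIn Ω C) (C.card - 1) (G.seenIn Ω C).card := by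
  obtain ⟨z, hz⟩ := hC.1.1
  refine ⟨z, hC.1, hz, fun v hv _ hvW => ?_, (hC.nbr_sdiff hd).symm, ?_, rfl⟩
  · exact Finset.disjoint_left.1 hC.2.1 hv (by simp [hvW])
  · have := Finset.card_pos.2 ⟨z, hz⟩
    omega

/-- With `C` and its neighbourhood forbidden, a second component pays only for the vertices of `Ω`
that `C` does not see. -/
theorem IsCompOf.stage_of_ne {G : SimpleGraph V} {W Ω C P : Finset V} (hC : G.IsCompOf (Ω ∪ W) C)
    (hP : G.IsCompOf (Ω ∪ W) P) (hne : P ≠ C) (hd : Disjoint Ω W) :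
    ∃ z, G.Stage (W ∪ (C ∪ G.seenIn Ω C)) z P (G.seenIn Ω P \ G.seenIn Ω C) (P.card - 1)
      (G.seenIn Ω P \ G.seenIn Ω C).card := by
  obtain ⟨z, hz⟩ := hP.1.1
  refine ⟨z, hP.1, hz, fun v hv _ hvW => ?_, ?_, ?_, rfl⟩
  · have h1 := Finset.disjoint_left.1 hP.2.1 hv
    simp only [Finset.mem_union, not_or] at h1 hvW
    rcases hvW with h | h | h
    · exact h1.2 h
    · exact hne (hP.eq_of_mem hC hv h)
    · exact h1.1 (seenIn_subset h)
  · rw [← hP.nbr_sdiff hd]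
    ext x
    simp only [Finset.mem_sdiff, Finset.mem_union]
    constructor
    · rintro ⟨⟨h1, h2⟩, h3⟩
      refine ⟨h1, ?_⟩
      rintro (h | h | h)
      · exact h2 h
      · have hx : x ∈ G.seenIn Ω P := by
          rw [← hP.nbr_sdiff hd, Finset.mem_sdiff]
          exact ⟨h1, h2⟩
        exact Finset.disjoint_left.1 hC.2.1 h (by simp [seenIn_subset hx])
      · exact h3 h
    · rintro ⟨h1, h2⟩
      exact ⟨⟨h1, fun h => h2 (Or.inl h)⟩, fun h => h2 (Or.inr (Or.inr h))⟩
  · have := Finset.card_pos.2 ⟨z, hz⟩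
    omega

variable {G : SimpleGraph V} {W Ω : Finset V}

theorem card_compl_add_card_le : (Ω ∪ W)ᶜ.card + Ω.card ≤ Fintype.card V := by
  rw [Finset.card_compl]
  have h1 := Finset.card_le_univ (Ω ∪ W)
  have h2 := Finset.card_le_card (Finset.subset_union_left (s₁ := Ω) (s₂ := W))
  omega

theorem connOn_insert_seenBy (U : Finset V) (z : V) : G.ConnOn (insert z (G.seenBy U z)) := by
  have : insert z (G.seenBy U z) = G.star U z := by
    ext v
    rw [Finset.mem_insert, mem_seenBy, mem_star]
  rw [this]
  exact G.connOn_star_self U z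

/-- A vertex of `Ω` that is seen by few components yields a code. -/
theorem CliquishNotFullIn.hasCode_of_seenBy (h : G.CliquishNotFullIn W Ω) {z : V} (hz : z ∈ Ω)
    (hs : 8 * (G.seenBy (Ω ∪ W) z).card ≤ 5 * (Ω ∪ W)ᶜ.card) : G.HasCode W Ω := by
  have hΩs : ∀ x ∈ Ω ∪ W, x ∉ G.seenBy (Ω ∪ W) z := fun x hx hx' =>
    Finset.mem_compl.1 (seenBy_subset hx') hx
  -- Every other vertex of `Ω` is adjacent to `z` or shares a component with it, so `z` and the
  -- components it sees form a connected set whose neighbourhood off `W` is exactly the rest of `Ω`.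
  have hnbr : Ω.erase z = G.nbr (insert z (G.seenBy (Ω ∪ W) z)) \ W := by
    ext x
    rw [Finset.mem_sdiff, mem_nbr, Finset.mem_erase]
    constructor
    · rintro ⟨hxz, hx⟩
      refine ⟨⟨?_, ?_⟩, Finset.disjoint_left.1 h.1 hx⟩
      · simp [hxz, hΩs x (by simp [hx])]
      · by_cases hadj : G.Adj z x
        · exact ⟨z, by simp, hadj⟩
        · obtain ⟨C, hC, hCz, a, ha, hax⟩ := h.2.2 z hz x hx (Ne.symm hxz) hadj
          exact ⟨a, Finset.mem_insert_of_mem (hC.subset_seenBy hCz ha), hax⟩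
    · rintro ⟨⟨hx, a, ha, hax⟩, hxW⟩
      simp only [Finset.mem_insert, not_or] at hx ha
      refine ⟨hx.1, ?_⟩
      by_contra hxΩ
      rcases ha with rfl | ha
      · obtain ⟨C, hC, hxC⟩ := G.exists_isCompOf (Ω := Ω ∪ W) (v := x) (by simp [hxΩ, hxW])
        exact hx.2 (hC.subset_seenBy ⟨x, hxC, hax.symm⟩ hxC)
      · obtain ⟨C, hC, hCz, haC⟩ := mem_seenBy.1 ha
        rcases hC.2.2 a haC x hax with h' | h'
        · exact hx.2 (hC.subset_seenBy hCz h')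
        · simp [hxΩ, hxW] at h'
  refine HasCode.of_one (z₁ := z) (e := z) (D₁ := insert z (G.seenBy (Ω ∪ W) z))
    (F₁ := Ω.erase z) (i₁ := (G.seenBy (Ω ∪ W) z).card) (j₁ := (Ω.erase z).card)
    ⟨connOn_insert_seenBy _ _, by simp, fun v hv hvz hvW => ?_, hnbr, ?_, rfl⟩
    (Finset.insert_erase hz).symm ?_
  · exact hΩs v (by simp [hvW]) ((Finset.mem_insert.1 hv).resolve_left hvz)
  · rw [Finset.card_insert_of_notMem (hΩs z (by simp [hz]))]
  · exact choose_le_codeBase_pow hs (Finset.card_le_card (Finset.erase_subset _ _))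
      card_compl_add_card_le

/-- A set disjoint from the components seen by `z` is small if those components are large. -/
theorem card_lt_of_disjoint_seenBy {z : V} {B : Finset V} (hB : B ⊆ (Ω ∪ W)ᶜ)
    (hd : Disjoint B (G.seenBy (Ω ∪ W) z))
    (hz : 5 * (Ω ∪ W)ᶜ.card < 8 * (G.seenBy (Ω ∪ W) z).card) : 8 * B.card < 3 * (Ω ∪ W)ᶜ.card := by
  have h1 := Finset.card_le_card (Finset.union_subset hB (seenBy_subset (G := G) (z := z)))
  rw [Finset.card_union_of_disjoint hd] at h1
  omega

theorem IsCompOf.subset_compl {U C : Finset V} (hC : G.IsCompOf U C) : C ⊆ Uᶜ := fun _ hv =>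
  Finset.mem_compl.2 (Finset.disjoint_left.1 hC.2.1 hv)

theorem IsCompOf.disjoint {U C D : Finset V} (hC : G.IsCompOf U C) (hD : G.IsCompOf U D)
    (hne : C ≠ D) : Disjoint C D :=
  Finset.disjoint_left.2 fun _ hv hv' => hne (hC.eq_of_mem hD hv hv')

/-- If no vertex of `Ω` is missed by both `P` and `Q`, the two components yield a code as soon as
the binomial bound holds. -/
theorem hasCode_of_pair (hd : Disjoint Ω W) (hne : Ω.Nonempty) {P Q : Finset V}
    (hP : G.IsCompOf (Ω ∪ W) P) (hQ : G.IsCompOf (Ω ∪ W) Q) (hPQ : P ≠ Q)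
    (hcov : ∀ z ∈ Ω, G.Sees P z ∨ G.Sees Q z)
    (hc : (((P.card - 1 + (G.seenIn Ω P).card).choose (P.card - 1) *
      (Q.card - 1 + (Ω \ G.seenIn Ω P).card).choose (Q.card - 1) : ℕ) : ℝ) ≤
        codeBase ^ Fintype.card V) : G.HasCode W Ω := by
  obtain ⟨z₁, h₁⟩ := hP.stage hd
  obtain ⟨z₂, h₂⟩ := hP.stage_of_ne hQ hPQ.symm hd
  have hsd : G.seenIn Ω Q \ G.seenIn Ω P = Ω \ G.seenIn Ω P := by
    ext x
    simp only [Finset.mem_sdiff, mem_seenIn]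
    constructor
    · exact fun h => ⟨h.1.1, h.2⟩
    · exact fun h => ⟨⟨h.1, (hcov x h.1).resolve_left fun h' => h.2 ⟨h.1, h'⟩⟩, h.2⟩
  rw [hsd] at h₂
  obtain ⟨e, he⟩ := hne
  refine HasCode.of_two h₁ h₂ (e := e) ?_ hc
  rw [Finset.union_sdiff_of_subset seenIn_subset, Finset.insert_eq_of_mem he]

/-- No vertex of `Ω` is missed twice, so the three missed sets are disjoint and their sizes add up
to at most `|Ω|`. Then one of the three cyclic pairs satisfies the binomial bound. -/
theorem hasCode_of_triple (hd : Disjoint Ω W) (hne : Ω.Nonempty) (P : Fin 3 → Finset V)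
    (hP : ∀ k, G.IsCompOf (Ω ∪ W) (P k)) (hinj : ∀ k l, k ≠ l → P k ≠ P l)
    (hcov : ∀ k l, k ≠ l → ∀ z ∈ Ω, G.Sees (P k) z ∨ G.Sees (P l) z) : G.HasCode W Ω := by
  have hdis : ∀ k l, k ≠ l → Disjoint (Ω \ G.seenIn Ω (P k)) (Ω \ G.seenIn Ω (P l)) := by
    intro k l hkl
    refine Finset.disjoint_left.2 fun x hx hx' => ?_
    simp only [Finset.mem_sdiff, mem_seenIn, not_and] at hx hx'
    exact (hcov k l hkl x hx.1).elim (hx.2 hx.1) (hx'.2 hx.1)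
  have hsum : ∀ f : Fin 3 → Finset V, (∀ k l, k ≠ l → Disjoint (f k) (f l)) → ∀ U : Finset V,
      (∀ k, f k ⊆ U) → (f 0).card + (f 1).card + (f 2).card ≤ U.card := by
    intro f hf U hU
    rw [← Finset.card_union_of_disjoint (hf 0 1 (by decide)), ← Finset.card_union_of_disjoint]
    · exact Finset.card_le_card
        (Finset.union_subset (Finset.union_subset (hU 0) (hU 1)) (hU 2))
    · exact Finset.disjoint_union_left.2 ⟨hf 0 2 (by decide), hf 1 2 (by decide)⟩
  obtain ⟨k, hk⟩ := exists_choose_mul_choose_le (m := (Ω ∪ W)ᶜ.card) (f := Ω.card)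
    (n := Fintype.card V) (c := fun k => (P k).card - 1) (s := fun k => (G.seenIn Ω (P k)).card)
    (t := fun k => (Ω \ G.seenIn Ω (P k)).card)
    (by
      have := hsum P (fun k l hkl => (hP k).disjoint (hP l) (hinj k l hkl)) _
        (fun k => (hP k).subset_compl)
      omega)
    (fun k => by
      have := Finset.card_sdiff_add_card_eq_card (seenIn_subset (G := G) (Ω := Ω) (C := P k))
      omega)
    (hsum _ hdis _ fun k => Finset.sdiff_subset) card_compl_add_card_le
  have hk1 : k ≠ k + 1 := (by decide : ∀ k : Fin 3, k ≠ k + 1) k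
  exact hasCode_of_pair hd hne (hP k) (hP (k + 1)) (hinj _ _ hk1) (hcov _ _ hk1) hk

/-- If the components other than `C` seen by `x` are all small, one of them can be chosen such that
few vertices are missed by it and by `C`. -/
theorem CliquishNotFullIn.hasCode_of_tiny (h : G.CliquishNotFullIn W Ω)
    (hA : ∀ z ∈ Ω, 5 * (Ω ∪ W)ᶜ.card < 8 * (G.seenBy (Ω ∪ W) z).card) {x : V} (hx : x ∈ Ω)
    {C : Finset V} (hC : G.IsCompOf (Ω ∪ W) C) (hCx : G.Sees C x)
    (hc : (Ω ∪ W)ᶜ.card < 4 * C.card)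
    (hX : 8 * (G.seenBy (Ω ∪ W) x \ C).card ≤ 3 * (Ω ∪ W)ᶜ.card)
    (htiny : ∀ P, G.IsCompOf (Ω ∪ W) P → P ≠ C → G.Sees P x →
      8 * (C.card + P.card) < 3 * (Ω ∪ W)ᶜ.card) : G.HasCode W Ω := by
  set m := (Ω ∪ W)ᶜ.card with hm
  set X := G.seenBy (Ω ∪ W) x \ C with hXdef
  set T := Ω \ G.seenIn Ω C with hT
  have hTC : ∀ z ∈ T, z ∈ Ω ∧ ¬ G.Sees C z := by
    intro z hz
    simp only [hT, Finset.mem_sdiff, mem_seenIn, not_and] at hz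
    exact ⟨hz.1, hz.2 hz.1⟩
  have hTne : T.Nonempty := by
    obtain ⟨z, hz, hCz⟩ := h.2.1 C hC
    exact ⟨z, by simp [hT, mem_seenIn, hz, hCz]⟩
  have hcx : C.card + X.card = (G.seenBy (Ω ∪ W) x).card := by
    have := Finset.card_sdiff_add_card_eq_card (hC.subset_seenBy hCx)
    rw [← hXdef] at this
    omega
  -- Double counting of pairs in `X` and `T` where `z` does not see the component of `v`. For each
  -- `z` in `T` such `v` together with `C` number fewer than `3m/8`. If every `v` were missed by
  -- more than a third of `T`, then `8 * |X| + 24 * |C| ≤ 9 * m`, which contradicts `|C| + |X| >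
  -- 5m/8` and `|C| > m/4`.
  obtain ⟨v, hvX, hv⟩ : ∃ v ∈ X, 3 * {z ∈ T | v ∉ G.seenBy (Ω ∪ W) z}.card ≤ T.card := by
    by_contra hcon
    push Not at hcon
    have h1 : ∑ v ∈ X, T.card ≤ ∑ v ∈ X, 3 * {z ∈ T | v ∉ G.seenBy (Ω ∪ W) z}.card :=
      Finset.sum_le_sum fun v hv => (hcon v hv).le
    rw [Finset.sum_const, smul_eq_mul, ← Finset.mul_sum] at h1
    have h2 : ∑ v ∈ X, {z ∈ T | v ∉ G.seenBy (Ω ∪ W) z}.card =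
        ∑ z ∈ T, {v ∈ X | v ∉ G.seenBy (Ω ∪ W) z}.card :=
      Finset.sum_card_bipartiteAbove_eq_sum_card_bipartiteBelow
        (fun v z => v ∉ G.seenBy (Ω ∪ W) z)
    have h3 : ∀ z ∈ T, 8 * (C.card + {v ∈ X | v ∉ G.seenBy (Ω ∪ W) z}.card) < 3 * m := by
      intro z hz
      rw [← Finset.card_union_of_disjoint]
      · refine card_lt_of_disjoint_seenBy (z := z) (Finset.union_subset hC.subset_compl ?_) ?_
          (hA z (hTC z hz).1)
        · exact (Finset.filter_subset _ _).trans (Finset.sdiff_subset.trans seenBy_subset)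
        · refine Finset.disjoint_union_left.2 ⟨hC.disjoint_seenBy (hTC z hz).2, ?_⟩
          exact Finset.disjoint_left.2 fun v hv => (Finset.mem_filter.1 hv).2
      · exact Finset.disjoint_left.2 fun v hv hv' =>
          (Finset.mem_sdiff.1 (Finset.mem_filter.1 hv').1).2 hv
    have h4 : ∑ z ∈ T, 8 * (C.card + {v ∈ X | v ∉ G.seenBy (Ω ∪ W) z}.card) ≤ ∑ z ∈ T, 3 * m :=
      Finset.sum_le_sum fun z hz => (h3 z hz).le
    rw [← Finset.mul_sum, Finset.sum_add_distrib, Finset.sum_const, Finset.sum_const, smul_eq_mul,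
      smul_eq_mul, ← h2] at h4
    have h5 : T.card * (8 * X.card + 24 * C.card) ≤ T.card * (9 * m) := by nlinarith
    have h6 := Nat.le_of_mul_le_mul_left h5 (Finset.card_pos.2 hTne)
    have h7 := hA x hx
    omega
  obtain ⟨hvx, hvC⟩ := Finset.mem_sdiff.1 hvX
  obtain ⟨P, hP, hPx, hvP⟩ := mem_seenBy.1 hvx
  have hPC : P ≠ C := fun e => hvC (e ▸ hvP)
  have hPX : P ⊆ X := fun w hw => Finset.mem_sdiff.2
    ⟨hP.subset_seenBy hPx hw, Finset.disjoint_left.1 (hP.disjoint hC hPC) hw⟩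
  set U := Ω \ (G.seenIn Ω C ∪ G.seenIn Ω P) with hU
  have hUT : U = {z ∈ T | v ∉ G.seenBy (Ω ∪ W) z} := by
    ext z
    simp only [hU, hT, Finset.mem_sdiff, Finset.mem_union, Finset.mem_filter, mem_seenIn,
      hP.mem_seenBy hvP]
    tauto
  obtain ⟨z₁, h₁⟩ := hC.stage h.1
  obtain ⟨z₂, h₂⟩ := hC.stage_of_ne hP hPC h.1
  -- The last exploration starts at `x`, which is already forbidden because `C` sees it; only the
  -- start is exempt. A vertex of `Ω` missed by `C` and `P` is adjacent to `x` or shares with it one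
  -- of the remaining components, so exactly `U` is found.
  have h₃ : G.Stage (W ∪ (C ∪ G.seenIn Ω C) ∪ (P ∪ (G.seenIn Ω P \ G.seenIn Ω C))) x
      (insert x (X \ P)) U (X \ P).card U.card := by
    have hXΩ : ∀ w ∈ X, w ∉ Ω ∪ W := fun w hw =>
      Finset.mem_compl.1 (seenBy_subset (Finset.mem_sdiff.1 hw).1)
    have hconn : G.ConnOn (insert x (X \ P)) := by
      have : insert x (X \ P) = insert x (({D | G.IsCompOf (Ω ∪ W) D ∧ G.Sees D x ∧ D ≠ C ∧ D ≠ P} :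
          Finset (Finset V)).biUnion id) := by
        congr 1
        ext w
        simp only [hXdef, Finset.mem_sdiff, mem_seenBy, Finset.mem_biUnion, Finset.mem_filter,
          Finset.mem_univ, true_and, id]
        constructor
        · rintro ⟨⟨⟨D, hD, hDx, hwD⟩, hwC⟩, hwP⟩
          exact ⟨D, ⟨hD, hDx, fun e => hwC (e ▸ hwD), fun e => hwP (e ▸ hwD)⟩, hwD⟩
        · rintro ⟨D, ⟨hD, hDx, hDC, hDP⟩, hwD⟩
          exact ⟨⟨⟨D, hD, hDx, hwD⟩, Finset.disjoint_left.1 (hD.disjoint hC hDC) hwD⟩,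
            Finset.disjoint_left.1 (hD.disjoint hP hDP) hwD⟩
      rw [this]
      refine connOn_star _ fun D hD => ?_
      simp only [Finset.mem_filter, Finset.mem_univ, true_and] at hD
      exact ⟨hD.1.1, hD.2.1⟩
    refine ⟨hconn, by simp, fun w hw hwx hwE => ?_, ?_, ?_, rfl⟩
    · obtain ⟨hwX, hwP⟩ := Finset.mem_sdiff.1 ((Finset.mem_insert.1 hw).resolve_left hwx)
      have h1 := hXΩ w hwX
      simp only [Finset.mem_union, not_or, Finset.mem_sdiff] at h1 hwE
      rcases hwE with (h | h | h) | h | h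
      · exact h1.2 h
      · exact (Finset.mem_sdiff.1 hwX).2 h
      · exact h1.1 (seenIn_subset h)
      · exact hwP h
      · exact h1.1 (seenIn_subset h.1)
    · ext w
      rw [Finset.mem_sdiff (s := G.nbr _), mem_nbr]
      constructor
      · intro hw
        simp only [hU, Finset.mem_sdiff, Finset.mem_union, mem_seenIn, not_or, not_and] at hw
        have hwC := hw.2.1 hw.1
        have hwP := hw.2.2 hw.1
        have hwx : x ≠ w := fun e => hwC (e ▸ hCx)
        refine ⟨⟨?_, ?_⟩, ?_⟩
        · simp only [Finset.mem_insert, not_or]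
          exact ⟨Ne.symm hwx, fun h' => hXΩ w (Finset.sdiff_subset h') (by simp [hw.1])⟩
        · by_cases hadj : G.Adj x w
          · exact ⟨x, by simp, hadj⟩
          · obtain ⟨D, hD, hDx, a, ha, haw⟩ := h.2.2 x hx w hw.1 hwx hadj
            refine ⟨a, Finset.mem_insert_of_mem ?_, haw⟩
            have hDC : D ≠ C := fun e => hwC ⟨a, e ▸ ha, haw⟩
            have hDP : D ≠ P := fun e => hwP ⟨a, e ▸ ha, haw⟩
            simp only [hXdef, Finset.mem_sdiff]
            exact ⟨⟨hD.subset_seenBy hDx ha, Finset.disjoint_left.1 (hD.disjoint hC hDC) ha⟩,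
              Finset.disjoint_left.1 (hD.disjoint hP hDP) ha⟩
        · simp only [Finset.mem_union, Finset.mem_sdiff, mem_seenIn]
          have hcomp : ∀ D, G.IsCompOf (Ω ∪ W) D → w ∉ D := fun D hD hwD =>
            Finset.disjoint_left.1 hD.2.1 hwD (by simp [hw.1])
          rintro ((h' | h' | h') | h' | h')
          · exact Finset.disjoint_left.1 h.1 hw.1 h'
          · exact hcomp C hC h'
          · exact hwC h'.2
          · exact hcomp P hP h'
          · exact hwP h'.1.2
      · rintro ⟨⟨hwD, a, ha, haw⟩, hwE⟩
        simp only [Finset.mem_union, Finset.mem_sdiff, not_or] at hwE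
        obtain ⟨⟨hwW, hwC, hwSC⟩, hwP, hwSP⟩ := hwE
        rw [Finset.mem_insert, not_or] at hwD
        suffices hwΩ : w ∈ Ω by
          simp only [hU, Finset.mem_sdiff, Finset.mem_union, not_or]
          exact ⟨hwΩ, hwSC, fun h' => hwSP ⟨h', hwSC⟩⟩
        by_contra hwΩ
        refine hwD.2 ?_
        simp only [hXdef, Finset.mem_sdiff]
        refine ⟨⟨?_, hwC⟩, hwP⟩
        rcases Finset.mem_insert.1 ha with rfl | ha
        · obtain ⟨D, hD, hwD'⟩ := G.exists_isCompOf (Ω := Ω ∪ W) (v := w) (by simp [hwΩ, hwW])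
          exact hD.subset_seenBy ⟨w, hwD', haw.symm⟩ hwD'
        · obtain ⟨D, hD, hDx, haD⟩ := mem_seenBy.1 (Finset.mem_sdiff.1 (Finset.mem_sdiff.1 ha).1).1
          refine hD.subset_seenBy hDx ((hD.2.2 a haD w haw).resolve_right ?_)
          simp [hwΩ, hwW]
    · rw [Finset.card_insert_of_notMem]
      exact fun h' => hXΩ x (Finset.sdiff_subset h') (by simp [hx])
  have hΩU : Ω = insert x (G.seenIn Ω C ∪ (G.seenIn Ω P \ G.seenIn Ω C) ∪ U) := by
    rw [Finset.union_sdiff_self_eq_union, hU, Finset.union_sdiff_of_subset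
      (Finset.union_subset seenIn_subset seenIn_subset), Finset.insert_eq_of_mem hx]
  refine ⟨z₁, z₂, x, x, _, _, _, _, _, _, _, _, _, _, _, _, h₁, h₂, h₃, hΩU, ?_⟩
  have hXP := Finset.card_sdiff_add_card_eq_card hPX
  have ht := htiny P hP hPC hPx
  have hcard : (G.seenIn Ω C).card + (G.seenIn Ω P \ G.seenIn Ω C).card + U.card = Ω.card := by
    rw [← Finset.card_union_of_disjoint Finset.disjoint_sdiff, Finset.union_sdiff_self_eq_union,
      hU, add_comm, Finset.card_sdiff_add_card_eq_card
      (Finset.union_subset seenIn_subset seenIn_subset)]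
  have hTcard := Finset.card_sdiff_add_card_eq_card (seenIn_subset (G := G) (Ω := Ω) (C := C))
  rw [← hT] at hTcard
  rw [← hUT] at hv
  -- The requirement `2 * u ≤ t` is `3 * |U| ≤ |T|`, since `T` consists of `U` and the new vertices
  -- seen by `P`.
  exact choose_mul_choose_mul_choose_le (m := m) (f := Ω.card) (by omega) (by omega) hcard.le
    (by omega) card_compl_add_card_le

/-- A pair of vertices seen by a unique common component yields a code. -/
theorem CliquishNotFullIn.hasCode_of_unique (h : G.CliquishNotFullIn W Ω)
    (hA : ∀ z ∈ Ω, 5 * (Ω ∪ W)ᶜ.card < 8 * (G.seenBy (Ω ∪ W) z).card) {x y : V} (hx : x ∈ Ω)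
    (hy : y ∈ Ω) {C : Finset V} (hC : G.IsCompOf (Ω ∪ W) C) (hCx : G.Sees C x) (hCy : G.Sees C y)
    (huniq : ∀ D, G.IsCompOf (Ω ∪ W) D → G.Sees D x → G.Sees D y → D = C) : G.HasCode W Ω := by
  set m := (Ω ∪ W)ᶜ.card with hm
  -- Components missed by one vertex of `Ω` have fewer than `3m/8` vertices in total, so two larger
  -- ones leave no vertex of `Ω` unseen.
  have hcov : ∀ P Q, G.IsCompOf (Ω ∪ W) P → G.IsCompOf (Ω ∪ W) Q → P ≠ Q →
      3 * m ≤ 8 * (P.card + Q.card) → ∀ z ∈ Ω, G.Sees P z ∨ G.Sees Q z := by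
    intro P Q hP hQ hPQ hle z hz
    by_contra hcon
    push Not at hcon
    have := card_lt_of_disjoint_seenBy (B := P ∪ Q) (z := z)
      (Finset.union_subset hP.subset_compl hQ.subset_compl)
      (Finset.disjoint_union_left.2 ⟨hP.disjoint_seenBy hcon.1, hQ.disjoint_seenBy hcon.2⟩)
      (hA z hz)
    rw [Finset.card_union_of_disjoint (hP.disjoint hQ hPQ)] at this
    omega
  have hcomp : ∀ P, G.IsCompOf (Ω ∪ W) P → 8 * P.card < 3 * m := by
    intro P hP
    obtain ⟨z, hz, hPz⟩ := h.2.1 P hP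
    exact card_lt_of_disjoint_seenBy hP.subset_compl (hP.disjoint_seenBy hPz) (hA z hz)
  have hxc := Finset.card_sdiff_add_card_eq_card (hC.subset_seenBy hCx)
  have hyc := Finset.card_sdiff_add_card_eq_card (hC.subset_seenBy hCy)
  -- Both vertices see more than `5m/8` vertices of components and share only `C`. Counting gives
  -- `|C| > m/4`, and the components other than `C` seen by either one have fewer than `3m/8`
  -- vertices.
  have hdis : Disjoint (G.seenBy (Ω ∪ W) x \ C) (G.seenBy (Ω ∪ W) y) := by
    refine Finset.disjoint_left.2 fun v hv hv' => ?_
    obtain ⟨hv, hvC⟩ := Finset.mem_sdiff.1 hv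
    obtain ⟨D, hD, hDx, hvD⟩ := mem_seenBy.1 hv
    exact hvC (huniq D hD hDx ((hD.mem_seenBy hvD).1 hv') ▸ hvD)
  have hsum := Finset.card_le_card (Finset.union_subset
    (Finset.sdiff_subset.trans (seenBy_subset (G := G) (U := Ω ∪ W) (z := x)) :
      G.seenBy (Ω ∪ W) x \ C ⊆ _) (seenBy_subset (G := G) (U := Ω ∪ W) (z := y)))
  rw [Finset.card_union_of_disjoint hdis] at hsum
  have hAx := hA x hx
  have hAy := hA y hy
  -- If `x` and `y` each see another component that together with `C` reaches `3m/8`, these cover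
  -- `Ω` in pairs with `C`. A pair of size at most `5m/8` is a description by itself. Otherwise `|C|
  -- < 3m/8` forces `|P|` and `|Q|` above `m/4`, so `P` and `Q` cover `Ω` as well and the three
  -- components apply.
  by_cases hbig : ∃ P Q, G.IsCompOf (Ω ∪ W) P ∧ P ≠ C ∧ G.Sees P x ∧
      3 * m ≤ 8 * (C.card + P.card) ∧ G.IsCompOf (Ω ∪ W) Q ∧ Q ≠ C ∧ G.Sees Q y ∧
      3 * m ≤ 8 * (C.card + Q.card)
  · obtain ⟨P, Q, hP, hPC, hPx, hPm, hQ, hQC, hQy, hQm⟩ := hbig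
    have hPQ : P ≠ Q := fun e => hPC (huniq P hP hPx (e ▸ hQy))
    have hsmall : ∀ R, G.IsCompOf (Ω ∪ W) R → R ≠ C → 3 * m ≤ 8 * (C.card + R.card) →
        8 * (C.card + R.card) ≤ 5 * m → G.HasCode W Ω := by
      intro R hR hRC hRm hRm'
      refine hasCode_of_pair h.1 ⟨x, hx⟩ hC hR hRC.symm (hcov C R hC hR hRC.symm hRm) ?_
      refine choose_mul_choose_le_of_small (m := m) (f := Ω.card) (by omega) ?_
        card_compl_add_card_le
      have := Finset.card_sdiff_add_card_eq_card (seenIn_subset (G := G) (Ω := Ω) (C := C))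
      omega
    by_cases hP5 : 8 * (C.card + P.card) ≤ 5 * m
    · exact hsmall P hP hPC hPm hP5
    by_cases hQ5 : 8 * (C.card + Q.card) ≤ 5 * m
    · exact hsmall Q hQ hQC hQm hQ5
    have hCm := hcomp C hC
    have hCP := hcov C P hC hP hPC.symm hPm
    have hCQ := hcov C Q hC hQ hQC.symm hQm
    have hPQ' := hcov P Q hP hQ hPQ (by omega)
    refine hasCode_of_triple h.1 ⟨x, hx⟩ ![C, P, Q] ?_ ?_ ?_
    · intro k
      fin_cases k
      exacts [hC, hP, hQ]
    · intro k l hkl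
      fin_cases k <;> fin_cases l
      exacts [absurd rfl hkl, hPC.symm, hQC.symm, hPC, absurd rfl hkl, hPQ, hQC, hPQ.symm,
        absurd rfl hkl]
    · intro k l hkl z hz
      fin_cases k <;> fin_cases l
      exacts [absurd rfl hkl, hCP z hz, hCQ z hz, (hCP z hz).symm, absurd rfl hkl, hPQ' z hz,
        (hCQ z hz).symm, (hPQ' z hz).symm, absurd rfl hkl]
  · push Not at hbig
    by_cases hP : ∃ P, G.IsCompOf (Ω ∪ W) P ∧ P ≠ C ∧ G.Sees P x ∧ 3 * m ≤ 8 * (C.card + P.card)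
    · obtain ⟨P, hP, hPC, hPx, hPm⟩ := hP
      exact h.hasCode_of_tiny hA hy hC hCy (by omega) (by omega)
        fun Q hQ hQC hQy => hbig P Q hP hPC hPx hPm hQ hQC hQy
    · push Not at hP
      exact h.hasCode_of_tiny hA hx hC hCx (by omega) (by omega) hP

/-- Either `Ω` survives the deletion of the vertex `a`, or it has a code. -/
theorem CliquishNotFullIn.erase_or_hasCode (h : G.CliquishNotFullIn W Ω) {a : V} (haW : a ∉ W) :
    G.CliquishNotFullIn (insert a W) (Ω.erase a) ∨ G.HasCode W Ω := by
  by_cases hA : ∃ z ∈ Ω, 8 * (G.seenBy (Ω ∪ W) z).card ≤ 5 * (Ω ∪ W)ᶜ.card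
  · obtain ⟨z, hz, hzs⟩ := hA
    exact Or.inr (h.hasCode_of_seenBy hz hzs)
  push Not at hA
  by_cases haΩ : a ∈ Ω
  · have hU : Ω.erase a ∪ insert a W = Ω ∪ W := by
      rw [Finset.union_insert, ← Finset.insert_union, Finset.insert_erase haΩ]
    -- Deleting a vertex of `Ω` leaves the components unchanged, so only the condition on full
    -- components can fail. Then `C` misses exactly `a`, and one exploration of `C` with extra
    -- vertex `a` describes `Ω`.
    by_cases hfull : ∃ C, G.IsCompOf (Ω ∪ W) C ∧ ∀ x ∈ Ω.erase a, G.Sees C x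
    · right
      obtain ⟨C, hC, hfull⟩ := hfull
      obtain ⟨z, hz, hCz⟩ := h.2.1 C hC
      have hza : z = a := by
        by_contra hza
        exact hCz (hfull z (by simp [hz, hza]))
      subst hza
      have hseen : G.seenIn Ω C = Ω.erase z := by
        ext x
        rw [mem_seenIn, Finset.mem_erase]
        constructor
        · exact fun hx => ⟨fun e => hCz (e ▸ hx.2), hx.1⟩
        · exact fun hx => ⟨hx.2, hfull x (by simp [hx])⟩
      obtain ⟨z₁, h₁⟩ := hC.stage h.1
      have hcm := card_lt_of_disjoint_seenBy hC.subset_compl (hC.disjoint_seenBy hCz) (hA z hz)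
      refine HasCode.of_one h₁ (e := z) (by rw [hseen, Finset.insert_erase hz]) ?_
      exact choose_le_codeBase_pow (m := (Ω ∪ W)ᶜ.card) (by omega)
        (Finset.card_le_card seenIn_subset) card_compl_add_card_le
    · left
      push Not at hfull
      refine ⟨?_, ?_, ?_⟩
      · refine Finset.disjoint_insert_right.2 ⟨by simp, h.1.mono_left (Finset.erase_subset _ _)⟩
      · rw [hU]
        exact hfull
      · rw [hU]
        exact fun u hu v hv => h.2.2 u (Finset.mem_of_mem_erase hu) v (Finset.mem_of_mem_erase hv)
  · rw [Finset.erase_eq_of_notMem haΩ]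
    -- Deleting a vertex outside `Ω` only breaks up its own component. The smaller pieces see no
    -- more than before, and a pair with two common components keeps one that does not contain `a`.
    by_cases huniq : ∃ x ∈ Ω, ∃ y ∈ Ω, ∃ C, G.IsCompOf (Ω ∪ W) C ∧ G.Sees C x ∧ G.Sees C y ∧
        ∀ D, G.IsCompOf (Ω ∪ W) D → G.Sees D x → G.Sees D y → D = C
    · obtain ⟨x, hx, y, hy, C, hC, hCx, hCy, hu⟩ := huniq
      exact Or.inr (h.hasCode_of_unique hA hx hy hC hCx hCy hu)
    · left
      push Not at huniq
      have hsub : Ω ∪ W ⊆ Ω ∪ insert a W :=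
        Finset.union_subset_union_right (Finset.subset_insert _ _)
      refine ⟨Finset.disjoint_insert_right.2 ⟨haΩ, h.1⟩, fun C hC => ?_, fun x hx y hy hxy hadj => ?_⟩
      · obtain ⟨v, hv⟩ := hC.1.1
        have hCΩ : ∀ w ∈ C, w ∉ Ω ∪ W := fun w hw hw' =>
          Finset.disjoint_left.1 hC.2.1 hw (hsub hw')
        obtain ⟨D, hD, hvD⟩ := G.exists_isCompOf (hCΩ v hv)
        have hCD : C ⊆ D := hC.1.subset_of_closed ⟨v, hv, hvD⟩ fun p _ hp q hq hpq =>
          (hD.2.2 p hp q hpq).resolve_right (hCΩ q hq)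
        obtain ⟨x, hx, hDx⟩ := h.2.1 D hD
        exact ⟨x, hx, fun ⟨b, hb, hbx⟩ => hDx ⟨b, hCD hb, hbx⟩⟩
      · have key : ∀ C, G.IsCompOf (Ω ∪ W) C → a ∉ C → G.IsCompOf (Ω ∪ insert a W) C := by
          intro C hC haC
          refine ⟨hC.1, ?_, fun p hp q hpq => (hC.2.2 p hp q hpq).imp id fun h' => hsub h'⟩
          rw [Finset.union_insert]
          exact Finset.disjoint_insert_right.2 ⟨haC, hC.2.1⟩
        obtain ⟨C, hC, hCx, hCy⟩ := h.2.2 x hx y hy hxy hadj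
        by_cases haC : a ∈ C
        · obtain ⟨D, hD, hDx, hDy, hDC⟩ := huniq x hx y hy C hC hCx hCy
          exact ⟨D, key D hD fun haD => hDC (hD.eq_of_mem hC haD haC), hDx, hDy⟩
        · exact ⟨C, key C hC haC, hCx, hCy⟩

end Encoding

end SimpleGraph

namespace RAM

/-! ### A language of terms with bounded iteration, and its translation to programs -/

/-- The binary operations of the machine. -/
inductive Op where
  | add | sub | mul | div

/-- The value of an operation. -/
def Op.val : Op → ℕ → ℕ → ℕ
  | add, a, b => a + b
  | sub, a, b => a - b
  | mul, a, b => a * b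
  | div, a, b => a / b

/-- The expression that applies an operation. -/
def Op.expr : Op → Expr → Expr → Expr
  | add => Expr.add
  | sub => Expr.sub
  | mul => Expr.mul
  | div => Expr.div

theorem Op.eval_expr (o : Op) (s : State) (a b : Expr) :
    (o.expr a b).eval s = o.val (a.eval s) (b.eval s) := by
  cases o <;> rfl

theorem Op.cost_expr (o : Op) (s : State) (a b : Expr) :
    (o.expr a b).cost s = a.cost s + b.cost s + 1 + Nat.size (o.val (a.eval s) (b.eval s)) := by
  cases o <;> rfl

theorem Op.val_lt (o : Op) {a b x y : ℕ} (ha : a < 2 ^ x) (hb : b < 2 ^ y) (hx : 1 ≤ x)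
    (hy : 1 ≤ y) : o.val a b < 2 ^ (x + y) := by
  have h2x : 2 ≤ 2 ^ x := by simpa using Nat.pow_le_pow_right (n := 2) (by norm_num) hx
  have h2y : 2 ≤ 2 ^ y := by simpa using Nat.pow_le_pow_right (n := 2) (by norm_num) hy
  rw [pow_add]
  cases o with
  | add => simp only [val]; nlinarith
  | sub => simp only [val]; have := Nat.sub_le a b; nlinarith
  | mul => simp only [val]; nlinarith
  | div => simp only [val]; have := Nat.div_le_self a b; nlinarith

/-- Terms. A variable refers to a position in the environment; `fold` iterates its body as often as
there are vertices, with the counter and the accumulator appended to the environment. -/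
inductive Tm where
  | lit (c : ℕ)
  | var (k : ℕ)
  | size
  | mem (a : Tm)
  | op (o : Op) (a b : Tm)
  | ite (c a b : Tm)
  | bind (a b : Tm)
  | call (f a b c d e : Tm)
  | fold (a b : Tm)

/-- Bounded iteration. -/
def loopVal (f : ℕ → ℕ → ℕ) (a : ℕ) : ℕ → ℕ
  | 0 => a
  | k + 1 => f k (loopVal f a k)

/-- The value of a term for `n` vertices, memory content `m`, and an environment. Accumulators of
folds are reduced modulo `M`. -/
def Tm.eval (n M : ℕ) (m : ℕ → ℕ) : Tm → List ℕ → ℕ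
  | lit c, _ => c
  | var k, ρ => ρ.getD k 0
  | size, _ => n
  | mem a, ρ => m (a.eval n M m ρ)
  | op o a b, ρ => o.val (a.eval n M m ρ) (b.eval n M m ρ)
  | ite c a b, ρ => if c.eval n M m ρ ≠ 0 then a.eval n M m ρ else b.eval n M m ρ
  | bind a b, ρ => b.eval n M m (ρ ++ [a.eval n M m ρ])
  | call f a b c d e, ρ => f.eval n M m
      [a.eval n M m ρ, b.eval n M m ρ, c.eval n M m ρ, d.eval n M m ρ, e.eval n M m ρ]
  | fold a b, ρ => loopVal (fun i x => b.eval n M m (ρ ++ [i, x]) % M) (a.eval n M m ρ) n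

/-- The expression for an entry of an environment held in the registers `env`. -/
def varExpr (env : List ℕ) (k : ℕ) : Expr :=
  match env[k]? with
  | some j => .reg j
  | none => .lit 0

/-- The program that computes a term into register `r`, with scratch space from `r` on. Register `0`
holds the number of vertices and register `1` the modulus. -/
def Tm.compile : Tm → List ℕ → ℕ → Program
  | lit c, _, r => .assign r (.lit c)
  | var k, env, r => .assign r (varExpr env k)
  | size, _, r => .assign r (.reg 0)
  | mem a, env, r => .seq (a.compile env r) (.assign r (.mem (.reg r)))
  | op o a b, env, r => .seq (a.compile env r)
      (.seq (b.compile env (r + 1)) (.assign r (o.expr (.reg r) (.reg (r + 1)))))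
  | ite c a b, env, r => .seq (c.compile env r)
      (.cond (.reg r) (a.compile env r) (b.compile env r))
  | bind a b, env, r => .seq (a.compile env r)
      (.seq (b.compile (env ++ [r]) (r + 1)) (.assign r (.reg (r + 1))))
  | call f a b c d e, env, r => .seq (a.compile env r) (.seq (b.compile env (r + 1))
      (.seq (c.compile env (r + 2)) (.seq (d.compile env (r + 3)) (.seq (e.compile env (r + 4))
        (.seq (f.compile [r, r + 1, r + 2, r + 3, r + 4] (r + 5))
          (.assign r (.reg (r + 5))))))))
  | fold a b, env, r => .seq (a.compile env (r + 1)) (.seq (.assign r (.lit 0))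
      (.seq (.loop (.sub (.reg 0) (.reg r)) (.seq (b.compile (env ++ [r, r + 1]) (r + 2))
          (.seq (.assign (r + 1) (.sub (.reg (r + 2))
            (.mul (.div (.reg (r + 2)) (.reg 1)) (.reg 1))))
            (.assign r (.add (.reg r) (.lit 1))))))
        (.assign r (.reg (r + 1)))))

/-! ### Correctness and cost of compiled terms. -/

/-- The state `s` holds the environment `ρ` in the registers `env`, all below `r`, and all numbers
in sight have at most `l` bits. -/
structure Frame (n M l : ℕ) (env ρ : List ℕ) (r : ℕ) (s : State) : Prop where
  two_le : 2 ≤ r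
  lt : ∀ e ∈ env, e < r
  regs : env.map s.reg = ρ
  reg_zero : s.reg 0 = n
  reg_one : s.reg 1 = M
  size_lt : n < 2 ^ l
  modulus_le : M ≤ 2 ^ l
  modulus_pos : 0 < M
  one_le : 1 ≤ l
  vals : ∀ x ∈ ρ, x < 2 ^ l
  mem_lt : ∀ a, s.mem a < 2 ^ l

/-- Two states agree below register `r`, and in memory and output. -/
def Agree (r : ℕ) (s s' : State) : Prop :=
  (∀ j < r, s'.reg j = s.reg j) ∧ s'.mem = s.mem ∧ s'.out = s.out

theorem Agree.refl (r : ℕ) (s : State) : Agree r s s := ⟨fun _ _ => rfl, rfl, rfl⟩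

theorem Agree.trans {r r' : ℕ} {s s' s'' : State} (h : Agree r s s') (h' : Agree r' s' s'')
    (hr : r ≤ r') : Agree r s s'' :=
  ⟨fun j hj => (h'.1 j (by omega)).trans (h.1 j hj), h'.2.1.trans h.2.1, h'.2.2.trans h.2.2⟩

theorem Agree.update {r k : ℕ} {s s' : State} (h : Agree r s s') (hk : r ≤ k) (v : ℕ) :
    Agree r s { s' with reg := Function.update s'.reg k v } :=
  ⟨fun j hj => by
    have : j ≠ k := by omega
    simp [Function.update_of_ne this, h.1 j hj], h.2.1, h.2.2⟩

theorem Frame.mono {n M l : ℕ} {env ρ : List ℕ} {r : ℕ} {s : State} (h : Frame n M l env ρ r s)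
    {l' r' : ℕ} {s' : State} (ha : Agree r s s') (hr : r ≤ r') (hl : l ≤ l') :
    Frame n M l' env ρ r' s' := by
  have hp : 2 ^ l ≤ 2 ^ l' := Nat.pow_le_pow_right (by norm_num) hl
  have h2 := h.two_le
  refine ⟨by omega, fun e he => (h.lt e he).trans_le hr, ?_, ?_, ?_, h.size_lt.trans_le hp,
    h.modulus_le.trans hp, h.modulus_pos, h.one_le.trans hl, fun x hx => (h.vals x hx).trans_le hp,
    ?_⟩
  · rw [← h.regs]
    exact List.map_congr_left fun e he => ha.1 e (h.lt e he)
  · rw [ha.1 0 (by omega), h.reg_zero]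
  · rw [ha.1 1 (by omega), h.reg_one]
  · rw [ha.2.1]
    exact fun a => (h.mem_lt a).trans_le hp

theorem Frame.snoc {n M l : ℕ} {env ρ : List ℕ} {r : ℕ} {s : State} (h : Frame n M l env ρ r s)
    {k r' v : ℕ} (hkr : k < r') (hr : r ≤ r') (hv : s.reg k = v) (hl : v < 2 ^ l) :
    Frame n M l (env ++ [k]) (ρ ++ [v]) r' s := by
  have h2 := h.two_le
  refine ⟨by omega, fun e he => ?_, by simp [h.regs, hv], h.reg_zero, h.reg_one, h.size_lt,
    h.modulus_le, h.modulus_pos, h.one_le, fun x hx => ?_, h.mem_lt⟩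
  · rcases List.mem_append.1 he with he | he
    · exact (h.lt e he).trans_le hr
    · simp only [List.mem_singleton] at he
      omega
  · rcases List.mem_append.1 hx with hx | hx
    · exact h.vals x hx
    · simp only [List.mem_singleton] at hx
      omega

theorem Frame.nil {n M l : ℕ} {env ρ : List ℕ} {r : ℕ} {s : State} (h : Frame n M l env ρ r s) :
    Frame n M l [] [] r s :=
  ⟨h.two_le, by simp, rfl, h.reg_zero, h.reg_one, h.size_lt, h.modulus_le, h.modulus_pos, h.one_le,
    by simp, h.mem_lt⟩

/-- The compiled term computes the value of the term, in time polynomial in the number of vertices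
and linear in the bit length. -/
def Computes (t : Tm) (K : ℕ) : Prop :=
  1 ≤ K ∧ ∀ (n M l : ℕ) (env ρ : List ℕ) (r : ℕ) (s : State), Frame n M l env ρ r s →
    t.eval n M s.mem ρ < 2 ^ (K * l) ∧ ∃ T s', Exec (t.compile env r) s T s' ∧
      T ≤ K * l * (n + 1) ^ K ∧ s'.reg r = t.eval n M s.mem ρ ∧ Agree r s s'

theorem lt_two_pow_mul {x K l : ℕ} (h : x < 2 ^ l) (hK : 1 ≤ K) : x < 2 ^ (K * l) :=
  h.trans_le (Nat.pow_le_pow_right (by norm_num) (Nat.le_mul_of_pos_left l hK))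

theorem bound_mono {K K' c l N : ℕ} (hN : 1 ≤ N) (hK : K ≤ K') :
    c * l * N ^ K ≤ c * l * N ^ K' :=
  Nat.mul_le_mul_left _ (Nat.pow_le_pow_right hN hK)

theorem le_bound {c l N K : ℕ} (hN : 1 ≤ N) : c * l ≤ c * l * N ^ K :=
  Nat.le_mul_of_pos_right _ (Nat.pow_pos hN)

theorem mul_add_two_le {k S l : ℕ} (hl : 1 ≤ l) : k * (S * l) + 2 ≤ (k * S + 2) * l := by
  nlinarith

theorem computes_assign {t : Tm} {K : ℕ} (hK : 1 ≤ K) (e : List ℕ → Expr)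
    (hc : ∀ env r, t.compile env r = .assign r (e env))
    (h : ∀ n M l env ρ r s, Frame n M l env ρ r s →
      (e env).eval s = t.eval n M s.mem ρ ∧ t.eval n M s.mem ρ < 2 ^ (K * l) ∧
        (e env).cost s + 1 ≤ K * l) : Computes t K := by
  refine ⟨hK, fun n M l env ρ r s hf => ⟨(h n M l env ρ r s hf).2.1, ?_⟩⟩
  obtain ⟨h1, _, h3⟩ := h n M l env ρ r s hf
  rw [hc]
  exact ⟨_, _, Exec.assign s r _, h3.trans (le_bound (by omega)), by simp [h1],
    (Agree.refl r s).update le_rfl _⟩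

theorem computes_lit (c : ℕ) : Computes (.lit c) (Nat.size c + 2) := by
  refine computes_assign (by omega) (fun _ => .lit c) (fun _ _ => rfl)
    fun n M l env ρ r s hf => ⟨rfl, ?_, ?_⟩
  · refine (Nat.lt_size_self c).trans_le (Nat.pow_le_pow_right (by norm_num) ?_)
    nlinarith [hf.one_le]
  · simp only [Expr.cost]
    nlinarith [hf.one_le]

theorem computes_size : Computes .size 3 := by
  refine computes_assign (by omega) (fun _ => .reg 0) (fun _ _ => rfl)
    fun n M l env ρ r s hf => ⟨hf.reg_zero, lt_two_pow_mul hf.size_lt (by norm_num), ?_⟩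
  have := Nat.size_le.2 hf.size_lt
  have := hf.one_le
  simp only [Expr.cost, hf.reg_zero]
  omega

theorem computes_var (k : ℕ) : Computes (.var k) 3 := by
  refine computes_assign (by omega) (fun env => varExpr env k) (fun _ _ => rfl)
    fun n M l env ρ r s hf => ?_
  have hl := hf.one_le
  have key : (varExpr env k).eval s = ρ.getD k 0 ∧ ρ.getD k 0 < 2 ^ l ∧
      (varExpr env k).cost s ≤ 1 + l := by
    have hr := hf.regs
    subst hr
    unfold varExpr
    by_cases hk : k < env.length
    · have hm : s.reg env[k] < 2 ^ l := hf.vals _ (List.mem_map_of_mem (List.getElem_mem hk))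
      simp only [List.getElem?_eq_getElem hk, Expr.eval, Expr.cost, List.getD_eq_getElem?_getD,
        List.getElem?_map, Option.map_some, Option.getD_some]
      exact ⟨trivial, hm, by have := Nat.size_le.2 hm; omega⟩
    · simp only [List.getElem?_eq_none (not_lt.1 hk), Expr.eval, Expr.cost,
        List.getD_eq_getElem?_getD, List.getElem?_map, Option.map_none, Option.getD_none]
      exact ⟨trivial, by positivity, by simp⟩
  exact ⟨key.1, lt_two_pow_mul key.2.1 (by norm_num), by omega⟩

theorem computes_mem {a : Tm} {K : ℕ} (ha : Computes a K) : Computes (.mem a) (2 * K + 4) := by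
  refine ⟨by omega, fun n M l env ρ r s hf => ?_⟩
  obtain ⟨hv, T, s', he, hT, hr, hag⟩ := ha.2 n M l env ρ r s hf
  refine ⟨lt_two_pow_mul (hf.mem_lt _) (by omega), _, _, Exec.seq he (Exec.assign s' r _), ?_, ?_,
    hag.update le_rfl _⟩
  · have h1 := Nat.size_le.2 hv
    have h2 := Nat.size_le.2 (hf.mem_lt (a.eval n M s.mem ρ))
    have h3 := hf.one_le
    have h4 : T ≤ K * l * (n + 1) ^ (2 * K + 4) := hT.trans (bound_mono (by omega) (by omega))
    have h5 : (K + 4) * l ≤ (K + 4) * l * (n + 1) ^ (2 * K + 4) := le_bound (by omega)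
    simp only [Expr.cost, Expr.eval, hr, hag.2.1]
    nlinarith
  · simp [Expr.eval, hr, Tm.eval, hag.2.1]

theorem computes_op (o : Op) {a b : Tm} {K K' : ℕ} (ha : Computes a K) (hb : Computes b K') :
    Computes (.op o a b) (3 * K + 3 * K' + 4) := by
  refine ⟨by omega, fun n M l env ρ r s hf => ?_⟩
  obtain ⟨hv, T, s', he, hT, hr, hag⟩ := ha.2 n M l env ρ r s hf
  obtain ⟨hv', T', s'', he', hT', hr', hag'⟩ :=
    hb.2 n M l env ρ (r + 1) s' (hf.mono hag (by omega) le_rfl)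
  rw [hag.2.1] at hv' hr'
  have hl := hf.one_le
  have hrr : s''.reg r = a.eval n M s.mem ρ := by rw [hag'.1 r (by omega), hr]
  have hval := o.val_lt hv hv' (Nat.mul_pos ha.1 hl) (Nat.mul_pos hb.1 hl)
  refine ⟨hval.trans_le (Nat.pow_le_pow_right (by norm_num) (by nlinarith)), _, _,
    Exec.seq he (Exec.seq he' (Exec.assign s'' r _)), ?_, ?_,
    (hag.trans hag' (by omega)).update le_rfl _⟩
  · have h1 := Nat.size_le.2 hv
    have h1' := Nat.size_le.2 hv'
    have h2 := Nat.size_le.2 hval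
    set E := 3 * K + 3 * K' + 4
    have h4 : T ≤ K * l * (n + 1) ^ E := hT.trans (bound_mono (by omega) (by omega))
    have h4' : T' ≤ K' * l * (n + 1) ^ E := hT'.trans (bound_mono (by omega) (by omega))
    have h5 : (2 * K + 2 * K' + 4) * l ≤ (2 * K + 2 * K' + 4) * l * (n + 1) ^ E :=
      le_bound (by omega)
    rw [Op.cost_expr]
    simp only [Expr.cost, Expr.eval, hrr, hr']
    have h6 : E * l * (n + 1) ^ E = K * l * (n + 1) ^ E + K' * l * (n + 1) ^ E +
      (2 * K + 2 * K' + 4) * l * (n + 1) ^ E := by simp only [E]; ring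
    nlinarith
  · simp [Op.eval_expr, Expr.eval, hrr, hr', Tm.eval]

theorem computes_ite {c a b : Tm} {K₀ K K' : ℕ} (hc : Computes c K₀) (ha : Computes a K)
    (hb : Computes b K') : Computes (.ite c a b) (2 * K₀ + K + K' + 2) := by
  refine ⟨by omega, fun n M l env ρ r s hf => ?_⟩
  obtain ⟨hv, T, s', he, hT, hr, hag⟩ := hc.2 n M l env ρ r s hf
  have hf' := hf.mono hag le_rfl le_rfl
  have hl := hf.one_le
  have h1 := Nat.size_le.2 hv
  set E := 2 * K₀ + K + K' + 2 with hE
  have h4 : T ≤ K₀ * l * (n + 1) ^ E := hT.trans (bound_mono (by omega) (by omega))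
  have h5 : (K₀ + 2) * l ≤ (K₀ + 2) * l * (n + 1) ^ E := le_bound (by omega)
  have h6 : E * l * (n + 1) ^ E = K₀ * l * (n + 1) ^ E + (K₀ + 2) * l * (n + 1) ^ E +
      K * l * (n + 1) ^ E + K' * l * (n + 1) ^ E := by simp only [E]; ring
  by_cases h0 : c.eval n M s.mem ρ = 0
  · obtain ⟨hv', T', s'', he', hT', hr', hag'⟩ := hb.2 n M l env ρ r s' hf'
    rw [hag.2.1] at hv' hr'
    have h4' : T' ≤ K' * l * (n + 1) ^ E := hT'.trans (bound_mono (by omega) (by omega))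
    simp only [Tm.eval, h0, ne_eq, not_true_eq_false, if_false]
    refine ⟨hv'.trans_le (Nat.pow_le_pow_right (by norm_num)
      (Nat.mul_le_mul_right l (by omega))), _, _,
      Exec.seq he (Exec.cond_false (by simp [Expr.eval, hr, h0]) he'), ?_, hr',
      hag.trans hag' le_rfl⟩
    simp only [Expr.cost, hr]
    nlinarith
  · obtain ⟨hv', T', s'', he', hT', hr', hag'⟩ := ha.2 n M l env ρ r s' hf'
    rw [hag.2.1] at hv' hr'
    have h4' : T' ≤ K * l * (n + 1) ^ E := hT'.trans (bound_mono (by omega) (by omega))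
    simp only [Tm.eval, ne_eq, h0, not_false_eq_true, if_true]
    refine ⟨hv'.trans_le (Nat.pow_le_pow_right (by norm_num)
      (Nat.mul_le_mul_right l (by omega))), _, _,
      Exec.seq he (Exec.cond_true (by simp [Expr.eval, hr, h0]) he'), ?_, hr',
      hag.trans hag' le_rfl⟩
    simp only [Expr.cost, hr]
    nlinarith

/-- The new entry may have `K * l` bits, so `b` runs in a frame of that bit length. Cost and output
length being linear in `l`, the constants merely multiply. -/
theorem computes_bind {a b : Tm} {K K' : ℕ} (ha : Computes a K) (hb : Computes b K') :
    Computes (.bind a b) (K + 2 * (K' * K) + K' + 2) := by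
  refine ⟨by omega, fun n M l env ρ r s hf => ?_⟩
  obtain ⟨hv, T, s', he, hT, hr, hag⟩ := ha.2 n M l env ρ r s hf
  have hl := hf.one_le
  obtain ⟨hv', T', s'', he', hT', hr', hag'⟩ := hb.2 n M (K * l) (env ++ [r]) _ (r + 1) s'
    ((hf.mono hag le_rfl (Nat.le_mul_of_pos_left l ha.1)).snoc (by omega) (by omega) hr hv)
  rw [hag.2.1] at hv' hr'
  set E := K + 2 * (K' * K) + K' + 2 with hE
  have hKK : K' * (K * l) ≤ E * l := by rw [← mul_assoc]; exact Nat.mul_le_mul_right l (by omega)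
  refine ⟨hv'.trans_le (Nat.pow_le_pow_right (by norm_num) hKK), _, _,
    Exec.seq he (Exec.seq he' (Exec.assign s'' r _)), ?_, by simp [Expr.eval, hr', Tm.eval],
    (hag.trans hag' (by omega)).update le_rfl _⟩
  have h1 := Nat.size_le.2 hv'
  have h4 : T ≤ K * l * (n + 1) ^ E := hT.trans (bound_mono (by omega) (by omega))
  have h4' : T' ≤ K' * (K * l) * (n + 1) ^ E := hT'.trans (bound_mono (by omega) (by omega))
  have h5 : (K' * K + 2) * l ≤ (K' * K + 2) * l * (n + 1) ^ E := le_bound (by omega)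
  have h6 : E * l * (n + 1) ^ E = K * l * (n + 1) ^ E + K' * (K * l) * (n + 1) ^ E +
      (K' * K + 2) * l * (n + 1) ^ E + K' * l * (n + 1) ^ E := by simp only [E]; ring
  have h7 := mul_add_two_le (k := K') (S := K) hl
  have h8 := Nat.zero_le (K' * l * (n + 1) ^ E)
  simp only [Expr.cost, hr']
  linarith

set_option maxHeartbeats 800000 in
theorem computes_call {f a b c d e : Tm} {Kf Ka Kb Kc Kd Ke : ℕ} (hf : Computes f Kf)
    (ha : Computes a Ka) (hb : Computes b Kb) (hc : Computes c Kc) (hd : Computes d Kd)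
    (he : Computes e Ke) : ∃ K, Computes (.call f a b c d e) K := by
  set S := Ka + Kb + Kc + Kd + Ke with hS
  refine ⟨S + 2 * (Kf * S) + Kf + 2, by omega, fun n M l env ρ r s hF => ?_⟩
  obtain ⟨va, Ta, sa, xa, ta, ra, ga⟩ := ha.2 n M l env ρ r s hF
  obtain ⟨vb, Tb, sb, xb, tb, rb, gb⟩ := hb.2 n M l env ρ (r + 1) sa (hF.mono ga (by omega) le_rfl)
  rw [ga.2.1] at vb rb
  have gb' := ga.trans gb (by omega)
  obtain ⟨vc, Tc, sc, xc, tc, rc, gc⟩ := hc.2 n M l env ρ (r + 2) sb (hF.mono gb' (by omega) le_rfl)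
  rw [gb'.2.1] at vc rc
  have gc' := gb'.trans gc (by omega)
  obtain ⟨vd, Td, sd, xd, td, rd, gd⟩ := hd.2 n M l env ρ (r + 3) sc (hF.mono gc' (by omega) le_rfl)
  rw [gc'.2.1] at vd rd
  have gd' := gc'.trans gd (by omega)
  obtain ⟨ve, Te, se, xe, te, re, ge⟩ := he.2 n M l env ρ (r + 4) sd (hF.mono gd' (by omega) le_rfl)
  rw [gd'.2.1] at ve re
  have ge' := gd'.trans ge (by omega)
  have hl := hF.one_le
  have lift : ∀ {x k : ℕ}, x < 2 ^ (k * l) → k ≤ S → x < 2 ^ (S * l) := fun hx hk =>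
    hx.trans_le (Nat.pow_le_pow_right (by norm_num) (Nat.mul_le_mul_right l hk))
  have hka := ha.1
  have F0 := (hF.mono (l' := S * l) (r' := r + 5) ge' (by omega)
    (Nat.le_mul_of_pos_left l (by omega))).nil
  have F1 := F0.snoc (k := r) (r' := r + 5) (by omega) le_rfl
    (show se.reg r = a.eval n M s.mem ρ by
      rw [ge.1 r (by omega), gd.1 r (by omega), gc.1 r (by omega), gb.1 r (by omega), ra])
    (lift va (by omega))
  have F2 := F1.snoc (k := r + 1) (r' := r + 5) (by omega) le_rfl
    (show se.reg (r + 1) = b.eval n M s.mem ρ by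
      rw [ge.1 _ (by omega), gd.1 _ (by omega), gc.1 _ (by omega), rb])
    (lift vb (by omega))
  have F3 := F2.snoc (k := r + 2) (r' := r + 5) (by omega) le_rfl
    (show se.reg (r + 2) = c.eval n M s.mem ρ by
      rw [ge.1 _ (by omega), gd.1 _ (by omega), rc])
    (lift vc (by omega))
  have F4 := F3.snoc (k := r + 3) (r' := r + 5) (by omega) le_rfl
    (show se.reg (r + 3) = d.eval n M s.mem ρ by rw [ge.1 _ (by omega), rd])
    (lift vd (by omega))
  have F5 := F4.snoc (k := r + 4) (r' := r + 5) (by omega) le_rfl re (lift ve (by omega))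
  simp only [List.nil_append, List.cons_append] at F5
  obtain ⟨vf, Tf, sf, xf, tf, rf, gf⟩ := hf.2 n M _ _ _ _ _ F5
  rw [ge'.2.1] at vf rf
  set E := S + 2 * (Kf * S) + Kf + 2 with hE
  have hKK : Kf * (S * l) ≤ E * l := by rw [← mul_assoc]; exact Nat.mul_le_mul_right l (by omega)
  refine ⟨vf.trans_le (Nat.pow_le_pow_right (by norm_num) hKK), _, _,
    Exec.seq xa (Exec.seq xb (Exec.seq xc (Exec.seq xd (Exec.seq xe (Exec.seq xf
      (Exec.assign sf r _)))))), ?_, by simp [Expr.eval, rf, Tm.eval],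
    (ge'.trans gf (by omega)).update le_rfl _⟩
  have h1 := Nat.size_le.2 vf
  have ta' : Ta ≤ Ka * l * (n + 1) ^ E := ta.trans (bound_mono (by omega) (by omega))
  have tb' : Tb ≤ Kb * l * (n + 1) ^ E := tb.trans (bound_mono (by omega) (by omega))
  have tc' : Tc ≤ Kc * l * (n + 1) ^ E := tc.trans (bound_mono (by omega) (by omega))
  have td' : Td ≤ Kd * l * (n + 1) ^ E := td.trans (bound_mono (by omega) (by omega))
  have te' : Te ≤ Ke * l * (n + 1) ^ E := te.trans (bound_mono (by omega) (by omega))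
  have tf' : Tf ≤ Kf * (S * l) * (n + 1) ^ E := tf.trans (bound_mono (by omega) (by omega))
  have h5 : (Kf * S + 2) * l ≤ (Kf * S + 2) * l * (n + 1) ^ E := le_bound (by omega)
  have h6 : E * l * (n + 1) ^ E = (Ka * l * (n + 1) ^ E + Kb * l * (n + 1) ^ E +
      Kc * l * (n + 1) ^ E + Kd * l * (n + 1) ^ E + Ke * l * (n + 1) ^ E) +
      Kf * (S * l) * (n + 1) ^ E +
      (Kf * S + 2) * l * (n + 1) ^ E + Kf * l * (n + 1) ^ E := by simp only [E, hS]; ring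
  have h7 := mul_add_two_le (k := Kf) (S := S) hl
  have h8 := Nat.zero_le (Kf * l * (n + 1) ^ E)
  have h9 : (Expr.reg (r + 5)).cost sf ≤ 1 + Kf * (S * l) := by
    simp only [Expr.cost, rf]
    omega
  clear_value E S
  rw [h6]
  clear ta tb tc td te tf F0 F1 F2 F3 F4 F5
  omega

/-- After each round the accumulator is reduced below `M ≤ 2 ^ l`, so its length stays within `K *
l` bits, whereas unreduced it could grow by a constant factor per round. The induction is on the
number `d` of rounds still to come. -/
theorem loop_exec {a b : Tm} {K K' n M l r : ℕ} {env ρ : List ℕ} {s : State} (hK : 1 ≤ K)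
    (hb : Computes b K') (hF : Frame n M l env ρ r s)
    (hv : a.eval n M s.mem ρ < 2 ^ (K * l)) (d : ℕ) :
    ∀ (i : ℕ) (s₁ : State), i + d = n → Agree r s s₁ → s₁.reg r = i →
      s₁.reg (r + 1) =
        loopVal (fun i x => b.eval n M s.mem (ρ ++ [i, x]) % M) (a.eval n M s.mem ρ) i →
      ∃ T s₂, Exec (.loop (.sub (.reg 0) (.reg r)) (.seq (b.compile (env ++ [r, r + 1]) (r + 2))
          (.seq (.assign (r + 1) (.sub (.reg (r + 2))
            (.mul (.div (.reg (r + 2)) (.reg 1)) (.reg 1))))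
            (.assign r (.add (.reg r) (.lit 1)))))) s₁ T s₂ ∧
        T ≤ d * (K' * (K * l) * (n + 1) ^ K' + 17 * (K' * (K * l)) + 14 * l) + 7 * l ∧
        s₂.reg (r + 1) = (Tm.fold a b).eval n M s.mem ρ ∧ Agree r s s₂ := by
  have hl := hF.one_le
  have h2 := hF.two_le
  have hzn := Nat.size_le.2 hF.size_lt
  have hacc : ∀ i, loopVal (fun i x => b.eval n M s.mem (ρ ++ [i, x]) % M)
      (a.eval n M s.mem ρ) i < 2 ^ (K * l) := by
    intro i
    cases i with
    | zero => exact hv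
    | succ i =>
      exact lt_two_pow_mul ((Nat.mod_lt _ hF.modulus_pos).trans_le hF.modulus_le) hK
  induction d with
  | zero =>
    intro i s₁ hi hag hri hra
    have h0 : s₁.reg 0 = n := by rw [hag.1 0 (by omega), hF.reg_zero]
    have hin : i = n := by omega
    subst hin
    refine ⟨_, _, Exec.loop_false (by simp [Expr.eval, h0, hri]), ?_, hra, hag⟩
    simp only [Expr.cost, Expr.eval, h0, hri, Nat.sub_self, Nat.size_zero]
    omega
  | succ d ih =>
    intro i s₁ hi hag hri hra
    have h0 : s₁.reg 0 = n := by rw [hag.1 0 (by omega), hF.reg_zero]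
    set acc := loopVal (fun i x => b.eval n M s.mem (ρ ++ [i, x]) % M) (a.eval n M s.mem ρ) i
      with hacc'
    have hil : i < 2 ^ l := lt_of_le_of_lt (by omega) hF.size_lt
    have F := ((hF.mono (l' := K * l) hag le_rfl (Nat.le_mul_of_pos_left l hK)).snoc (k := r)
      (r' := r + 1) (by omega) (by omega) hri (lt_two_pow_mul hil hK)).snoc (k := r + 1)
      (r' := r + 2) (by omega) (by omega) hra (hacc i)
    simp only [List.append_assoc, List.cons_append, List.nil_append] at F
    obtain ⟨vb, Tb, sb, xb, tb, rb, gb⟩ := hb.2 n M _ _ _ _ _ F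
    rw [hag.2.1] at vb rb
    set v := b.eval n M s.mem (ρ ++ [i, acc]) with hvdef
    have hm : v - v / M * M = v % M := by
      have := Nat.div_add_mod' v M
      omega
    have e1 : (Expr.sub (.reg (r + 2)) (.mul (.div (.reg (r + 2)) (.reg 1)) (.reg 1))).eval sb =
        v % M := by
      simp only [Expr.eval, rb, gb.1 1 (by omega), hag.1 1 (by omega), hF.reg_one, hm]
    set s₃ : State := { sb with reg := Function.update sb.reg (r + 1) (v % M) } with hs₃
    have e2 : (Expr.add (.reg r) (.lit 1)).eval s₃ = i + 1 := by
      simp [Expr.eval, hs₃, gb.1 r (by omega), hri]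
    set s₄ : State := { s₃ with reg := Function.update s₃.reg r (i + 1) } with hs₄
    obtain ⟨T, s₂, x, t, hr, g⟩ := ih (i + 1) s₄ (by omega)
      (((hag.trans gb (by omega)).update (k := r + 1) (by omega) _).update le_rfl _)
      (by simp [hs₄]) (by simp [hs₄, hs₃, loopVal, hvdef, hacc'])
    have x1 := Exec.assign sb (r + 1)
      (Expr.sub (.reg (r + 2)) (.mul (.div (.reg (r + 2)) (.reg 1)) (.reg 1)))
    rw [e1] at x1
    have x2 := Exec.assign s₃ r (Expr.add (.reg r) (.lit 1))
    rw [e2] at x2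
    refine ⟨_, _, Exec.loop_true (by simp [Expr.eval, h0, hri]; omega)
      (Exec.seq xb (Exec.seq x1 x2)) x, ?_, hr, g⟩
    have hzv := Nat.size_le.2 vb
    have hz : ∀ w ≤ v, Nat.size w ≤ K' * (K * l) := fun w hw => (Nat.size_le_size hw).trans hzv
    have hzi := Nat.size_le.2 hil
    have hzi' := Nat.size_le_size (show i + 1 ≤ n by omega)
    have hzni := Nat.size_le_size (Nat.sub_le n i)
    have hzM : Nat.size M ≤ l + 1 := Nat.size_le.2
      (lt_of_le_of_lt hF.modulus_le (Nat.pow_lt_pow_right (by norm_num) (by omega)))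
    have hz1 := hz _ (Nat.div_le_self v M)
    have hz2 := hz _ (Nat.div_mul_le_self v M)
    have hz3 := hz _ (Nat.mod_le v M)
    have hlb : l ≤ K' * (K * l) := by
      have := hb.1
      calc l ≤ K * l := Nat.le_mul_of_pos_left l hK
        _ ≤ K' * (K * l) := Nat.le_mul_of_pos_left _ hb.1
    have c1 : (Expr.sub (.reg (r + 2)) (.mul (.div (.reg (r + 2)) (.reg 1)) (.reg 1))).cost sb ≤
        16 * (K' * (K * l)) := by
      simp only [Expr.cost, Expr.eval, rb, gb.1 1 (by omega), hag.1 1 (by omega), hF.reg_one, hm]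
      omega
    have c2 : (Expr.add (.reg r) (.lit 1)).cost s₃ ≤ 6 * l := by
      simp only [Expr.cost]
      have : (Expr.add (.reg r) (.lit 1)).eval s₃ = (Expr.reg r).eval s₃ + (Expr.lit 1).eval s₃ := rfl
      rw [← this, e2]
      have : s₃.reg r = i := by simp [hs₃, gb.1 r (by omega), hri]
      rw [this, Nat.size_one]
      omega
    have c3 : (Expr.sub (.reg 0) (.reg r)).cost s₁ ≤ 6 * l := by
      simp only [Expr.cost, Expr.eval, h0, hri]
      omega
    have hd : (d + 1) * (K' * (K * l) * (n + 1) ^ K' + 17 * (K' * (K * l)) + 14 * l) =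
        d * (K' * (K * l) * (n + 1) ^ K' + 17 * (K' * (K * l)) + 14 * l) +
        K' * (K * l) * (n + 1) ^ K' + 17 * (K' * (K * l)) + 14 * l := by ring
    rw [hd]
    omega

/-- The `n` rounds cost one more power of `n + 1` than the body. -/
theorem computes_fold {a b : Tm} {K K' : ℕ} (ha : Computes a K) (hb : Computes b K') :
    ∃ K, Computes (.fold a b) K := by
  set E := 2 * K + 18 * (K' * K) + K' + 30 with hE
  refine ⟨E, by omega, fun n M l env ρ r s hF => ?_⟩
  obtain ⟨va, Ta, sa, xa, ta, ra, ga⟩ := ha.2 n M l env ρ (r + 1) s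
    (hF.mono (Agree.refl r s) (by omega) le_rfl)
  have hl := hF.one_le
  have hga : Agree r s sa := ⟨fun j hj => ga.1 j (by omega), ga.2⟩
  obtain ⟨T, s₂, x, t, hr, g⟩ := loop_exec (a := a) (b := b) ha.1 hb hF va n 0
    { sa with reg := Function.update sa.reg r 0 } (by omega) (hga.update le_rfl _) (by simp)
    (by simp [ra, loopVal])
  have hval : (Tm.fold a b).eval n M s.mem ρ < 2 ^ (K * l) := by
    simp only [Tm.eval]
    cases n with
    | zero => exact va
    | succ n => exact lt_two_pow_mul ((Nat.mod_lt _ hF.modulus_pos).trans_le hF.modulus_le) ha.1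
  refine ⟨hval.trans_le (Nat.pow_le_pow_right (by norm_num) (Nat.mul_le_mul_right l (by omega))),
    _, _, Exec.seq xa (Exec.seq (Exec.assign sa r (.lit 0)) (Exec.seq x (Exec.assign s₂ r _))), ?_,
    by simp [Expr.eval, hr], g.update le_rfl _⟩
  have h1 := Nat.size_le.2 hval
  have c1 : (Expr.reg (r + 1)).cost s₂ ≤ 1 + K * l := by
    simp only [Expr.cost, hr]
    omega
  have c2 : (Expr.lit 0).cost sa = 1 := by simp [Expr.cost]
  have hN : 1 ≤ n + 1 := by omega
  have h4 : Ta ≤ K * l * (n + 1) ^ E := ta.trans (bound_mono hN (by omega))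
  have h5 : K' * (K * l) * (n + 1) ^ K' + 17 * (K' * (K * l)) + 14 * l ≤
      (18 * (K' * K) + 14) * l * (n + 1) ^ K' := by
    have := le_bound (c := 17 * (K' * K) + 14) (l := l) (K := K') hN
    nlinarith
  have h6 : n * (K' * (K * l) * (n + 1) ^ K' + 17 * (K' * (K * l)) + 14 * l) ≤
      (18 * (K' * K) + 14) * l * (n + 1) ^ E := by
    refine (Nat.mul_le_mul (show n ≤ n + 1 by omega) h5).trans ?_
    rw [mul_comm, mul_assoc, ← pow_succ]
    exact Nat.mul_le_mul_left _ (Nat.pow_le_pow_right hN (by omega))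
  have h7 : (K + 11) * l ≤ (K + 11) * l * (n + 1) ^ E := le_bound hN
  have h8 : E * l * (n + 1) ^ E = K * l * (n + 1) ^ E + (18 * (K' * K) + 14) * l * (n + 1) ^ E +
      (K + 11) * l * (n + 1) ^ E + (K' + 5) * l * (n + 1) ^ E := by
    rw [← Nat.add_mul, ← Nat.add_mul, ← Nat.add_mul, ← Nat.add_mul, ← Nat.add_mul, ← Nat.add_mul]
    congr 2
    omega
  have h9 : 7 * l + K * l + 4 ≤ (K + 11) * l := by nlinarith
  rw [h8, c2]
  clear_value E
  omega

/-- Every term is computed by its compilation in polynomial time. -/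
theorem exists_computes (t : Tm) : ∃ K, Computes t K := by
  induction t with
  | lit c => exact ⟨_, computes_lit c⟩
  | var k => exact ⟨_, computes_var k⟩
  | size => exact ⟨_, computes_size⟩
  | mem a ih =>
    obtain ⟨_, h⟩ := ih
    exact ⟨_, computes_mem h⟩
  | op o a b iha ihb =>
    obtain ⟨_, ha⟩ := iha
    obtain ⟨_, hb⟩ := ihb
    exact ⟨_, computes_op o ha hb⟩
  | ite c a b ihc iha ihb =>
    obtain ⟨_, hc⟩ := ihc
    obtain ⟨_, ha⟩ := iha
    obtain ⟨_, hb⟩ := ihb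
    exact ⟨_, computes_ite hc ha hb⟩
  | bind a b iha ihb =>
    obtain ⟨_, ha⟩ := iha
    obtain ⟨_, hb⟩ := ihb
    exact ⟨_, computes_bind ha hb⟩
  | call f a b c d e ihf iha ihb ihc ihd ihe =>
    obtain ⟨_, hf⟩ := ihf
    obtain ⟨_, ha⟩ := iha
    obtain ⟨_, hb⟩ := ihb
    obtain ⟨_, hc⟩ := ihc
    obtain ⟨_, hd⟩ := ihd
    obtain ⟨_, he⟩ := ihe
    exact computes_call hf ha hb hc hd he
  | fold a b iha ihb =>
    obtain ⟨_, ha⟩ := iha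
    obtain ⟨_, hb⟩ := ihb
    exact computes_fold ha hb

end RAM

namespace RAM

/-! ### Vertex sets as binary numbers -/

section SetCode

variable {n : ℕ}

theorem setCode_eq_sum_map (S : Finset (Fin n)) :
    setCode S = ∑ i ∈ S.map Fin.valEmbedding, 2 ^ i := by
  simp [setCode]

theorem setCode_lt (S : Finset (Fin n)) : setCode S < 2 ^ n := by
  rw [setCode_eq_sum_map]
  refine Nat.geomSum_lt le_rfl fun k hk => ?_
  obtain ⟨i, _, rfl⟩ := Finset.mem_map.1 hk
  exact i.2

/-- The powers below `i` sum to less than `2 ^ i` and vanish in the quotient; those above `i`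
contribute an even number to it. -/
theorem sum_two_pow_bit (S : Finset ℕ) (i : ℕ) :
    (∑ j ∈ S, 2 ^ j) / 2 ^ i % 2 = if i ∈ S then 1 else 0 := by
  have hsplit := Finset.sum_filter_add_sum_filter_not S (fun j => j < i) (fun j => 2 ^ j)
  have hlow : ∑ j ∈ S with j < i, 2 ^ j < 2 ^ i :=
    Nat.geomSum_lt le_rfl fun k hk => (Finset.mem_filter.1 hk).2
  have hhigh : ∑ j ∈ S with ¬ j < i, 2 ^ j = 2 ^ i * ∑ j ∈ S with ¬ j < i, 2 ^ (j - i) := by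
    rw [Finset.mul_sum]
    refine Finset.sum_congr rfl fun j hj => ?_
    have := (Finset.mem_filter.1 hj).2
    rw [← pow_add]
    congr 1
    omega
  rw [← hsplit, hhigh, Nat.add_mul_div_left _ _ (by positivity), Nat.div_eq_of_lt hlow, zero_add]
  by_cases hi : i ∈ S
  · have him : i ∈ ({j ∈ S | ¬ j < i} : Finset ℕ) := by simp [hi]
    rw [← Finset.add_sum_erase _ _ him, if_pos hi, Nat.sub_self, pow_zero]
    have : 2 ∣ ∑ j ∈ ({j ∈ S | ¬ j < i} : Finset ℕ).erase i, 2 ^ (j - i) := by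
      refine Finset.dvd_sum fun j hj => ?_
      simp only [Finset.mem_erase, Finset.mem_filter] at hj
      exact dvd_pow_self 2 (by omega)
    omega
  · rw [if_neg hi]
    refine Nat.mod_eq_zero_of_dvd (Finset.dvd_sum fun j hj => ?_)
    simp only [Finset.mem_filter] at hj
    have : j ≠ i := fun e => hi (e ▸ hj.1)
    exact dvd_pow_self 2 (by omega)

theorem setCode_bit (S : Finset (Fin n)) (i : Fin n) :
    setCode S / 2 ^ (i : ℕ) % 2 = if i ∈ S then 1 else 0 := by
  rw [setCode_eq_sum_map, sum_two_pow_bit]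
  congr 1
  simp [← Fin.ext_iff]

theorem setCode_insert {S : Finset (Fin n)} {i : Fin n} (h : i ∉ S) :
    setCode (insert i S) = setCode S + 2 ^ (i : ℕ) := by
  rw [setCode, Finset.sum_insert h, add_comm]
  rfl

theorem setCode_empty : setCode (∅ : Finset (Fin n)) = 0 := by
  simp [setCode]

theorem setCode_singleton (i : Fin n) : setCode {i} = 2 ^ (i : ℕ) := by
  simp [setCode]

end SetCode

/-! ### Terms for vertex sets -/

namespace Tm

/-- The term `a - b`. -/
abbrev sub (a b : Tm) : Tm := .op .sub a b

/-- The term `a + b`. -/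
abbrev add (a b : Tm) : Tm := .op .add a b

/-- The term `a * b`. -/
abbrev mul (a b : Tm) : Tm := .op .mul a b

/-- The term `a / b`. -/
abbrev div (a b : Tm) : Tm := .op .div a b

/-- The term `a % b`. -/
abbrev mod (a b : Tm) : Tm := sub a (mul b (div a b))

/-- Negation of a test. -/
abbrev neg (a : Tm) : Tm := .ite a (.lit 0) (.lit 1)

/-- Conjunction of tests. -/
abbrev conj (a b : Tm) : Tm := .ite a b (.lit 0)

/-- Disjunction of tests. -/
abbrev disj (a b : Tm) : Tm := .ite a (.lit 1) b

/-- A power of two, for exponents up to the number of vertices. -/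
def pow (j : Tm) : Tm :=
  .call (.fold (.lit 1) (.ite (sub (.var 0) (.var 5)) (mul (.lit 2) (.var 6)) (.var 6)))
    j (.lit 0) (.lit 0) (.lit 0) (.lit 0)

/-- The bit of `x` at position `j`. -/
def bit (x j : Tm) : Tm :=
  .call (mod (div (.var 0) (pow (.var 1))) (.lit 2)) x j (.lit 0) (.lit 0) (.lit 0)

/-- The entry of the adjacency matrix. -/
def adj (u v : Tm) : Tm := .mem (add (mul u .size) v)

/-- Some vertex passes the test; `d` is the length of the environment. -/
def any (d : ℕ) (φ : Tm) : Tm := .fold (.lit 0) (.ite φ (.lit 1) (.var (d + 1)))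

/-- All vertices pass the test. -/
def all (d : ℕ) (φ : Tm) : Tm := neg (any d (neg φ))

/-- The set of vertices that pass the test. -/
def mask (d : ℕ) (φ : Tm) : Tm :=
  .fold (.lit 0) (.ite φ (add (.var (d + 1)) (pow (.var d))) (.var (d + 1)))

/-- One more than the first vertex that passes the test, or zero. -/
def find (d : ℕ) (φ : Tm) : Tm :=
  .fold (.lit 0)
    (.ite (.var (d + 1)) (.var (d + 1)) (.ite φ (add (.var d) (.lit 1)) (.lit 0)))

/-- Binomial coefficients. -/
def binom (a b : Tm) : Tm :=
  .call (.fold (.lit 1) (.ite (sub (.var 1) (.var 5))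
    (div (mul (.var 6) (sub (.var 0) (.var 5))) (add (.var 5) (.lit 1))) (.var 6)))
    a b (.lit 0) (.lit 0) (.lit 0)

end Tm

/-- The setting in which terms are evaluated: the memory starts with the adjacency matrix of `G`,
and the modulus is large. -/
structure Holds {n : ℕ} (G : SimpleGraph (Fin n)) (M : ℕ) (m : ℕ → ℕ) : Prop where
  pos : 0 < n
  le_modulus : 2 ^ (100 * n) ≤ M
  adj_iff : ∀ i j : Fin n, m ((i : ℕ) * n + j) ≠ 0 ↔ G.Adj i j

/-- The term is nonzero exactly if `P` holds. -/
def Decides (n M : ℕ) (m : ℕ → ℕ) (t : Tm) (ρ : List ℕ) (P : Prop) : Prop :=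
  t.eval n M m ρ ≠ 0 ↔ P

/-! ### Values of the basic terms. -/

section Eval

variable {n : ℕ} {G : SimpleGraph (Fin n)} {M : ℕ} {m : ℕ → ℕ} {ρ : List ℕ}

theorem Holds.two_pow_lt (h : Holds G M m) {k : ℕ} (hk : k < 100 * n) : 2 ^ k < M :=
  (Nat.pow_lt_pow_right (by norm_num) hk).trans_le h.le_modulus

theorem eval_mod (a b : Tm) :
    (Tm.mod a b).eval n M m ρ = a.eval n M m ρ % b.eval n M m ρ := by
  simp only [Tm.eval, Op.val]
  have := Nat.div_add_mod (a.eval n M m ρ) (b.eval n M m ρ)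
  omega

theorem loopVal_eq_of {f : ℕ → ℕ → ℕ} {a : ℕ} (g : ℕ → ℕ) (h0 : a = g 0)
    (hs : ∀ k < n, f k (g k) = g (k + 1)) : loopVal f a n = g n := by
  have : ∀ k ≤ n, loopVal f a k = g k := by
    intro k
    induction k with
    | zero => exact fun _ => h0
    | succ k ih =>
      intro hk
      rw [loopVal, ih (by omega), hs k (by omega)]
  exact this n le_rfl

theorem eval_pow (h : Holds G M m) {t : Tm} {j : ℕ} (ht : t.eval n M m ρ = j) (hj : j ≤ n) :
    (Tm.pow t).eval n M m ρ = 2 ^ j := by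
  have hn := h.pos
  simp only [Tm.pow, Tm.eval, ht]
  -- The loop always runs `n` rounds but stops doubling after `j` of them; this is why `j ≤ n` is
  -- needed.
  rw [loopVal_eq_of (fun k => 2 ^ min k j)]
  · simp [hj]
  · simp
  · intro k hk
    by_cases hkj : k < j
    · have h1 : min k j = k := by omega
      have h2 : min (k + 1) j = k + 1 := by omega
      have : 2 ^ (k + 1) < M := h.two_pow_lt (by omega)
      have h3 : j - k ≠ 0 := by omega
      simp only [List.cons_append, List.nil_append, List.getD_cons_succ, List.getD_cons_zero, Op.val,
        h1, h2, h3, ne_eq, not_false_eq_true, if_true]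
      rw [← pow_succ', Nat.mod_eq_of_lt this]
    · have h1 : min k j = j := by omega
      have h2 : min (k + 1) j = j := by omega
      have : 2 ^ j < M := h.two_pow_lt (by omega)
      have h3 : j - k = 0 := by omega
      simp only [List.cons_append, List.nil_append, List.getD_cons_succ, List.getD_cons_zero, Op.val,
        h1, h2, h3, ne_eq, not_true_eq_false, if_false]
      rw [Nat.mod_eq_of_lt this]

theorem eval_bit (h : Holds G M m) {a b : Tm} {S : Finset (Fin n)} {i : Fin n}
    (ha : a.eval n M m ρ = setCode S) (hb : b.eval n M m ρ = i) :
    (Tm.bit a b).eval n M m ρ = if i ∈ S then 1 else 0 := by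
  have hp := eval_pow h (ρ := [setCode S, i, 0, 0, 0]) (t := .var 1) (j := i) rfl i.2.le
  rw [Tm.bit, Tm.eval, eval_mod, ← setCode_bit]
  simp only [ha, hb, Tm.eval]
  simp [Op.val, hp]

theorem decides_bit (h : Holds G M m) {a b : Tm} {S : Finset (Fin n)} {i : Fin n}
    (ha : a.eval n M m ρ = setCode S) (hb : b.eval n M m ρ = i) :
    Decides n M m (Tm.bit a b) ρ (i ∈ S) := by
  rw [Decides, eval_bit h ha hb]
  by_cases hi : i ∈ S <;> simp [hi]

theorem decides_adj (h : Holds G M m) {a b : Tm} {i j : Fin n}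
    (ha : a.eval n M m ρ = i) (hb : b.eval n M m ρ = j) :
    Decides n M m (Tm.adj a b) ρ (G.Adj i j) := by
  rw [Decides, ← h.adj_iff]
  simp [Tm.adj, Tm.eval, ha, hb, Op.val]

theorem decides_lt {a b : Tm} {x y : ℕ} (ha : a.eval n M m ρ = x) (hb : b.eval n M m ρ = y) :
    Decides n M m (Tm.sub b a) ρ (x < y) := by
  simp only [Decides, Tm.eval, ha, hb, Op.val]
  omega

theorem Decides.congr {t : Tm} {P Q : Prop} (h : Decides n M m t ρ P) (hPQ : P ↔ Q) :
    Decides n M m t ρ Q := h.trans hPQ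

theorem Decides.neg {t : Tm} {P : Prop} (h : Decides n M m t ρ P) :
    Decides n M m (Tm.neg t) ρ (¬ P) := by
  unfold Decides at *
  simp only [Tm.eval]
  by_cases h0 : t.eval n M m ρ = 0
  · simp_all
  · simp_all

theorem Decides.conj {t u : Tm} {P Q : Prop} (h : Decides n M m t ρ P) (h' : Decides n M m u ρ Q) :
    Decides n M m (Tm.conj t u) ρ (P ∧ Q) := by
  unfold Decides at *
  simp only [Tm.eval]
  by_cases h0 : t.eval n M m ρ = 0
  · simp_all
  · simp_all

theorem Decides.disj {t u : Tm} {P Q : Prop} (h : Decides n M m t ρ P) (h' : Decides n M m u ρ Q) :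
    Decides n M m (Tm.disj t u) ρ (P ∨ Q) := by
  unfold Decides at *
  simp only [Tm.eval]
  by_cases h0 : t.eval n M m ρ = 0
  · simp_all
  · simp_all

open Classical in
theorem Decides.eval_ite {c a b : Tm} {P : Prop} (h : Decides n M m c ρ P) :
    (Tm.ite c a b).eval n M m ρ = if P then a.eval n M m ρ else b.eval n M m ρ := by
  unfold Decides at h
  simp only [Tm.eval]
  exact if_congr h rfl rfl

theorem getD_length_append (ρ : List ℕ) (x y : ℕ) :
    (ρ ++ [x, y]).getD ρ.length 0 = x ∧ (ρ ++ [x, y]).getD (ρ.length + 1) 0 = y := by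
  simp [List.getD_eq_getElem?_getD]

theorem decides_any (h : Holds G M m) {d : ℕ} (hd : ρ.length = d) {φ : Tm} {P : Fin n → Prop}
    (hφ : ∀ (i : Fin n) (x : ℕ), Decides n M m φ (ρ ++ [(i : ℕ), x]) (P i)) :
    Decides n M m (Tm.any d φ) ρ (∃ i, P i) := by
  classical
  subst hd
  have hM : 1 < M := by simpa using h.two_pow_lt (k := 0) (by have := h.pos; omega)
  have : (Tm.any ρ.length φ).eval n M m ρ = if ∃ i : Fin n, (i : ℕ) < n ∧ P i then 1 else 0 := by
    rw [Tm.any, Tm.eval]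
    refine loopVal_eq_of (fun k => if ∃ i : Fin n, (i : ℕ) < k ∧ P i then 1 else 0) ?_ ?_
    · simp [Tm.eval]
    · intro k hk
      rw [(hφ ⟨k, hk⟩ _).eval_ite]
      simp only [Tm.eval, (getD_length_append ρ _ _).2]
      by_cases hP : P ⟨k, hk⟩
      · rw [if_pos hP, if_pos ⟨⟨k, hk⟩, Nat.lt_succ_self k, hP⟩, Nat.mod_eq_of_lt hM]
      · have hiff : (∃ i : Fin n, (i : ℕ) < k + 1 ∧ P i) ↔ ∃ i : Fin n, (i : ℕ) < k ∧ P i := by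
          refine exists_congr fun i => and_congr_left fun hi => ?_
          have : (i : ℕ) ≠ k := fun e => hP (by
            have : i = ⟨k, hk⟩ := Fin.ext e
            exact this ▸ hi)
          omega
        rw [if_neg hP, if_congr hiff rfl rfl, Nat.mod_eq_of_lt]
        split_ifs <;> omega
  rw [Decides, this]
  simp

theorem decides_all (h : Holds G M m) {d : ℕ} (hd : ρ.length = d) {φ : Tm} {P : Fin n → Prop}
    (hφ : ∀ (i : Fin n) (x : ℕ), Decides n M m φ (ρ ++ [(i : ℕ), x]) (P i)) :
    Decides n M m (Tm.all d φ) ρ (∀ i, P i) :=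
  (decides_any h hd fun i x => (hφ i x).neg).neg.congr (by simp)

open Classical in
theorem eval_mask (h : Holds G M m) {d : ℕ} (hd : ρ.length = d) {φ : Tm} {P : Fin n → Prop}
    (hφ : ∀ (i : Fin n) (x : ℕ), Decides n M m φ (ρ ++ [(i : ℕ), x]) (P i)) :
    (Tm.mask d φ).eval n M m ρ = setCode ({i | P i} : Finset (Fin n)) := by
  subst hd
  have hn := h.pos
  rw [Tm.mask, Tm.eval, loopVal_eq_of
    (fun k => setCode ({i | (i : ℕ) < k ∧ P i} : Finset (Fin n)))]
  · simp
  · simp [Tm.eval, setCode]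
  · intro k hk
    rw [(hφ ⟨k, hk⟩ _).eval_ite]
    have hlt : setCode ({i | (i : ℕ) < k + 1 ∧ P i} : Finset (Fin n)) < M :=
      (setCode_lt _).trans (h.two_pow_lt (by omega))
    by_cases hP : P ⟨k, hk⟩
    · have : ({i | (i : ℕ) < k + 1 ∧ P i} : Finset (Fin n)) =
          insert ⟨k, hk⟩ ({i | (i : ℕ) < k ∧ P i} : Finset (Fin n)) := by
        ext i
        simp only [Finset.mem_filter, Finset.mem_univ, true_and, Finset.mem_insert, Fin.ext_iff]
        constructor
        · rintro ⟨h1, h2⟩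
          by_cases e : (i : ℕ) = k
          · exact Or.inl e
          · exact Or.inr ⟨by omega, h2⟩
        · rintro (h1 | h1)
          · have : i = ⟨k, hk⟩ := Fin.ext h1
            exact ⟨by omega, this ▸ hP⟩
          · exact ⟨by omega, h1.2⟩
      rw [this, setCode_insert (by simp)] at hlt ⊢
      rw [if_pos hP]
      have hp := fun x => eval_pow h (ρ := ρ ++ [k, x]) (t := .var ρ.length) (j := k)
        (by simp [Tm.eval]) hk.le
      simp only [Tm.eval, (getD_length_append ρ _ _).2, Op.val, hp]
      rw [Nat.mod_eq_of_lt hlt]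
    · have : ({i | (i : ℕ) < k + 1 ∧ P i} : Finset (Fin n)) =
          ({i | (i : ℕ) < k ∧ P i} : Finset (Fin n)) := by
        ext i
        simp only [Finset.mem_filter, Finset.mem_univ, true_and]
        refine and_congr_left fun hi => ?_
        have : (i : ℕ) ≠ k := fun e => hP (by
          have : i = ⟨k, hk⟩ := Fin.ext e
          exact this ▸ hi)
        omega
      rw [this] at hlt ⊢
      rw [if_neg hP]
      simp only [Tm.eval, (getD_length_append ρ _ _).2]
      rw [Nat.mod_eq_of_lt hlt]

/-- One more than the first element of a set of vertices, or zero. -/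
def firstSucc (S : Finset (Fin n)) : ℕ :=
  if h : S.Nonempty then (S.min' h : ℕ) + 1 else 0

theorem firstSucc_eq {S : Finset (Fin n)} {i : Fin n} (hi : i ∈ S) (hmin : ∀ j ∈ S, i ≤ j) :
    firstSucc S = i + 1 := by
  have hS : S.Nonempty := ⟨i, hi⟩
  rw [firstSucc, dif_pos hS]
  congr 2
  exact le_antisymm (S.min'_le i hi) (hmin _ (S.min'_mem hS))

open Classical in
theorem eval_find (h : Holds G M m) {d : ℕ} (hd : ρ.length = d) {φ : Tm} {P : Fin n → Prop}
    (hφ : ∀ (i : Fin n) (x : ℕ), Decides n M m φ (ρ ++ [(i : ℕ), x]) (P i)) :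
    (Tm.find d φ).eval n M m ρ = firstSucc ({i | P i} : Finset (Fin n)) := by
  subst hd
  have hn := h.pos
  have hnM : n < M := (Nat.lt_two_pow_self).trans (h.two_pow_lt (by omega))
  rw [Tm.find, Tm.eval, loopVal_eq_of
    (fun k => firstSucc ({i | (i : ℕ) < k ∧ P i} : Finset (Fin n)))]
  · simp
  · simp [Tm.eval, firstSucc]
  · intro k hk
    simp only [Tm.eval, (getD_length_append ρ _ _).2, (getD_length_append ρ _ _).1, Op.val]
    by_cases hne : ({i | (i : ℕ) < k ∧ P i} : Finset (Fin n)).Nonempty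
    · have hmem := Finset.min'_mem _ hne
      set i := Finset.min' _ hne with hi
      simp only [Finset.mem_filter, Finset.mem_univ, true_and] at hmem
      have h1 : firstSucc ({i | (i : ℕ) < k ∧ P i} : Finset (Fin n)) = i + 1 := by
        rw [firstSucc, dif_pos hne]
      have h2 : firstSucc ({i | (i : ℕ) < k + 1 ∧ P i} : Finset (Fin n)) = i + 1 := by
        refine firstSucc_eq (by simp [hmem.2]; omega) fun j hj => ?_
        simp only [Finset.mem_filter, Finset.mem_univ, true_and] at hj
        by_cases hjk : (j : ℕ) < k
        · exact Finset.min'_le _ _ (by simp [hj.2, hjk])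
        · rw [Fin.le_def]
          omega
      rw [h1, h2]
      have := i.2
      rw [if_pos (by omega), Nat.mod_eq_of_lt (by omega)]
    · have h1 : firstSucc ({i | (i : ℕ) < k ∧ P i} : Finset (Fin n)) = 0 := by
        rw [firstSucc, dif_neg hne]
      rw [h1, if_neg (by simp)]
      have hφ' := hφ ⟨k, hk⟩ 0
      rw [Decides] at hφ'
      simp only at hφ'
      have hnone : ∀ i : Fin n, (i : ℕ) < k → ¬ P i := by
        intro i hi hP
        exact hne ⟨i, by simp [hi, hP]⟩
      by_cases hP : P ⟨k, hk⟩
      · rw [if_pos (hφ'.2 hP)]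
        have h2 : firstSucc ({i | (i : ℕ) < k + 1 ∧ P i} : Finset (Fin n)) = k + 1 := by
          refine firstSucc_eq (i := ⟨k, hk⟩) (by simp [hP]) fun j hj => ?_
          simp only [Finset.mem_filter, Finset.mem_univ, true_and] at hj
          rw [Fin.le_def]
          by_contra hlt
          exact hnone j (by simpa using hlt) hj.2
        rw [h2, Nat.mod_eq_of_lt (by omega)]
      · rw [if_neg (fun h' => hP (hφ'.1 h'))]
        have h2 : firstSucc ({i | (i : ℕ) < k + 1 ∧ P i} : Finset (Fin n)) = 0 := by
          rw [firstSucc, dif_neg]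
          rintro ⟨j, hj⟩
          simp only [Finset.mem_filter, Finset.mem_univ, true_and] at hj
          by_cases hjk : (j : ℕ) < k
          · exact hnone j hjk hj.2
          · have : j = ⟨k, hk⟩ := Fin.ext (by simp; omega)
            exact hP (this ▸ hj.2)
        rw [h2, Nat.zero_mod]

/-- The division in each round is exact, by `choose (k + 1) * (k + 1) = choose k * (x - k)`; after
`y` rounds the value is kept. -/
theorem eval_binom (h : Holds G M m) {a b : Tm} {x y : ℕ} (ha : a.eval n M m ρ = x)
    (hb : b.eval n M m ρ = y) (hx : x ≤ 2 * n) (hy : y ≤ n) :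
    (Tm.binom a b).eval n M m ρ = x.choose y := by
  have hn := h.pos
  have hlt : ∀ k, x.choose k < M := fun k => by
    refine lt_of_le_of_lt (Nat.choose_le_two_pow x k) (h.two_pow_lt (by omega))
  simp only [Tm.binom, Tm.eval, ha, hb]
  rw [loopVal_eq_of (fun k => x.choose (min k y))]
  · simp [hy]
  · simp
  · intro k hk
    simp only [List.cons_append, List.nil_append, List.getD_cons_succ, List.getD_cons_zero, Op.val]
    by_cases hky : k < y
    · have h1 : min k y = k := by omega
      have h2 : min (k + 1) y = k + 1 := by omega
      rw [if_pos (by omega), h1, h2, ← Nat.choose_succ_right_eq,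
        Nat.mul_div_cancel _ (by omega), Nat.mod_eq_of_lt (hlt _)]
    · have h1 : min k y = y := by omega
      have h2 : min (k + 1) y = y := by omega
      rw [if_neg (by omega), h1, h2, Nat.mod_eq_of_lt (hlt _)]

end Eval

end RAM

namespace SimpleGraph

/-! ### Components by breadth first search -/

section Components

variable {V : Type*} [Fintype V] [DecidableEq V] {G : SimpleGraph V}

open scoped Classical

/-- The set `S` together with its neighbours outside of `B`. -/
noncomputable def grow (G : SimpleGraph V) (B S : Finset V) : Finset V :=
  {u | u ∈ S ∨ u ∉ B ∧ G.Sees S u}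

theorem mem_grow {B S : Finset V} {u : V} : u ∈ G.grow B S ↔ u ∈ S ∨ u ∉ B ∧ G.Sees S u := by
  simp [grow]

theorem subset_grow {B S : Finset V} : S ⊆ G.grow B S := fun _ hu => mem_grow.2 (Or.inl hu)

/-- The component of `v` in `G - B`, by breadth first search. -/
noncomputable def compAt (G : SimpleGraph V) (B : Finset V) (v : V) : Finset V :=
  (G.grow B)^[Fintype.card V] {v}

theorem mem_grow_iterate (B : Finset V) (v : V) (k : ℕ) : v ∈ (G.grow B)^[k] {v} := by
  induction k with
  | zero => simp
  | succ k ih =>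
    rw [Function.iterate_succ_apply']
    exact subset_grow ih

/-- Every round that changes the set adds a vertex, so the search is stationary after as many rounds
as there are vertices. -/
theorem grow_compAt (B : Finset V) (v : V) : G.grow B (G.compAt B v) = G.compAt B v := by
  have key : ∀ k, G.grow B ((G.grow B)^[k] {v}) = (G.grow B)^[k] {v} ∨
      k + 1 ≤ ((G.grow B)^[k] {v}).card := by
    intro k
    induction k with
    | zero => exact Or.inr (by simp)
    | succ k ih =>
      rw [Function.iterate_succ_apply']
      rcases ih with ih | ih
      · exact Or.inl (by rw [ih, ih])
      · by_cases hfix : G.grow B ((G.grow B)^[k] {v}) = (G.grow B)^[k] {v}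
        · exact Or.inl (by rw [hfix, hfix])
        · refine Or.inr (Nat.succ_le_of_lt (ih.trans_lt (Finset.card_lt_card ?_)))
          exact Finset.ssubset_iff_subset_ne.2 ⟨subset_grow, Ne.symm hfix⟩
  refine (key (Fintype.card V)).resolve_right fun h => ?_
  have := Finset.card_le_univ ((G.grow B)^[Fintype.card V] {v})
  omega

theorem isCompOf_compAt {B : Finset V} {v : V} (hv : v ∉ B) : G.IsCompOf B (G.compAt B v) := by
  obtain ⟨C, hC, hvC⟩ := G.exists_isCompOf hv
  have hsub : ∀ k, (G.grow B)^[k] {v} ⊆ C := by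
    intro k
    induction k with
    | zero => simpa using hvC
    | succ k ih =>
      rw [Function.iterate_succ_apply']
      intro u hu
      rcases mem_grow.1 hu with hu | ⟨huB, a, ha, hau⟩
      · exact ih hu
      · exact (hC.2.2 a (ih ha) u hau).resolve_right huB
  have hsup : C ⊆ G.compAt B v := by
    refine hC.1.subset_of_closed ⟨v, hvC, mem_grow_iterate B v _⟩ fun a _ ha b hb hab => ?_
    rw [← grow_compAt]
    exact mem_grow.2 (Or.inr ⟨Finset.disjoint_left.1 hC.2.1 hb, a, ha, hab⟩)
  have heq : G.compAt B v = C := (hsub _).antisymm hsup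
  rwa [heq]

/-- Quantifiers over components become quantifiers over vertices, which bounded loops can evaluate.
-/
theorem exists_compAt_iff {B : Finset V} {P : Finset V → Prop} :
    (∃ v, v ∉ B ∧ P (G.compAt B v)) ↔ ∃ C, G.IsCompOf B C ∧ P C := by
  constructor
  · rintro ⟨v, hv, h⟩
    exact ⟨_, isCompOf_compAt hv, h⟩
  · rintro ⟨C, hC, h⟩
    obtain ⟨v, hv⟩ := hC.1.1
    have hvB := Finset.disjoint_left.1 hC.2.1 hv
    have := hC.eq_of_mem (isCompOf_compAt hvB) hv (mem_grow_iterate B v _)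
    exact ⟨v, hvB, this ▸ h⟩

theorem cliquishNotFullIn_iff {W Ω : Finset V} :
    G.CliquishNotFullIn W Ω ↔ (∀ u, ¬ (u ∈ W ∧ u ∈ Ω)) ∧
      (∀ v, v ∈ Ω ∪ W ∨ ∃ u, u ∈ Ω ∧ ¬ G.Sees (G.compAt (Ω ∪ W) v) u) ∧
      ∀ u v, ¬ u ∈ Ω ∨ ¬ v ∈ Ω ∨ u = v ∨ G.Adj u v ∨ ∃ c, c ∉ Ω ∪ W ∧
        G.Sees (G.compAt (Ω ∪ W) c) u ∧ G.Sees (G.compAt (Ω ∪ W) c) v := by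
  have h1 : Disjoint Ω W ↔ ∀ u, ¬ (u ∈ W ∧ u ∈ Ω) := by
    rw [Finset.disjoint_left]
    exact forall_congr' fun u => by tauto
  have h2 : (∀ C, G.IsCompOf (Ω ∪ W) C → ∃ x ∈ Ω, ¬ G.Sees C x) ↔
      ∀ v, v ∈ Ω ∪ W ∨ ∃ u, u ∈ Ω ∧ ¬ G.Sees (G.compAt (Ω ∪ W) v) u := by
    have := exists_compAt_iff (G := G) (B := Ω ∪ W) (P := fun C => ¬ ∃ u, u ∈ Ω ∧ ¬ G.Sees C u)
    constructor
    · intro h v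
      by_contra hcon
      push Not at hcon
      obtain ⟨C, hC, hC'⟩ := this.1 ⟨v, hcon.1, fun ⟨u, hu, hu'⟩ => hu' (hcon.2 u hu)⟩
      exact hC' (h C hC)
    · intro h C hC
      by_contra hcon
      obtain ⟨v, hv, hv'⟩ := this.2 ⟨C, hC, hcon⟩
      exact (h v).elim hv hv'
  rw [CliquishNotFullIn, h1, h2]
  refine and_congr_right fun _ => and_congr_right fun _ => ?_
  constructor
  · intro h u v
    by_cases hu : u ∈ Ω <;> by_cases hv : v ∈ Ω <;> by_cases huv : u = v <;>
      by_cases hadj : G.Adj u v <;> simp only [hu, hv, huv, hadj, true_or, or_true, not_true_eq_false,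
        not_false_eq_true, false_or]
    exact exists_compAt_iff.2 (h u hu v hv huv hadj)
  · intro h u hu v hv huv hadj
    have := h u v
    simp only [hu, hv, huv, hadj, not_true_eq_false, false_or] at this
    exact exists_compAt_iff.1 this

end Components

/-! ### Exploring a connected set with the help of a number -/

section Explore

variable {n : ℕ} {G : SimpleGraph (Fin n)}

open scoped Classical

/-- A state of the exploration: the part of the connected set and the part of its neighbourhood
found so far, how much of both is missing, and the advice. -/
structure Search (n : ℕ) where
  inner : Finset (Fin n)
  outer : Finset (Fin n)
  i : ℕ
  j : ℕ
  r : ℕ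

/-- The vertices to be classified next. -/
noncomputable def candidates (G : SimpleGraph (Fin n)) (X : Finset (Fin n)) (s : Search n) :
    Finset (Fin n) :=
  {u | u ∉ s.inner ∧ u ∉ s.outer ∧ u ∉ X ∧ G.Sees s.inner u}

theorem mem_candidates {X : Finset (Fin n)} {s : Search n} {u : Fin n} :
    u ∈ G.candidates X s ↔ u ∉ s.inner ∧ u ∉ s.outer ∧ u ∉ X ∧ G.Sees s.inner u := by
  simp [candidates]

/-- Classify the first candidate according to the advice. -/
noncomputable def searchStep (G : SimpleGraph (Fin n)) (X : Finset (Fin n)) (s : Search n) :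
    Search n :=
  if h : (G.candidates X s).Nonempty then
    if s.r < (s.i + s.j - 1).choose s.i then
      ⟨s.inner, insert ((G.candidates X s).min' h) s.outer, s.i, s.j - 1, s.r⟩
    else
      ⟨insert ((G.candidates X s).min' h) s.inner, s.outer, s.i - 1, s.j,
        s.r - (s.i + s.j - 1).choose s.i⟩
  else s

/-- Pascal's rule splits the numbers below `(i + j).choose i`: the first `(i + j - 1).choose i` put
the next candidate into the neighbourhood, the others into the set. Every candidate is in `D` or
`F`, and the induction is on the number of vertices not yet found. -/
theorem Stage.exists_advice_of_subset {X : Finset (Fin n)} {z : Fin n} {D F : Finset (Fin n)}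
    {i₀ j₀ : ℕ} (h : G.Stage X z D F i₀ j₀) (k : ℕ) :
    ∀ (i j : ℕ) (D' F' : Finset (Fin n)), i + j = k → z ∈ D' → D' ⊆ D → F' ⊆ F →
      D.card = D'.card + i → F.card = F'.card + j →
      ∃ r < (i + j).choose i, ∀ K ≥ k,
        (G.searchStep X)^[K] ⟨D', F', i, j, r⟩ = ⟨D, F, 0, 0, 0⟩ := by
  obtain ⟨hconn, hz, hX, hF, _, _⟩ := h
  have hdisj : ∀ u ∈ F, u ∉ D := fun u hu => by
    rw [hF, Finset.mem_sdiff, mem_nbr] at hu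
    exact hu.1.1
  have hcand : ∀ s : Search n, s.inner ⊆ D → ∀ u ∈ G.candidates X s, u ∈ D ∨ u ∈ F := by
    intro s hs u hu
    obtain ⟨_, _, huX, a, ha, hau⟩ := mem_candidates.1 hu
    by_cases huD : u ∈ D
    · exact Or.inl huD
    · right
      rw [hF, Finset.mem_sdiff, mem_nbr]
      exact ⟨⟨huD, a, hs ha, hau⟩, huX⟩
  induction k with
  | zero =>
    intro i j D' F' hk hzD hD hFF hDc hFc
    obtain rfl : i = 0 := by omega
    obtain rfl : j = 0 := by omega
    obtain rfl := Finset.eq_of_subset_of_card_le hD (by omega)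
    obtain rfl := Finset.eq_of_subset_of_card_le hFF (by omega)
    refine ⟨0, by simp, fun K _ => ?_⟩
    refine Function.iterate_fixed ?_ K
    rw [searchStep, dif_neg]
    rintro ⟨u, hu⟩
    have h1 := hcand ⟨D', F', 0, 0, 0⟩ (Finset.Subset.refl _) u hu
    have h2 := mem_candidates.1 hu
    exact h1.elim h2.1 h2.2.1
  | succ k ih =>
    intro i j D' F' hk hzD hD hFF hDc hFc
    -- While `D'` is incomplete, connectedness of `D` supplies a candidate; once `D' = D`, any
    -- missing vertex of `F` is one.
    have hne : ∀ r, (G.candidates X ⟨D', F', i, j, r⟩).Nonempty := by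
      intro r
      by_cases hDD : D' = D
      · have : F' ≠ F := by
          rintro rfl
          subst hDD
          omega
        obtain ⟨u, huF, huF'⟩ := Finset.exists_of_ssubset
          (Finset.ssubset_iff_subset_ne.2 ⟨hFF, this⟩)
        have hu := huF
        rw [hF, Finset.mem_sdiff, mem_nbr] at hu
        subst hDD
        exact ⟨u, mem_candidates.2 ⟨hu.1.1, huF', hu.2, hu.1.2⟩⟩
      · obtain ⟨a, ha, b, hb, hbD, hab⟩ := hconn.2 D' hD ⟨z, hzD⟩ hDD
        refine ⟨b, mem_candidates.2 ⟨hbD, fun hbF => hdisj b (hFF hbF) hb,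
          hX b hb fun e => hbD (e ▸ hzD), a, ha, hab⟩⟩
    have hsame : ∀ r, G.candidates X ⟨D', F', i, j, r⟩ = G.candidates X ⟨D', F', i, j, 0⟩ :=
      fun r => rfl
    set u := (G.candidates X ⟨D', F', i, j, 0⟩).min' (hne 0) with hu
    have humem := Finset.min'_mem _ (hne 0)
    rw [← hu] at humem
    have hu' := mem_candidates.1 humem
    simp only at hu'
    have hpos : ∀ r, (G.searchStep X) ⟨D', F', i, j, r⟩ = if r < (i + j - 1).choose i then
        ⟨D', insert u F', i, j - 1, r⟩ else
        ⟨insert u D', F', i - 1, j, r - (i + j - 1).choose i⟩ := by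
      intro r
      rw [searchStep, dif_pos (hne r)]
      rfl
    rcases hcand _ hD u humem with huD | huF
    · have hi : i ≠ 0 := by
        rintro rfl
        exact hu'.1 ((Finset.eq_of_subset_of_card_le hD (by omega)).symm ▸ huD)
      obtain ⟨i, rfl⟩ := Nat.exists_eq_succ_of_ne_zero hi
      obtain ⟨r, hr, hK⟩ := ih i j (insert u D') F' (by omega) (by simp [hzD])
        (Finset.insert_subset huD hD) hFF
        (by rw [Finset.card_insert_of_notMem hu'.1]; omega) hFc
      have hpas : (i + 1 + j).choose (i + 1) = (i + j).choose i + (i + j).choose (i + 1) := by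
        rw [show i + 1 + j = (i + j) + 1 by omega, Nat.choose_succ_succ]
      refine ⟨r + (i + j).choose (i + 1), by rw [Nat.succ_eq_add_one, hpas]; omega, ?_⟩
      intro K hKk
      obtain ⟨K, rfl⟩ := Nat.exists_eq_succ_of_ne_zero (show K ≠ 0 by omega)
      rw [Function.iterate_succ_apply, hpos]
      have e : i.succ + j - 1 = i + j := by omega
      rw [e, if_neg (by simp), Nat.succ_sub_one, Nat.succ_eq_add_one, Nat.add_sub_cancel]
      exact hK K (by omega)
    · have hj : j ≠ 0 := by
        rintro rfl
        exact hu'.2.1 ((Finset.eq_of_subset_of_card_le hFF (by omega)).symm ▸ huF)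
      obtain ⟨j, rfl⟩ := Nat.exists_eq_succ_of_ne_zero hj
      obtain ⟨r, hr, hK⟩ := ih i j D' (insert u F') (by omega) hzD hD
        (Finset.insert_subset huF hFF) hDc
        (by rw [Finset.card_insert_of_notMem hu'.2.1]; omega)
      refine ⟨r, hr.trans_le (Nat.choose_le_choose i (by omega)), ?_⟩
      intro K hKk
      obtain ⟨K, rfl⟩ := Nat.exists_eq_succ_of_ne_zero (show K ≠ 0 by omega)
      rw [Function.iterate_succ_apply, hpos]
      have e : i + j.succ - 1 = i + j := by omega
      rw [e, if_pos hr, Nat.succ_sub_one]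
      exact hK K (by omega)

theorem Stage.add_lt {X : Finset (Fin n)} {z : Fin n} {D F : Finset (Fin n)}
    {i j : ℕ} (h : G.Stage X z D F i j) : i + j < n := by
  obtain ⟨_, _, _, hF, hD, hj⟩ := h
  have hd : Disjoint D F := by
    rw [Finset.disjoint_right]
    intro u hu
    rw [hF, Finset.mem_sdiff, mem_nbr] at hu
    exact hu.1.1
  have := Finset.card_le_univ (D ∪ F)
  rw [Finset.card_union_of_disjoint hd, Fintype.card_fin] at this
  omega

/-- With suitable advice, the exploration finds a given connected set and its neighbourhood. -/
theorem Stage.exists_advice {X : Finset (Fin n)} {z : Fin n} {D F : Finset (Fin n)}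
    {i j : ℕ} (h : G.Stage X z D F i j) :
    ∃ r < (i + j).choose i, (G.searchStep X)^[n] ⟨{z}, ∅, i, j, r⟩ = ⟨D, F, 0, 0, 0⟩ := by
  obtain ⟨r, hr, hK⟩ := h.exists_advice_of_subset (i + j) i j {z} ∅ rfl (by simp)
    (by simpa using h.2.1) (by simp) (by rw [h.2.2.2.2.1]; simp; omega)
    (by rw [h.2.2.2.2.2]; simp)
  exact ⟨r, hr, hK n h.add_lt.le⟩

end Explore

/-! ### Removing an initial segment of the vertices -/

section Segment

variable {n : ℕ} {G : SimpleGraph (Fin n)}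

/-- The vertices before position `k`. -/
def below (n k : ℕ) : Finset (Fin n) := {u | (u : ℕ) < k}

theorem mem_below {k : ℕ} {u : Fin n} : u ∈ below n k ↔ (u : ℕ) < k := by
  simp [below]

theorem below_succ {k : ℕ} (hk : k < n) : below n (k + 1) = insert ⟨k, hk⟩ (below n k) := by
  ext u
  simp only [mem_below, Finset.mem_insert, Fin.ext_iff]
  omega

theorem sdiff_below_succ {k : ℕ} (hk : k < n) (Ω : Finset (Fin n)) :
    Ω \ below n (k + 1) = (Ω \ below n k).erase ⟨k, hk⟩ := by
  ext u
  simp only [mem_below, Finset.mem_sdiff, Finset.mem_erase, ne_eq, Fin.ext_iff]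
  constructor
  · rintro ⟨h1, h2⟩
    exact ⟨by omega, h1, by omega⟩
  · rintro ⟨h1, h2, h3⟩
    exact ⟨h2, by omega⟩

/-- When one vertex remains, it belongs to `Ω`: otherwise its component would have to miss a vertex
of an empty set. Then no vertex lies outside `Ω` and the size condition is trivial. -/
theorem CliquishNotFullIn.hasCode_of_last (hn : 0 < n) {Ω : Finset (Fin n)}
    (h : G.CliquishNotFullIn (below n (n - 1)) Ω) : G.HasCode (below n (n - 1)) Ω := by
  set a : Fin n := ⟨n - 1, by omega⟩
  have hall : ∀ u : Fin n, u = a ∨ u ∈ below n (n - 1) := fun u => by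
    rw [mem_below, Fin.ext_iff]
    have := u.2
    simp only [a]
    omega
  have ha : a ∉ below n (n - 1) := by simp [mem_below, a]
  have haΩ : a ∈ Ω := by
    by_contra haΩ
    obtain ⟨C, hC, _⟩ := G.exists_isCompOf (Ω := Ω ∪ below n (n - 1)) (v := a) (by simp [haΩ, ha])
    obtain ⟨x, hx, _⟩ := h.2.1 C hC
    rcases hall x with rfl | hx'
    · exact haΩ hx
    · exact Finset.disjoint_left.1 h.1 hx hx'
  have huniv : (Ω ∪ below n (n - 1))ᶜ = ∅ := by
    rw [Finset.compl_eq_empty_iff, Finset.eq_univ_iff_forall]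
    intro u
    rcases hall u with rfl | hu
    · simp [haΩ]
    · simp [hu]
  refine h.hasCode_of_seenBy haΩ ?_
  have := Finset.card_le_card (seenBy_subset (G := G) (U := Ω ∪ below n (n - 1)) (z := a))
  rw [huniv, Finset.card_empty] at this
  omega

/-- Removing the vertices one after the other, one arrives at a set that has a code. -/
theorem CliquishNotFull.exists_hasCode (hn : 0 < n) {Ω : Finset (Fin n)}
    (h : G.CliquishNotFull Ω) : ∃ k < n, G.HasCode (below n k) (Ω \ below n k) ∧
      ∀ v ≤ k, G.CliquishNotFullIn (below n v) (Ω \ below n v) := by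
  have key : ∀ k < n, (∃ k' < n, G.HasCode (below n k') (Ω \ below n k') ∧
      ∀ v ≤ k', G.CliquishNotFullIn (below n v) (Ω \ below n v)) ∨
      ∀ v ≤ k, G.CliquishNotFullIn (below n v) (Ω \ below n v) := by
    intro k
    induction k with
    | zero =>
      refine fun _ => Or.inr fun v hv => ?_
      obtain rfl : v = 0 := by omega
      have : below n 0 = ∅ := by simp [below]
      rw [this, Finset.sdiff_empty]
      exact cliquishNotFullIn_empty.2 h
    | succ k ih =>
      intro hk
      rcases ih (by omega) with ih | ih
      · exact Or.inl ih
      · rcases (ih k le_rfl).erase_or_hasCode (a := ⟨k, by omega⟩) (by simp [mem_below]) with h' | h'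
        · refine Or.inr fun v hv => ?_
          rcases Nat.lt_or_eq_of_le hv with hv | rfl
          · exact ih v (by omega)
          · rw [below_succ (by omega), ← below_succ (by omega), sdiff_below_succ (by omega),
              below_succ (by omega)]
            exact h'
        · exact Or.inl ⟨k, by omega, h', ih⟩
  rcases key (n - 1) (by omega) with h' | h'
  · exact h'
  · exact ⟨n - 1, by omega, (h' _ le_rfl).hasCode_of_last hn, h'⟩

end Segment

end SimpleGraph

namespace RAM

/-! ### Terms for the graph algorithms -/

namespace Tm

/-- Equality of two numbers. -/
abbrev eq (a b : Tm) : Tm := neg (disj (sub a b) (sub b a))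

/-- A call with two arguments. -/
abbrev call₂ (f a b : Tm) : Tm := .call f a b (.lit 0) (.lit 0) (.lit 0)

/-- Some vertex of the set is adjacent to the vertex. -/
def sees (c x : Tm) : Tm :=
  call₂ (any 5 (conj (bit (.var 0) (.var 5)) (adj (.var 5) (.var 1)))) c x

/-- The component of a vertex after the removal of a set. -/
def comp (b v : Tm) : Tm :=
  call₂ (.fold (pow (.var 1)) (mask 7 (disj (bit (.var 6) (.var 7))
    (conj (neg (bit (.var 0) (.var 7))) (sees (.var 6) (.var 7)))))) b v

/-- The test for potential maximal cliques after the removal of a set. -/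
def cliquish (w x : Tm) : Tm :=
  call₂ (.bind (mask 5 (disj (bit (.var 1) (.var 5)) (bit (.var 0) (.var 5))))
    (conj (all 6 (neg (conj (bit (.var 0) (.var 6)) (bit (.var 1) (.var 6)))))
    (conj (all 6 (disj (bit (.var 5) (.var 6))
      (any 8 (conj (bit (.var 1) (.var 8)) (neg (sees (comp (.var 5) (.var 6)) (.var 8)))))))
    (all 6 (all 8 (disj (neg (bit (.var 1) (.var 6))) (disj (neg (bit (.var 1) (.var 8)))
      (disj (eq (.var 6) (.var 8)) (disj (adj (.var 6) (.var 8))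
        (any 10 (conj (neg (bit (.var 5) (.var 10)))
          (conj (sees (comp (.var 5) (.var 10)) (.var 6))
            (sees (comp (.var 5) (.var 10)) (.var 8)))))))))))))) w x

/-- The number that packs five numbers, the first four of them less than `q`. -/
def pack (q a b c d e : Tm) : Tm := add a (mul q (add b (mul q (add c (mul q (add d (mul q e)))))))

/-- The first packed number. -/
def part₀ (q s : Tm) : Tm := mod s q

/-- The second packed number. -/
def part₁ (q s : Tm) : Tm := mod (div s q) q

/-- The third packed number. -/
def part₂ (q s : Tm) : Tm := mod (div (div s q) q) q

/-- The fourth packed number. -/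
def part₃ (q s : Tm) : Tm := mod (div (div (div s q) q) q) q

/-- The fifth packed number. -/
def part₄ (q s : Tm) : Tm := div (div (div (div s q) q) q) q

/-- One step of the exploration, for the set `x` to be avoided, the packed state `s`, and the
base `q`. -/
def searchStep (x s q : Tm) : Tm :=
  .call (.bind (part₀ (.var 2) (.var 1)) (.bind (part₁ (.var 2) (.var 1))
    (.bind (part₂ (.var 2) (.var 1)) (.bind (part₃ (.var 2) (.var 1))
    (.bind (part₄ (.var 2) (.var 1))
    (.bind (find 10 (conj (neg (bit (.var 5) (.var 10))) (conj (neg (bit (.var 6) (.var 10)))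
      (conj (neg (bit (.var 0) (.var 10))) (sees (.var 5) (.var 10))))))
    (.bind (binom (sub (add (.var 7) (.var 8)) (.lit 1)) (.var 7))
    (.ite (.var 10) (.ite (sub (.var 11) (.var 9))
      (pack (.var 2) (.var 5) (add (.var 6) (pow (sub (.var 10) (.lit 1)))) (.var 7)
        (sub (.var 8) (.lit 1)) (.var 9))
      (pack (.var 2) (add (.var 5) (pow (sub (.var 10) (.lit 1)))) (.var 6)
        (sub (.var 7) (.lit 1)) (.var 8) (sub (.var 9) (.var 11))))
      (.var 1)))))))))
    x s q (.lit 0) (.lit 0)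

/-- The exploration. -/
def search (x z i j r : Tm) : Tm :=
  .call (.bind (pow .size) (.fold (pack (.var 5) (pow (.var 1)) (.lit 0) (.var 2) (.var 3) (.var 4))
    (searchStep (.var 0) (.var 7) (.var 5)))) x z i j r

/-- Reinsertion of the first `k` vertices. -/
def lift (x k : Tm) : Tm :=
  call₂ (.fold (.var 0) (.ite (sub (.var 1) (.var 5))
    (.ite (cliquish (mask 7 (sub (sub (sub (.var 1) (.var 5)) (.lit 1)) (.var 7))) (.var 6))
      (.var 6)
      (mask 7 (disj (bit (.var 6) (.var 7))
        (eq (.var 7) (sub (sub (.var 1) (.var 5)) (.lit 1))))))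
    (.var 6))) x k

end Tm

/-! ### Values of the graph terms. -/

section EvalGraph

variable {n : ℕ} {G : SimpleGraph (Fin n)} {M : ℕ} {m : ℕ → ℕ} {ρ : List ℕ}

open SimpleGraph

theorem decides_eq {a b : Tm} {x y : ℕ} (ha : a.eval n M m ρ = x) (hb : b.eval n M m ρ = y) :
    Decides n M m (Tm.eq a b) ρ (x = y) :=
  ((decides_lt hb ha).disj (decides_lt ha hb)).neg.congr (by omega)

theorem eval_call {f a b c d e : Tm} {v₀ v₁ v₂ v₃ v₄ : ℕ} (h₀ : a.eval n M m ρ = v₀)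
    (h₁ : b.eval n M m ρ = v₁) (h₂ : c.eval n M m ρ = v₂) (h₃ : d.eval n M m ρ = v₃)
    (h₄ : e.eval n M m ρ = v₄) :
    (Tm.call f a b c d e).eval n M m ρ = f.eval n M m [v₀, v₁, v₂, v₃, v₄] := by
  rw [Tm.eval, h₀, h₁, h₂, h₃, h₄]

theorem eval_call₂ {f a b : Tm} {v₀ v₁ : ℕ} (h₀ : a.eval n M m ρ = v₀)
    (h₁ : b.eval n M m ρ = v₁) :
    (Tm.call₂ f a b).eval n M m ρ = f.eval n M m [v₀, v₁, 0, 0, 0] :=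
  eval_call h₀ h₁ rfl rfl rfl

theorem eval_fold {a b : Tm} : (Tm.fold a b).eval n M m ρ =
    loopVal (fun i x => b.eval n M m (ρ ++ [i, x]) % M) (a.eval n M m ρ) n := rfl

theorem eval_add {a b : Tm} :
    (Tm.add a b).eval n M m ρ = a.eval n M m ρ + b.eval n M m ρ := rfl

theorem eval_ite_of_ne {c a b : Tm} (hc : c.eval n M m ρ ≠ 0) :
    (Tm.ite c a b).eval n M m ρ = a.eval n M m ρ := if_pos hc

theorem eval_mask_eq (h : Holds G M m) {d : ℕ} (hd : ρ.length = d) {φ : Tm} {S : Finset (Fin n)}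
    (hφ : ∀ (i : Fin n) (x : ℕ), Decides n M m φ (ρ ++ [(i : ℕ), x]) (i ∈ S)) :
    (Tm.mask d φ).eval n M m ρ = setCode S := by
  rw [eval_mask h hd hφ]
  congr 1
  ext
  simp

theorem eval_find_eq (h : Holds G M m) {d : ℕ} (hd : ρ.length = d) {φ : Tm} {S : Finset (Fin n)}
    (hφ : ∀ (i : Fin n) (x : ℕ), Decides n M m φ (ρ ++ [(i : ℕ), x]) (i ∈ S)) :
    (Tm.find d φ).eval n M m ρ = firstSucc S := by
  rw [eval_find h hd hφ]
  congr 1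
  ext
  simp

theorem Decides.call₂ {f a b : Tm} {v₀ v₁ : ℕ} {P : Prop} (h₀ : a.eval n M m ρ = v₀)
    (h₁ : b.eval n M m ρ = v₁) (h : Decides n M m f [v₀, v₁, 0, 0, 0] P) :
    Decides n M m (Tm.call₂ f a b) ρ P := by
  rwa [Decides, eval_call₂ h₀ h₁]

theorem Decides.bind {a b : Tm} {v : ℕ} {P : Prop} (h₀ : a.eval n M m ρ = v)
    (h : Decides n M m b (ρ ++ [v]) P) : Decides n M m (.bind a b) ρ P := by
  rwa [Decides, Tm.eval, h₀]

theorem decides_sees (h : Holds G M m) {a b : Tm} {S : Finset (Fin n)} {i : Fin n}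
    (ha : a.eval n M m ρ = setCode S) (hb : b.eval n M m ρ = i) :
    Decides n M m (Tm.sees a b) ρ (G.Sees S i) :=
  Decides.call₂ ha hb (decides_any h rfl fun _ _ =>
    (decides_bit h rfl rfl).conj (decides_adj h rfl rfl))

theorem Holds.setCode_lt (h : Holds G M m) (S : Finset (Fin n)) : setCode S < M :=
  (RAM.setCode_lt S).trans (h.two_pow_lt (by have := h.pos; omega))

/-- The invariant `P` keeps the codes below the modulus, so the reduction never takes effect and the
fold simulates `step`. -/
theorem eval_fold_iterate {α : Type*} {a b : Tm} (code : α → ℕ) (step : α → α) (P : α → Prop)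
    (s : α) (h0 : a.eval n M m ρ = code s) (hs : P s) (hstep : ∀ s, P s → P (step s))
    (hlt : ∀ s, P s → code s < M)
    (hb : ∀ i s, P s → b.eval n M m (ρ ++ [i, code s]) = code (step s)) :
    (Tm.fold a b).eval n M m ρ = code (step^[n] s) := by
  have hP : ∀ k, P (step^[k] s) := fun k => by
    induction k with
    | zero => exact hs
    | succ k ih => rw [Function.iterate_succ_apply']; exact hstep _ ih
  rw [Tm.eval]
  refine loopVal_eq_of (fun k => code (step^[k] s)) h0 fun k _ => ?_
  rw [hb k _ (hP k), Nat.mod_eq_of_lt (hlt _ (hstep _ (hP k))), Function.iterate_succ_apply']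

theorem eval_comp (h : Holds G M m) {a b : Tm} {B : Finset (Fin n)} {v : Fin n}
    (ha : a.eval n M m ρ = setCode B) (hb : b.eval n M m ρ = v) :
    (Tm.comp a b).eval n M m ρ = setCode (G.compAt B v) := by
  rw [Tm.comp, eval_call₂ ha hb, compAt, Fintype.card_fin]
  refine eval_fold_iterate setCode (G.grow B) (fun _ => True) {v} ?_ trivial (fun _ _ => trivial)
    (fun _ _ => h.setCode_lt _) fun i S _ => ?_
  · rw [setCode_singleton]
    exact eval_pow h rfl v.2.le
  · exact eval_mask_eq h rfl fun u x => Decides.congr ((decides_bit h rfl rfl).disj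
      ((decides_bit h rfl rfl).neg.conj (decides_sees h rfl rfl))) mem_grow.symm

theorem decides_cliquish (h : Holds G M m) {a b : Tm} {W Ω : Finset (Fin n)}
    (ha : a.eval n M m ρ = setCode W) (hb : b.eval n M m ρ = setCode Ω) :
    Decides n M m (Tm.cliquish a b) ρ (G.CliquishNotFullIn W Ω) := by
  classical
  have hB : (Tm.mask 5 (.disj (.bit (.var 1) (.var 5)) (.bit (.var 0) (.var 5)))).eval n M m
      [setCode W, setCode Ω, 0, 0, 0] = setCode (Ω ∪ W) :=
    eval_mask_eq h rfl fun u x => Decides.congr ((decides_bit h rfl rfl).disj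
      (decides_bit h rfl rfl)) Finset.mem_union.symm
  refine Decides.call₂ ha hb (Decides.bind hB (Decides.congr ?_ cliquishNotFullIn_iff.symm))
  refine (decides_all h rfl fun u _ => ?_).conj ((decides_all h rfl fun v _ => ?_).conj
    (decides_all h rfl fun u _ => decides_all h rfl fun v _ => ?_))
  · exact ((decides_bit h rfl rfl).conj (decides_bit h rfl rfl)).neg
  · exact (decides_bit h rfl rfl).disj (decides_any h rfl fun u _ =>
      (decides_bit h rfl rfl).conj (decides_sees h (eval_comp h rfl rfl) rfl).neg)
  · exact (decides_bit h rfl rfl).neg.disj ((decides_bit h rfl rfl).neg.disj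
      (((decides_eq rfl rfl).congr Fin.ext_iff.symm).disj ((decides_adj h rfl rfl).disj
        (decides_any h rfl fun c _ => (decides_bit h rfl rfl).neg.conj
          ((decides_sees h (eval_comp h rfl rfl) rfl).conj
            (decides_sees h (eval_comp h rfl rfl) rfl))))))

/-- The number that packs a state of the exploration. -/
def searchCode (s : Search n) : ℕ :=
  setCode s.inner + 2 ^ n * (setCode s.outer + 2 ^ n * (s.i + 2 ^ n * (s.j + 2 ^ n * s.r)))

/-- The numbers of the state are small. -/
def SmallSearch (s : Search n) : Prop :=
  s.i ≤ n ∧ s.j ≤ n ∧ s.r < 2 ^ (2 * n)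

/-- Four fields of `n` bits and `2 * n` bits of advice give `6 * n` bits, well within the modulus.
-/
theorem searchCode_lt (h : Holds G M m) {s : Search n} (hs : SmallSearch s) :
    searchCode s < M := by
  have h1 := setCode_lt s.inner
  have h2 := setCode_lt s.outer
  have h3 : s.i < 2 ^ n := hs.1.trans_lt Nat.lt_two_pow_self
  have h4 : s.j < 2 ^ n := hs.2.1.trans_lt Nat.lt_two_pow_self
  have h5 := hs.2.2
  have hn := h.pos
  refine lt_of_lt_of_le ?_ (h.two_pow_lt (k := 6 * n) (by omega)).le
  have key : ∀ {a b x y : ℕ}, a < 2 ^ x → b < 2 ^ y → a + 2 ^ x * b < 2 ^ (x + y) := by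
    intro a b x y ha hb
    rw [pow_add]
    calc a + 2 ^ x * b < 2 ^ x * (b + 1) := by rw [mul_add, mul_one]; omega
      _ ≤ 2 ^ x * 2 ^ y := Nat.mul_le_mul_left _ hb
  have := key h1 (key h2 (key h3 (key h4 h5)))
  rwa [show n + (n + (n + (n + 2 * n))) = 6 * n by ring] at this

theorem SmallSearch.step {X : Finset (Fin n)} {s : Search n} (hs : SmallSearch s) :
    SmallSearch (G.searchStep X s) := by
  obtain ⟨h1, h2, h3⟩ := hs
  rw [SimpleGraph.searchStep]
  split_ifs
  · exact ⟨h1, (Nat.sub_le _ _).trans h2, h3⟩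
  · exact ⟨(Nat.sub_le _ _).trans h1, h2, (Nat.sub_le _ _).trans_lt h3⟩
  · exact ⟨h1, h2, h3⟩

theorem eval_pack {q a b c d e : Tm} : (Tm.pack q a b c d e).eval n M m ρ =
    a.eval n M m ρ + q.eval n M m ρ * (b.eval n M m ρ + q.eval n M m ρ * (c.eval n M m ρ +
      q.eval n M m ρ * (d.eval n M m ρ + q.eval n M m ρ * e.eval n M m ρ))) := rfl

theorem eval_parts {q t : Tm} {s : Search n} (hs : SmallSearch s)
    (hq : q.eval n M m ρ = 2 ^ n) (ht : t.eval n M m ρ = searchCode s) :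
    (Tm.part₀ q t).eval n M m ρ = setCode s.inner ∧
    (Tm.part₁ q t).eval n M m ρ = setCode s.outer ∧
    (Tm.part₂ q t).eval n M m ρ = s.i ∧ (Tm.part₃ q t).eval n M m ρ = s.j ∧
    (Tm.part₄ q t).eval n M m ρ = s.r := by
  have h1 := setCode_lt s.inner
  have h2 := setCode_lt s.outer
  have h3 : s.i < 2 ^ n := hs.1.trans_lt Nat.lt_two_pow_self
  have h4 : s.j < 2 ^ n := hs.2.1.trans_lt Nat.lt_two_pow_self
  have hpos : 0 < 2 ^ n := by positivity
  have key : ∀ {a b : ℕ}, a < 2 ^ n → (a + 2 ^ n * b) / 2 ^ n = b := by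
    intro a b ha
    rw [Nat.add_mul_div_left _ _ hpos, Nat.div_eq_of_lt ha, zero_add]
  refine ⟨?_, ?_, ?_, ?_, ?_⟩ <;>
    simp only [Tm.part₀, Tm.part₁, Tm.part₂, Tm.part₃, Tm.part₄, eval_mod, Tm.eval, Op.val, hq, ht,
      searchCode, key h1, key h2, key h3, key h4, Nat.add_mul_mod_self_left,
      Nat.mod_eq_of_lt h1, Nat.mod_eq_of_lt h2, Nat.mod_eq_of_lt h3, Nat.mod_eq_of_lt h4]

theorem eval_bind {a b : Tm} {v : ℕ} (ha : a.eval n M m ρ = v) :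
    (Tm.bind a b).eval n M m ρ = b.eval n M m (ρ ++ [v]) := by
  rw [Tm.eval, ha]

theorem eval_searchStep (h : Holds G M m) {a b c : Tm} {X : Finset (Fin n)} {s : Search n}
    (hs : SmallSearch s) (ha : a.eval n M m ρ = setCode X) (hb : b.eval n M m ρ = searchCode s)
    (hc : c.eval n M m ρ = 2 ^ n) :
    (Tm.searchStep a b c).eval n M m ρ = searchCode (G.searchStep X s) := by
  classical
  obtain ⟨h1, h2, h3⟩ := hs
  have hn := h.pos
  rw [Tm.searchStep, eval_call ha hb hc (v₃ := 0) (v₄ := 0) rfl rfl,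
    eval_bind (eval_parts (s := s) ⟨h1, h2, h3⟩ rfl rfl).1,
    eval_bind (eval_parts (s := s) ⟨h1, h2, h3⟩ rfl rfl).2.1,
    eval_bind (eval_parts (s := s) ⟨h1, h2, h3⟩ rfl rfl).2.2.1,
    eval_bind (eval_parts (s := s) ⟨h1, h2, h3⟩ rfl rfl).2.2.2.1,
    eval_bind (eval_parts (s := s) ⟨h1, h2, h3⟩ rfl rfl).2.2.2.2,
    eval_bind (v := firstSucc (G.candidates X s)),
    eval_bind (v := (s.i + s.j - 1).choose s.i) (eval_binom h rfl rfl _ h1)]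
  · simp only [List.cons_append, List.nil_append]
    rw [SimpleGraph.searchStep]
    by_cases hne : (G.candidates X s).Nonempty
    · rw [dif_pos hne]
      have hmem := Finset.min'_mem _ hne
      set u := Finset.min' _ hne with hu
      have hf : firstSucc (G.candidates X s) = u + 1 := by rw [firstSucc, dif_pos hne]
      rw [hf]
      rw [mem_candidates] at hmem
      rw [eval_ite_of_ne (show (Tm.var 10).eval n M m [setCode X, searchCode s, 2 ^ n, 0, 0,
        setCode s.inner, setCode s.outer, s.i, s.j, s.r, u + 1, (s.i + s.j - 1).choose s.i] ≠ 0
        from Nat.succ_ne_zero u), (decides_lt (x := s.r) (y := (s.i + s.j - 1).choose s.i) rfl rfl).eval_ite]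
      split_ifs with hr
      · generalize searchCode s = y
        rw [eval_pack, searchCode, setCode_insert hmem.2.1, eval_add, eval_pow h (j := u) rfl u.2.le]
        rfl
      · generalize searchCode s = y
        rw [eval_pack, searchCode, setCode_insert hmem.1, eval_add, eval_pow h (j := u) rfl u.2.le]
        rfl
    · rw [dif_neg hne]
      have hf : firstSucc (G.candidates X s) = 0 := by rw [firstSucc, dif_neg hne]
      rw [hf, Decides.eval_ite (P := False) (iff_of_false (fun h => h rfl) id), if_neg id]
      rfl
  · exact (by omega : s.i + s.j - 1 ≤ 2 * n)
  · exact eval_find_eq h rfl fun u _ => Decides.congr ((decides_bit h rfl rfl).neg.conj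
      ((decides_bit h rfl rfl).neg.conj ((decides_bit h rfl rfl).neg.conj
        (decides_sees h rfl rfl)))) mem_candidates.symm

theorem eval_search (h : Holds G M m) {a b c d e : Tm} {X : Finset (Fin n)} {z : Fin n}
    {i j r : ℕ} (hi : i ≤ n) (hj : j ≤ n) (hr : r < 2 ^ (2 * n))
    (h₀ : a.eval n M m ρ = setCode X) (h₁ : b.eval n M m ρ = z) (h₂ : c.eval n M m ρ = i)
    (h₃ : d.eval n M m ρ = j) (h₄ : e.eval n M m ρ = r) :
    (Tm.search a b c d e).eval n M m ρ =
      searchCode ((G.searchStep X)^[n] ⟨{z}, ∅, i, j, r⟩) := by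
  rw [Tm.search, eval_call h₀ h₁ h₂ h₃ h₄, eval_bind (eval_pow h rfl le_rfl)]
  refine eval_fold_iterate searchCode (G.searchStep X) SmallSearch _ ?_ ⟨hi, hj, hr⟩
    (fun _ hs => hs.step) (fun _ hs => searchCode_lt h hs)
    fun _ s hs => eval_searchStep h hs rfl rfl rfl
  rw [eval_pack, searchCode, setCode_singleton, setCode_empty, eval_pow h (j := z) rfl z.2.le]
  rfl

/-- After `t` rounds the accumulator is `Ω` without the vertices before `k - t`. The next vertex `v
= k - t - 1` is added exactly if the current set fails the test in the graph with `v` restored; by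
`CliquishNotFullIn.not_insert` this happens precisely when `v` lies in `Ω`. -/
theorem eval_lift (h : Holds G M m) {a b : Tm} {Ω : Finset (Fin n)} {k : ℕ} (hk : k ≤ n)
    (hΩ : ∀ v ≤ k, G.CliquishNotFullIn (below n v) (Ω \ below n v))
    (ha : a.eval n M m ρ = setCode (Ω \ below n k)) (hb : b.eval n M m ρ = k) :
    (Tm.lift a b).eval n M m ρ = setCode Ω := by
  classical
  rw [Tm.lift, eval_call₂ ha hb, eval_fold,
    loopVal_eq_of (fun t => setCode (Ω \ below n (k - t)))]
  · simp [Nat.sub_eq_zero_of_le hk, below]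
  · rfl
  · intro t ht
    simp only [List.cons_append, List.nil_append]
    refine Eq.trans ?_ (Nat.mod_eq_of_lt (h.setCode_lt _))
    congr 1
    rw [(decides_lt (x := t) (y := k) rfl rfl).eval_ite]
    split_ifs with htk
    · obtain ⟨v, hv⟩ : ∃ v, k - t = v + 1 := ⟨k - t - 1, by omega⟩
      have hvn : v < n := by omega
      have hv' : k - (t + 1) = v := by omega
      rw [hv, hv']
      have he : ∀ x, (Tm.sub (.sub (.var 1) (.var 5)) (.lit 1)).eval n M m
          (setCode (Ω \ below n k) :: k :: 0 :: 0 :: 0 :: t :: x) = v := fun x =>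
        show k - t - 1 = v by omega
      have hW := decides_cliquish h (W := below n v) (Ω := Ω \ below n (v + 1))
        (ρ := [setCode (Ω \ below n k), k, 0, 0, 0, t, setCode (Ω \ below n (v + 1))])
        (b := .var 6) (eval_mask_eq h (d := 7) rfl fun u x =>
          Decides.congr (decides_lt (a := .var 7) (x := u) (b := Tm.sub (.sub (.var 1) (.var 5)) (.lit 1)) rfl (he _))
            mem_below.symm) rfl
      rw [hW.eval_ite]
      have hcur := hΩ v (by omega)
      by_cases hvΩ : (⟨v, hvn⟩ : Fin n) ∈ Ω
      · have hins : Ω \ below n v = insert ⟨v, hvn⟩ (Ω \ below n (v + 1)) := by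
          rw [sdiff_below_succ hvn, Finset.insert_erase (by simp [hvΩ, mem_below])]
        rw [if_neg]
        · refine eval_mask_eq h rfl fun u x => Decides.congr ((decides_bit h rfl rfl).disj
            (decides_eq (a := .var 7) (x := u) rfl (he _))) ?_
          rw [hins, Finset.mem_insert, Fin.ext_iff, or_comm]
        · intro hc
          refine hc.not_insert (a := ⟨v, hvn⟩) (by simp [mem_below]) (by simp [mem_below]) ?_
          rwa [← hins]
      · have hsame : Ω \ below n (v + 1) = Ω \ below n v := by
          rw [sdiff_below_succ hvn, Finset.erase_eq_of_notMem (by simp [hvΩ])]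
        rw [hsame, if_pos hcur]
        rfl
    · rw [show k - (t + 1) = k - t by omega]
      rfl

end EvalGraph

end RAM

namespace RAM

/-! ### Decoding a number to a potential maximal clique -/

namespace Tm

/-- The first variable divided by the `k`-th power of the number of vertices. -/
def quot : ℕ → Tm
  | 0 => .var 0
  | k + 1 => div (quot k) .size

/-- The `k`-th digit of the first variable, in base the number of vertices. -/
def digit (k : ℕ) : Tm := mod (quot k) .size

/-- One more than the code of the given set if it is a potential maximal clique, and zero
otherwise. -/
def check (x : Tm) : Tm :=
  call₂ (.bind (mask 5 (bit (.var 0) (.var 5)))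
    (.ite (cliquish (.lit 0) (.var 5)) (add (.var 5) (.lit 1)) (.lit 0))) x (.lit 0)

/-- The union of the set `x` and the two sets of the packed state `s`, as a test for the
vertex `u`. -/
def explored (q x s u : Tm) : Tm := disj (bit x u) (disj (bit (part₀ q s) u) (bit (part₁ q s) u))

/-- Decodes the first variable: the digits are the number of removed vertices, the starting points
of the three explorations, one more vertex, and the sizes of the sets to be found, and the quotient
combines the advice for the explorations. -/
def decode : Tm :=
  .bind (mask 1 (sub (digit 0) (.var 1)))
  (.bind (binom (add (digit 7) (digit 8)) (digit 7))
  (.bind (binom (add (digit 9) (digit 10)) (digit 9))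
  (.bind (pow .size)
  (.bind (search (.var 1) (digit 1) (digit 5) (digit 6) (div (div (quot 11) (.var 3)) (.var 2)))
  (.bind (mask 6 (explored (.var 4) (.var 1) (.var 5) (.var 6)))
  (.bind (search (.var 6) (digit 2) (digit 7) (digit 8) (mod (div (quot 11) (.var 3)) (.var 2)))
  (.bind (mask 8 (explored (.var 4) (.var 6) (.var 7) (.var 8)))
  (.bind (search (.var 8) (digit 3) (digit 9) (digit 10) (mod (quot 11) (.var 3)))
  (.bind (mask 10 (disj (eq (.var 10) (digit 4)) (disj (disj (bit (part₁ (.var 4) (.var 5)) (.var 10))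
    (bit (part₁ (.var 4) (.var 7)) (.var 10))) (bit (part₁ (.var 4) (.var 9)) (.var 10)))))
  (check (lift (.var 10) (digit 0))))))))))))

end Tm

/-- The number with the given leading digits in base `n` and the given rest. -/
def ofDigits (n : ℕ) : List ℕ → ℕ → ℕ
  | [], r => r
  | d :: ds, r => d + n * ofDigits n ds r

theorem ofDigits_lt {n r B : ℕ} (hr : r < B) {ds : List ℕ} (hd : ∀ d ∈ ds, d < n) :
    ofDigits n ds r < n ^ ds.length * B := by
  induction ds with
  | nil => simpa [ofDigits] using hr
  | cons d ds ih =>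
    have h1 := ih fun x hx => hd x (by simp [hx])
    have h2 := hd d (by simp)
    rw [ofDigits, List.length_cons, pow_succ', mul_assoc]
    calc d + n * ofDigits n ds r < n * (ofDigits n ds r + 1) := by rw [mul_add, mul_one]; omega
      _ ≤ _ := Nat.mul_le_mul_left _ h1

theorem ofDigits_div {n r : ℕ} {ds : List ℕ} (hd : ∀ d ∈ ds, d < n) (k : ℕ) (hk : k ≤ ds.length) :
    ofDigits n ds r / n ^ k = ofDigits n (ds.drop k) r := by
  induction k generalizing ds with
  | zero => simp
  | succ k ih =>
    cases ds with
    | nil => simp at hk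
    | cons d ds =>
      have h2 := hd d (by simp)
      rw [ofDigits, pow_succ', ← Nat.div_div_eq_div_mul, Nat.add_mul_div_left _ _ (by omega),
        Nat.div_eq_of_lt h2, zero_add, List.drop_succ_cons]
      exact ih (fun x hx => hd x (by simp [hx])) (by simpa using hk)

/-! ### Soundness and completeness of decoding. -/

section Decode

variable {n : ℕ} {G : SimpleGraph (Fin n)} {M : ℕ} {m : ℕ → ℕ}

open SimpleGraph

theorem eval_quot (R : ℕ) (ρ : List ℕ) (k : ℕ) :
    (Tm.quot k).eval n M m (R :: ρ) = R / n ^ k := by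
  induction k with
  | zero => simp [Tm.quot, Tm.eval]
  | succ k ih =>
    simp only [Tm.quot, Tm.eval, Op.val, ih]
    rw [Nat.div_div_eq_div_mul, pow_succ]

theorem eval_quot_ofDigits {ds : List ℕ} (hd : ∀ d ∈ ds, d < n) (r : ℕ) (ρ : List ℕ) :
    (Tm.quot ds.length).eval n M m (ofDigits n ds r :: ρ) = r := by
  rw [eval_quot, ofDigits_div hd _ le_rfl, List.drop_length, ofDigits]

theorem eval_digit_ofDigits {ds : List ℕ} (hd : ∀ d ∈ ds, d < n) (r : ℕ) (ρ : List ℕ) (k : ℕ)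
    (hk : k < ds.length) :
    (Tm.digit k).eval n M m (ofDigits n ds r :: ρ) = ds[k] := by
  rw [Tm.digit, eval_mod, eval_quot, ofDigits_div hd _ hk.le, List.drop_eq_getElem_cons hk,
    ofDigits, Tm.eval, Nat.add_mul_mod_self_left, Nat.mod_eq_of_lt (hd _ (List.getElem_mem hk))]

theorem decides_check (h : Holds G M m) (y : ℕ) (Ω : Finset (Fin n)) :
    Decides n M m (Tm.cliquish (.lit 0) (.var 5)) ([y, 0, 0, 0, 0] ++ [setCode Ω])
      (G.CliquishNotFull Ω) :=
  Decides.congr (decides_cliquish h setCode_empty.symm rfl) cliquishNotFullIn_empty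

/-- Masking to the vertex positions turns any number into the code of some set, so even the result
of decoding a meaningless number is safe to test and output. -/
theorem eval_check_sound (h : Holds G M m) (x : Tm) (ρ : List ℕ) :
    (Tm.check x).eval n M m ρ = 0 ∨
      ∃ Ω, G.CliquishNotFull Ω ∧ (Tm.check x).eval n M m ρ = setCode Ω + 1 := by
  classical
  obtain ⟨S, hS⟩ : ∃ S : Finset (Fin n), (Tm.mask 5 (.bit (.var 0) (.var 5))).eval n M m
      [x.eval n M m ρ, 0, 0, 0, 0] = setCode S :=
    ⟨_, eval_mask h rfl (P := fun i => (Tm.bit (.var 0) (.var 5)).eval n M m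
      [x.eval n M m ρ, 0, 0, 0, 0, (i : ℕ), 0] ≠ 0) fun i y => Iff.rfl⟩
  rw [Tm.check, eval_call₂ (v₁ := 0) rfl rfl, eval_bind hS,
    (decides_check h _ S).eval_ite]
  split_ifs with hc
  · exact Or.inr ⟨S, hc, rfl⟩
  · exact Or.inl rfl

theorem eval_check (h : Holds G M m) {x : Tm} {ρ : List ℕ} {Ω : Finset (Fin n)}
    (hΩ : G.CliquishNotFull Ω) (hx : x.eval n M m ρ = setCode Ω) :
    (Tm.check x).eval n M m ρ = setCode Ω + 1 := by
  classical
  have hS : (Tm.mask 5 (.bit (.var 0) (.var 5))).eval n M m [setCode Ω, 0, 0, 0, 0] = setCode Ω :=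
    eval_mask_eq h rfl fun u _ => decides_bit h rfl rfl
  rw [Tm.check, eval_call₂ (v₁ := 0) hx rfl, eval_bind hS,
    (decides_check h _ Ω).eval_ite,
    if_pos hΩ]
  rfl

theorem eval_decode_sound (h : Holds G M m) (ρ : List ℕ) :
    Tm.decode.eval n M m ρ = 0 ∨
      ∃ Ω, G.CliquishNotFull Ω ∧ Tm.decode.eval n M m ρ = setCode Ω + 1 := by
  unfold Tm.decode
  iterate 10 rw [eval_bind rfl]
  exact eval_check_sound h _ _

theorem smallSearch_final (D F : Finset (Fin n)) : SmallSearch ⟨D, F, 0, 0, 0⟩ :=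
  ⟨Nat.zero_le _, Nat.zero_le _, by positivity⟩

theorem eval_search_of_advice (h : Holds G M m) {ρ : List ℕ} {a b c d e : Tm}
    {X D F : Finset (Fin n)} {z : Fin n} {i j r : ℕ} (hij : i + j < n) (hr : r < (i + j).choose i)
    (hs : (G.searchStep X)^[n] ⟨{z}, ∅, i, j, r⟩ = ⟨D, F, 0, 0, 0⟩)
    (h₀ : a.eval n M m ρ = setCode X) (h₁ : b.eval n M m ρ = z) (h₂ : c.eval n M m ρ = i)
    (h₃ : d.eval n M m ρ = j) (h₄ : e.eval n M m ρ = r) :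
    (Tm.search a b c d e).eval n M m ρ = searchCode ⟨D, F, 0, 0, 0⟩ := by
  rw [eval_search h (by omega) (by omega) ?_ h₀ h₁ h₂ h₃ h₄, hs]
  exact hr.trans_le ((Nat.choose_le_two_pow _ _).trans
    (Nat.pow_le_pow_right (by norm_num) (by omega)))

/-- The number `R` is chosen before `M` and `m`: the memory changes between trials as marks are set,
and the same `R` must still decode to `Ω`. -/
theorem eval_decode {Ω : Finset (Fin n)} (hn : 0 < n) (hΩ : G.CliquishNotFull Ω) :
    ∃ R < n ^ 11 * (17346009 ^ n / 10000000 ^ n + 1), ∀ M m, Holds G M m →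
      Tm.decode.eval n M m [R] = setCode Ω + 1 := by
  obtain ⟨k, hk, ⟨z₁, z₂, z₃, e, D₁, F₁, D₂, F₂, D₃, F₃, i₁, j₁, i₂, j₂, i₃, j₃, h₁, h₂, h₃, hE,
    hc⟩, hlift⟩ := hΩ.exists_hasCode hn
  obtain ⟨r₁, hr₁, hs₁⟩ := h₁.exists_advice
  obtain ⟨r₂, hr₂, hs₂⟩ := h₂.exists_advice
  obtain ⟨r₃, hr₃, hs₃⟩ := h₃.exists_advice
  have l₁ := h₁.add_lt
  have l₂ := h₂.add_lt
  have l₃ := h₃.add_lt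
  set c₁ := (i₁ + j₁).choose i₁ with hc₁
  set c₂ := (i₂ + j₂).choose i₂ with hc₂
  set c₃ := (i₃ + j₃).choose i₃ with hc₃
  -- The three pieces of advice as mixed-radix digits, so that `r` stays below the product of the
  -- binomial coefficients.
  set r := r₃ + c₃ * (r₂ + c₂ * r₁) with hr
  have hrlt : r < codeCount i₁ j₁ i₂ j₂ i₃ j₃ := by
    rw [codeCount, ← hc₁, ← hc₂, ← hc₃]
    calc r < c₃ * (r₂ + c₂ * r₁ + 1) := by rw [mul_add _ _ 1, mul_one]; omega
      _ ≤ c₃ * (c₂ * (r₁ + 1)) := Nat.mul_le_mul_left _ (by rw [mul_add, mul_one]; omega)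
      _ ≤ c₃ * (c₂ * c₁) := Nat.mul_le_mul_left _ (Nat.mul_le_mul_left _ hr₁)
      _ = _ := by ring
  -- The quotient of natural numbers is the integer part of `codeBase ^ n`, which bounds the integer
  -- `r`.
  have hrB : r < 17346009 ^ n / 10000000 ^ n + 1 := by
    refine Nat.lt_succ_of_le ((Nat.le_div_iff_mul_le (by positivity)).2 ?_)
    have h1 : (r : ℝ) ≤ codeBase ^ n := by
      rw [Fintype.card_fin] at hc
      exact (Nat.cast_le.2 hrlt.le).trans hc
    rw [codeBase, div_pow, le_div_iff₀ (by positivity)] at h1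
    exact_mod_cast h1
  have d₁ : r % c₃ = r₃ := by rw [hr, Nat.add_mul_mod_self_left, Nat.mod_eq_of_lt hr₃]
  have d₂ : r / c₃ = r₂ + c₂ * r₁ := by
    rw [hr, Nat.add_mul_div_left _ _ (by omega), Nat.div_eq_of_lt hr₃, zero_add]
  have d₃ : r / c₃ % c₂ = r₂ := by rw [d₂, Nat.add_mul_mod_self_left, Nat.mod_eq_of_lt hr₂]
  have d₄ : r / c₃ / c₂ = r₁ := by
    rw [d₂, Nat.add_mul_div_left _ _ (by omega), Nat.div_eq_of_lt hr₂, zero_add]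
  set ds : List ℕ := [k, z₁, z₂, z₃, e, i₁, j₁, i₂, j₂, i₃, j₃] with hds
  have hd : ∀ d ∈ ds, d < n := by
    intro d hd
    simp only [hds, List.mem_cons, List.not_mem_nil, or_false] at hd
    have := z₁.2
    have := z₂.2
    have := z₃.2
    have := e.2
    omega
  refine ⟨ofDigits n ds r, ofDigits_lt hrB hd, fun M m h => ?_⟩
  have dig : ∀ (ρ : List ℕ) (k : ℕ) (hk : k < ds.length),
      (Tm.digit k).eval n M m (ofDigits n ds r :: ρ) = ds[k] := eval_digit_ofDigits hd r
  have quo : ∀ ρ : List ℕ, (Tm.quot 11).eval n M m (ofDigits n ds r :: ρ) = r :=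
    eval_quot_ofDigits hd r
  generalize ofDigits n ds r = R at dig quo
  have dg : ∀ (ρ : List ℕ) (k : Fin 11), (Tm.digit k).eval n M m (R :: ρ) = ds[k] :=
    fun ρ k => dig ρ k k.2
  have exq : ∀ {ρ : List ℕ} {q x s u : Tm} {X D F : Finset (Fin n)} {v : Fin n},
      q.eval n M m ρ = 2 ^ n → x.eval n M m ρ = setCode X →
      s.eval n M m ρ = searchCode ⟨D, F, 0, 0, 0⟩ → u.eval n M m ρ = v →
      Decides n M m (Tm.explored q x s u) ρ (v ∈ X ∪ (D ∪ F)) := by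
    intro ρ q x s u X D F v hq hx hs hu
    obtain ⟨p₀, p₁, _⟩ := eval_parts (smallSearch_final D F) hq hs
    exact ((decides_bit h hx hu).disj ((decides_bit h p₀ hu).disj (decides_bit h p₁ hu))).congr
      (by simp)
  have out : ∀ {ρ : List ℕ} {q s u : Tm} {D F : Finset (Fin n)} {v : Fin n},
      q.eval n M m ρ = 2 ^ n → s.eval n M m ρ = searchCode ⟨D, F, 0, 0, 0⟩ → u.eval n M m ρ = v →
      Decides n M m (Tm.bit (Tm.part₁ q s) u) ρ (v ∈ F) := fun hq hs hu =>
    decides_bit h (eval_parts (smallSearch_final _ _) hq hs).2.1 hu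
  unfold Tm.decode
  refine (eval_bind (v := setCode (below n k)) ?_).trans ?_
  · exact eval_mask_eq h rfl fun u _ =>
      (decides_lt (x := u) (y := k) rfl (dg _ 0)).congr mem_below.symm
  refine (eval_bind (v := c₂) ?_).trans ?_
  · exact eval_binom h (congrArg₂ (· + ·) (dg _ 7) (dg _ 8)) (dg _ 7) (show i₂ + j₂ ≤ _ by omega)
      (show i₂ ≤ _ by omega)
  refine (eval_bind (v := c₃) ?_).trans ?_
  · exact eval_binom h (congrArg₂ (· + ·) (dg _ 9) (dg _ 10)) (dg _ 9) (show i₃ + j₃ ≤ _ by omega)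
      (show i₃ ≤ _ by omega)
  refine (eval_bind (eval_pow h rfl le_rfl)).trans ?_
  refine (eval_bind (v := searchCode ⟨D₁, F₁, 0, 0, 0⟩) ?_).trans ?_
  · refine eval_search_of_advice h l₁ hr₁ hs₁ rfl (dg _ 1) (dg _ 5) (dg _ 6) ?_
    exact (congrArg (· / c₃ / c₂) (quo _)).trans d₄
  refine (eval_bind (v := setCode (below n k ∪ (D₁ ∪ F₁))) ?_).trans ?_
  · exact eval_mask_eq h rfl fun u _ => exq rfl rfl rfl rfl
  refine (eval_bind (v := searchCode ⟨D₂, F₂, 0, 0, 0⟩) ?_).trans ?_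
  · refine eval_search_of_advice h l₂ hr₂ hs₂ rfl (dg _ 2) (dg _ 7) (dg _ 8) ?_
    exact (eval_mod _ _).trans ((congrArg (· / c₃ % c₂) (quo _)).trans d₃)
  refine (eval_bind (v := setCode (below n k ∪ (D₁ ∪ F₁) ∪ (D₂ ∪ F₂))) ?_).trans ?_
  · exact eval_mask_eq h rfl fun u _ => exq rfl rfl rfl rfl
  refine (eval_bind (v := searchCode ⟨D₃, F₃, 0, 0, 0⟩) ?_).trans ?_
  · refine eval_search_of_advice h l₃ hr₃ hs₃ rfl (dg _ 3) (dg _ 9) (dg _ 10) ?_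
    exact (eval_mod _ _).trans ((congrArg (· % c₃) (quo _)).trans d₁)
  refine (eval_bind (v := setCode (Ω \ below n k)) ?_).trans ?_
  · refine eval_mask_eq h rfl fun u _ => Decides.congr ((decides_eq (x := u) (y := e) rfl
      (dg _ 4)).disj (((out rfl rfl rfl).disj (out rfl rfl rfl)).disj (out rfl rfl rfl))) ?_
    rw [hE, Finset.mem_insert, Finset.mem_union, Finset.mem_union, Fin.ext_iff]
  exact eval_check h hΩ (eval_lift h hk.le hlift rfl (dg _ 0))

end Decode

end RAM

namespace RAM

/-! ### The program -/

open SimpleGraph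

/-- A fixed power of the number of vertices. -/
def Tm.sizePow : ℕ → Tm
  | 0 => .lit 1
  | k + 1 => .mul .size (Tm.sizePow k)

/-- A power of a constant, with the number of vertices as the exponent. -/
def Tm.constPow (c : ℕ) : Tm := .fold (.lit 1) (.mul (.lit c) (.var 1))

/-- The number of codes to be tried. -/
def Tm.codes : Tm :=
  .mul (Tm.sizePow 11) (.add (.div (Tm.constPow 17346009) (Tm.constPow 10000000)) (.lit 1))

/-- The number of codes to be tried, for `n` vertices. -/
def codes (n : ℕ) : ℕ := n ^ 11 * (17346009 ^ n / 10000000 ^ n + 1)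

section Program

variable {n : ℕ} {G : SimpleGraph (Fin n)} {M : ℕ} {m : ℕ → ℕ}

theorem eval_sizePow (ρ : List ℕ) (k : ℕ) : (Tm.sizePow k).eval n M m ρ = n ^ k := by
  induction k with
  | zero => rfl
  | succ k ih => simp [Tm.sizePow, Tm.eval, Op.val, ih, pow_succ']

/-- The constant `100` in the modulus leaves room for `c ^ n`, so no power is reduced. -/
theorem eval_constPow (h : Holds G M m) {c : ℕ} (hc : c < 2 ^ 100) :
    (Tm.constPow c).eval n M m [] = c ^ n := by
  have hn := h.pos
  rw [Tm.constPow, eval_fold]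
  refine loopVal_eq_of (fun k => c ^ k) rfl fun k hk => ?_
  have : c ^ (k + 1) < M := by
    refine lt_of_lt_of_le ?_ h.le_modulus
    calc c ^ (k + 1) < (2 ^ 100) ^ (k + 1) := Nat.pow_lt_pow_left hc (by omega)
      _ = 2 ^ (100 * (k + 1)) := (pow_mul _ _ _).symm
      _ ≤ _ := Nat.pow_le_pow_right (by norm_num) (by omega)
  rw [show (Tm.mul (.lit c) (.var 1)).eval n M m ([] ++ [k, c ^ k]) = c * c ^ k from rfl,
    ← pow_succ', Nat.mod_eq_of_lt this]

theorem eval_codes (h : Holds G M m) : Tm.codes.eval n M m [] = codes n := by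
  simp only [Tm.codes, Tm.eval, Op.val, eval_sizePow, eval_constPow h (c := 17346009) (by norm_num),
    eval_constPow h (c := 10000000) (by norm_num), codes]

end Program

/-- The program that puts `2 ^ (100 * n)` into register `1`, counting down register `2`. -/
def modulusLoop : Program :=
  .loop (.reg 2) (.seq (.assign 1 (.mul (.reg 1) (.lit (2 ^ 100)))) (.assign 2 (.sub (.reg 2) (.lit 1))))

/-- The address of the mark for the number in register `3`. -/
def markExpr : Expr := .add (.mul (.reg 0) (.reg 0)) (.reg 3)

/-- Decodes the number in register `2`, and outputs the result unless it is marked already. -/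
def visit : Program :=
  .seq (.assign 2 (.sub (.reg 2) (.lit 1))) (.seq (Tm.decode.compile [2] 3)
    (.cond (.reg 3) (.cond (.mem markExpr) .skip
      (.seq (.write (.sub (.reg 3) (.lit 1))) (.store markExpr (.lit 1)))) .skip))

/-- The program that lists the potential maximal cliques. -/
def listCliques : Program :=
  .cond (.reg 0)
    (.seq (.assign 1 (.lit 1)) (.seq (.assign 2 (.reg 0)) (.seq modulusLoop
      (.seq (Tm.codes.compile [] 2) (.loop (.reg 2) visit)))))
    (.write (.lit 0))

theorem size_le_self (x : ℕ) : Nat.size x ≤ x := Nat.size_le.2 Nat.lt_two_pow_self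

theorem exec_modulusLoop {n : ℕ} (k : ℕ) : ∀ s : State, s.reg 0 = n → s.reg 2 = k → k ≤ n →
    s.reg 1 = 2 ^ (100 * (n - k)) → ∃ T s', Exec modulusLoop s T s' ∧
      T ≤ (k + 1) * (500 * (n + 1)) ∧ s'.reg 0 = n ∧ s'.reg 1 = 2 ^ (100 * n) ∧
      s'.mem = s.mem ∧ s'.out = s.out := by
  induction k with
  | zero =>
    intro s h0 h2 _ h1
    refine ⟨_, s, Exec.loop_false (by simpa [Expr.eval] using h2), ?_, h0, by simpa using h1, rfl,
      rfl⟩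
    simp only [Expr.cost, h2, Nat.size_zero]
    omega
  | succ k ih =>
    intro s h0 h2 hk h1
    obtain ⟨T, s', x, t, hs'⟩ := ih
      { s with reg := Function.update (Function.update s.reg 1 (s.reg 1 * 2 ^ 100)) 2 k }
      (by simp [h0]) (by simp) (by omega)
      (by
        simp only [ne_eq, OfNat.one_ne_ofNat, not_false_eq_true, Function.update_of_ne,
          Function.update_self, h1]
        rw [← pow_add]
        congr 1
        omega)
    have e1 := Exec.assign s 1 (.mul (.reg 1) (.lit (2 ^ 100)))
    have e2 := Exec.assign { s with reg := Function.update s.reg 1 (s.reg 1 * 2 ^ 100) } 2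
      (.sub (.reg 2) (.lit 1))
    have v2 : (Expr.sub (.reg 2) (.lit 1)).eval
        { s with reg := Function.update s.reg 1 (s.reg 1 * 2 ^ 100) } = k := by
      simp [Expr.eval, h2]
    rw [v2] at e2
    refine ⟨_, s', Exec.loop_true (by simp [Expr.eval, h2]) (Exec.seq e1 e2) x, ?_, hs'⟩
    have z1 : Nat.size (s.reg 1) ≤ 100 * n + 1 := by rw [h1, Nat.size_pow]; omega
    have z2 : Nat.size (s.reg 1 * 2 ^ 100) ≤ 100 * n + 1 := by
      rw [h1, ← pow_add, Nat.size_pow]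
      omega
    have z3 : Nat.size (2 ^ 100) = 101 := Nat.size_pow
    have z4 := size_le_self (k + 1)
    have z5 := size_le_self k
    have c1 : (Expr.mul (.reg 1) (.lit (2 ^ 100))).cost s ≤ 200 * n + 106 := by
      simp only [Expr.cost, Expr.eval, z3]
      omega
    have c2 : (Expr.sub (.reg 2) (.lit 1)).cost
        { s with reg := Function.update s.reg 1 (s.reg 1 * 2 ^ 100) } ≤ 2 * n + 5 := by
      have : (Expr.reg 2).eval { s with reg := Function.update s.reg 1 (s.reg 1 * 2 ^ 100) } -
        (Expr.lit 1).eval { s with reg := Function.update s.reg 1 (s.reg 1 * 2 ^ 100) } = k := v2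
      simp only [Expr.cost, this]
      simp only [ne_eq, OfNat.ofNat_ne_one, not_false_eq_true, Function.update_of_ne, h2,
        Nat.size_one]
      omega
    have c3 : (Expr.reg 2).cost s ≤ n + 1 := by
      simp only [Expr.cost, h2]
      omega
    have : (k + 1 + 1) * (500 * (n + 1)) = (k + 1) * (500 * (n + 1)) + 500 * (n + 1) := by ring
    omega

/-- The codes from `k` on have been processed. -/
structure Progress {n : ℕ} (G : SimpleGraph (Fin n)) (M k : ℕ) (s : State) : Prop where
  reg_zero : s.reg 0 = n
  reg_one : s.reg 1 = M
  reg_two : s.reg 2 = k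
  holds : Holds G M s.mem
  mem_le : ∀ a, s.mem a ≤ 1
  mark : ∀ y, s.mem (n * n + (y + 1)) ≠ 0 ↔ y ∈ s.out
  nodup : s.out.Nodup
  sound : ∀ y ∈ s.out, ∃ Ω, G.CliquishNotFull Ω ∧ setCode Ω = y
  complete : ∀ (Ω : Finset (Fin n)) (R : ℕ), k ≤ R → R < codes n →
    (∀ m, Holds G M m → Tm.decode.eval n M m [R] = setCode Ω + 1) → setCode Ω ∈ s.out

/-- Marks are stored behind the `n * n` entries of the matrix and have value `1`, so decoding keeps
reading the same graph from a memory of single bits. The marks record exactly what was output, which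
rules out repetitions without a search. -/
theorem Progress.visit {n : ℕ} {G : SimpleGraph (Fin n)} {M k l K : ℕ} {s : State}
    (hK : Computes Tm.decode K) (h : Progress G M (k + 1) s) (hl : 1 ≤ l) (hn : n < 2 ^ l)
    (hM : M ≤ 2 ^ l) (hk : k + 1 < 2 ^ l) :
    ∃ T s', Exec visit s T s' ∧ T ≤ 50 * (K + 1) * l * (n + 1) ^ K ∧ Progress G M k s' := by
  set s₁ : State := { s with reg := Function.update s.reg 2 k } with hs₁
  have hpos := h.holds.pos
  have F : Frame n M l [2] [k] 3 s₁ := by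
    refine ⟨by norm_num, by simp, by simp [hs₁], by simp [hs₁, h.reg_zero],
      by simp [hs₁, h.reg_one], hn, hM, ?_, hl, ?_, ?_⟩
    · exact lt_of_lt_of_le (by positivity) h.holds.le_modulus
    · simp only [List.mem_singleton, forall_eq]
      omega
    · intro a
      have := h.mem_le a
      have : 2 ^ 1 ≤ 2 ^ l := Nat.pow_le_pow_right (by norm_num) hl
      simp only [hs₁]
      omega
  obtain ⟨hv, T, s₂, x, t, hr, ag⟩ := hK.2 n M l [2] [k] 3 s₁ F
  set v := Tm.decode.eval n M s₁.mem [k] with hvdef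
  have e1 := Exec.assign s 2 (.sub (.reg 2) (.lit 1))
  have v1 : (Expr.sub (.reg 2) (.lit 1)).eval s = k := by simp [Expr.eval, h.reg_two]
  rw [v1] at e1
  have r0 : s₂.reg 0 = n := by rw [ag.1 0 (by norm_num), F.reg_zero]
  have r1 : s₂.reg 1 = M := by rw [ag.1 1 (by norm_num), F.reg_one]
  have r2 : s₂.reg 2 = k := by rw [ag.1 2 (by norm_num)]; simp [hs₁]
  have hmem : s₂.mem = s.mem := ag.2.1
  have hout : s₂.out = s.out := ag.2.2
  have hcomp : ∀ (Ω : Finset (Fin n)) (R : ℕ), k ≤ R → R < codes n →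
      (∀ m, Holds G M m → Tm.decode.eval n M m [R] = setCode Ω + 1) →
      setCode Ω ∈ s.out ∨ v = setCode Ω + 1 := by
    intro Ω R hkR hR hΩ
    rcases Nat.lt_or_eq_of_le hkR with hlt | rfl
    · exact Or.inl (h.complete Ω R hlt hR hΩ)
    · exact Or.inr (hΩ _ h.holds)
  have hpl := le_bound (c := 49 * (K + 1)) (l := l) (N := n + 1) (K := K) (by omega)
  have hsum : 50 * (K + 1) * l * (n + 1) ^ K =
      K * l * (n + 1) ^ K + 49 * (K + 1) * l * (n + 1) ^ K + l * (n + 1) ^ K := by ring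
  have hKl : 49 * (K + 1) * l = 49 * (K * l) + 49 * l := by ring
  have z0 := Nat.size_le.2 hn
  have zk := Nat.size_le.2 hk
  have zk' : Nat.size k ≤ l := (Nat.size_le_size (Nat.le_succ k)).trans zk
  have zv := Nat.size_le.2 hv
  have c1 : (Expr.sub (.reg 2) (.lit 1)).cost s ≤ 2 * l + 4 := by
    have : (Expr.reg 2).eval s - (Expr.lit 1).eval s = k := v1
    simp only [Expr.cost, this]
    simp only [h.reg_two, Nat.size_one]
    omega
  have c3 : (Expr.reg 3).cost s₂ ≤ 1 + K * l := by
    simp only [Expr.cost, hr]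
    omega
  by_cases hv0 : v = 0
  · refine ⟨_, s₂, Exec.seq e1 (Exec.seq x (Exec.cond_false (by simp [Expr.eval, hr, hv0])
      (Exec.skip s₂))), ?_, r0, r1, r2, hmem ▸ h.holds, hmem ▸ h.mem_le, ?_, hout ▸ h.nodup,
      hout ▸ h.sound, ?_⟩
    · omega
    · rw [hmem, hout]
      exact h.mark
    · intro Ω R hkR hR hΩ
      rw [hout]
      exact (hcomp Ω R hkR hR hΩ).resolve_right (by omega)
  obtain ⟨Ω, hΩ, hvΩ⟩ := (eval_decode_sound h.holds [k]).resolve_left hv0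
  have hvΩ : v = setCode Ω + 1 := hvΩ
  have va : markExpr.eval s₂ = n * n + (setCode Ω + 1) := by
    simp [markExpr, Expr.eval, r0, hr, hvΩ]
  have cm : markExpr.cost s₂ ≤ 2 * (K * l) + 6 * l + 5 := by
    have b1 : n * n < 2 ^ (l + l) := Op.mul.val_lt hn hn hl hl
    have b2 : n * n + v < 2 ^ (l + l + K * l) :=
      Op.add.val_lt b1 hv (by omega) (Nat.mul_pos hK.1 hl)
    have b1 := Nat.size_le.2 b1
    have b2 := Nat.size_le.2 b2
    simp only [markExpr, Expr.cost, Expr.eval, r0, hr]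
    omega
  by_cases hm : s.mem (n * n + (setCode Ω + 1)) = 0
  · set s₃ : State := { s₂ with out := s₂.out ++ [setCode Ω] } with hs₃
    have e3 := Exec.write s₂ (.sub (.reg 3) (.lit 1))
    have v3 : (Expr.sub (.reg 3) (.lit 1)).eval s₂ = setCode Ω := by simp [Expr.eval, hr, hvΩ]
    rw [v3] at e3
    have e4 := Exec.store s₃ markExpr (.lit 1)
    rw [show markExpr.eval s₃ = n * n + (setCode Ω + 1) from va] at e4
    have hnot : setCode Ω ∉ s.out := fun hmem => (h.mark _).2 hmem hm
    have e4' : Exec (.store markExpr (.lit 1)) s₃ (markExpr.cost s₃ + (Expr.lit 1).cost s₃ + 1)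
        { s₃ with mem := Function.update s.mem (n * n + (setCode Ω + 1)) 1 } := by
      rw [← hmem]
      exact e4
    refine ⟨_, _, Exec.seq e1 (Exec.seq x (Exec.cond_true (by simp [Expr.eval, hr, hv0])
      (Exec.cond_false (by simp [Expr.eval, va, hmem, hm]) (Exec.seq e3 e4')))), ?_, r0, r1, r2,
      ⟨hpos, h.holds.le_modulus, fun i j => ?_⟩, fun a => ?_, fun y => ?_, ?_, ?_, ?_⟩
    · have c4 : (Expr.sub (.reg 3) (.lit 1)).cost s₂ ≤ 2 * (K * l) + 4 := by
        have : (Expr.reg 3).eval s₂ - (Expr.lit 1).eval s₂ = setCode Ω := v3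
        have z : Nat.size (setCode Ω) ≤ K * l :=
          (Nat.size_le_size (by omega : setCode Ω ≤ v)).trans zv
        simp only [Expr.cost, this]
        simp only [hr, Nat.size_one]
        omega
      have c5 : (Expr.mem markExpr).cost s₂ ≤ 2 * (K * l) + 6 * l + 6 := by
        simp only [Expr.cost, va, hmem, hm, Nat.size_zero]
        omega
      have c6 : markExpr.cost s₃ = markExpr.cost s₂ := rfl
      have c7 : (Expr.lit 1).cost s₃ = 2 := by simp [Expr.cost]
      omega
    · have : (i : ℕ) * n + j ≠ n * n + (setCode Ω + 1) := by
        have := i.2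
        have := j.2
        nlinarith
      simp only [Function.update_of_ne this]
      exact h.holds.adj_iff i j
    · by_cases ha : a = n * n + (setCode Ω + 1)
      · simp [ha]
      · simp only [Function.update_of_ne ha]
        exact h.mem_le a
    · simp only [hs₃, hout, List.mem_append, List.mem_singleton]
      by_cases hy : y = setCode Ω
      · simp [hy]
      · rw [Function.update_of_ne (by omega), h.mark]
        simp [hy]
    · simp only [hs₃, hout]
      exact List.nodup_append.2 ⟨h.nodup, by simp, by
        intro a ha b hb
        rw [List.mem_singleton] at hb
        rintro rfl
        exact hnot (hb ▸ ha)⟩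
    · intro y hy
      simp only [hs₃, hout, List.mem_append, List.mem_singleton] at hy
      rcases hy with hy | rfl
      · exact h.sound y hy
      · exact ⟨Ω, hΩ, rfl⟩
    · intro Ω' R hkR hR hΩ'
      simp only [hs₃, hout, List.mem_append, List.mem_singleton]
      exact (hcomp Ω' R hkR hR hΩ').imp_right (by omega)
  · refine ⟨_, s₂, Exec.seq e1 (Exec.seq x (Exec.cond_true (by simp [Expr.eval, hr, hv0])
      (Exec.cond_true (by simp [Expr.eval, va, hmem, hm]) (Exec.skip s₂)))), ?_, r0, r1, r2,
      hmem ▸ h.holds, hmem ▸ h.mem_le, ?_, hout ▸ h.nodup, hout ▸ h.sound, ?_⟩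
    · have c5 : (Expr.mem markExpr).cost s₂ ≤ 2 * (K * l) + 6 * l + 7 := by
        have := h.mem_le (n * n + (setCode Ω + 1))
        have := (Nat.size_le_size this).trans_eq Nat.size_one
        simp only [Expr.cost, va, hmem]
        omega
      omega
    · rw [hmem, hout]
      exact h.mark
    · intro Ω' R hkR hR hΩ'
      rw [hout]
      rcases hcomp Ω' R hkR hR hΩ' with h' | h'
      · exact h'
      · rw [← (show setCode Ω = setCode Ω' by omega)]
        exact (h.mark _).1 hm

theorem Progress.loop {n : ℕ} {G : SimpleGraph (Fin n)} {M l K : ℕ}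
    (hK : Computes Tm.decode K) (hl : 1 ≤ l) (hn : n < 2 ^ l) (hM : M ≤ 2 ^ l) (k : ℕ) :
    ∀ s, Progress G M k s → k < 2 ^ l →
    ∃ T s', Exec (.loop (.reg 2) RAM.visit) s T s' ∧
      T ≤ (k + 1) * (53 * (K + 1) * l * (n + 1) ^ K) ∧ Progress G M 0 s' := by
  have hb := le_bound (c := 3 * (K + 1)) (l := l) (N := n + 1) (K := K) (by omega)
  have hb' : 3 * l ≤ 3 * (K + 1) * l := Nat.mul_le_mul_right l (by omega)
  have hsplit : 53 * (K + 1) * l * (n + 1) ^ K =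
    50 * (K + 1) * l * (n + 1) ^ K + 3 * (K + 1) * l * (n + 1) ^ K := by ring
  induction k with
  | zero =>
    intro s h _
    refine ⟨_, s, Exec.loop_false (by simp [Expr.eval, h.reg_two]), ?_, h⟩
    simp only [Expr.cost, h.reg_two, Nat.size_zero]
    omega
  | succ k ih =>
    intro s h hk
    obtain ⟨T, s', x, t, h'⟩ := h.visit hK hl hn hM hk
    obtain ⟨T', s'', x', t', h''⟩ := ih s' h' (by omega)
    refine ⟨_, s'', Exec.loop_true (by simp [Expr.eval, h.reg_two]) x x', ?_, h''⟩
    have := Nat.size_le.2 hk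
    have e : (k + 1 + 1) * (53 * (K + 1) * l * (n + 1) ^ K) =
      (k + 1) * (53 * (K + 1) * l * (n + 1) ^ K) + 53 * (K + 1) * l * (n + 1) ^ K := by ring
    simp only [Expr.cost, h.reg_two]
    omega

end RAM

/-! ### Initial state, total running time and the main theorem. -/

namespace RAM

open SimpleGraph

theorem graphInput_mem_le {n : ℕ} (G : SimpleGraph (Fin n)) (a : ℕ) : (graphInput G).mem a ≤ 1 := by
  simp only [graphInput]
  split_ifs <;> omega

theorem graphInput_mem_ne_zero {n : ℕ} (G : SimpleGraph (Fin n)) (i j : Fin n) :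
    (graphInput G).mem ((i : ℕ) * n + j) ≠ 0 ↔ G.Adj i j := by
  simp only [graphInput, ne_eq, ite_eq_right_iff, one_ne_zero, imp_false, not_not]
  refine ⟨fun ⟨i', j', h, hadj⟩ => ?_, fun h => ⟨i, j, rfl, h⟩⟩
  have hn : 0 < n := i.pos
  have hi : i = i' := by
    have := congrArg (· / n) h
    simp only [mul_comm _ n, Nat.mul_add_div hn, Nat.div_eq_of_lt j.2, Nat.div_eq_of_lt j'.2,
      add_zero] at this
    exact Fin.ext this
  subst hi
  have hj : j = j' := Fin.ext (by omega)
  exact hj ▸ hadj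

theorem graphInput_mem_of_le {n : ℕ} (G : SimpleGraph (Fin n)) {a : ℕ} (ha : n * n ≤ a) :
    (graphInput G).mem a = 0 := by
  simp only [graphInput, ite_eq_right_iff, one_ne_zero, imp_false, not_exists, not_and]
  intro i j h
  have := i.2
  have := j.2
  nlinarith

/-- The ratio `codeBase / 1.734601` is less than `1`, and a polynomial times its powers is bounded.
-/
theorem exists_polynomial_bound (E : ℕ) :
    ∃ C : ℝ, ∀ n : ℕ, ((n : ℝ) + 1) ^ E * codeBase ^ n ≤ C * (1.734601 : ℝ) ^ n := by
  set r : ℝ := codeBase / 1.734601 with hr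
  have hr0 : 0 < r := by rw [hr, codeBase]; norm_num
  have hr1 : r < 1 := by rw [hr, codeBase]; norm_num
  obtain ⟨C, hC⟩ := (tendsto_pow_const_mul_const_pow_of_abs_lt_one E
    (by rwa [abs_of_pos hr0] : |r| < 1)).bddAbove_range
  -- The bound is applied at `n + 1`; dividing by `r` compensates for the shifted exponent.
  refine ⟨C / r, fun n => ?_⟩
  have h := hC ⟨n + 1, rfl⟩
  have hb : codeBase ^ n = r ^ n * (1.734601 : ℝ) ^ n := by
    rw [← mul_pow, hr, div_mul_cancel₀ _ (by norm_num)]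
  rw [hb, ← mul_assoc]
  refine mul_le_mul_of_nonneg_right ?_ (by positivity)
  rw [le_div_iff₀ hr0]
  push_cast at h
  calc ((n : ℝ) + 1) ^ E * r ^ n * r = ((n : ℝ) + 1) ^ E * r ^ (n + 1) := by ring
    _ ≤ C := h

theorem codes_add_one_le (n : ℕ) :
    ((codes n : ℝ) + 1) ≤ 3 * (((n : ℝ) + 1) ^ 11 * codeBase ^ n) := by
  have h1 : (1 : ℝ) ≤ codeBase ^ n := one_le_pow₀ (by rw [codeBase]; norm_num)
  have h2 : ((17346009 ^ n / 10000000 ^ n : ℕ) : ℝ) ≤ codeBase ^ n := by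
    rw [codeBase, div_pow]
    refine Nat.cast_div_le.trans (le_of_eq ?_)
    push_cast
    rfl
  have h3 : (n : ℝ) ^ 11 ≤ ((n : ℝ) + 1) ^ 11 :=
    pow_le_pow_left₀ (Nat.cast_nonneg n) (by linarith) 11
  have h4 : (1 : ℝ) ≤ ((n : ℝ) + 1) ^ 11 := one_le_pow₀ (by linarith [Nat.cast_nonneg (α := ℝ) n])
  have h5 : (codes n : ℝ) ≤ ((n : ℝ) + 1) ^ 11 * (codeBase ^ n + codeBase ^ n) := by
    rw [codes]
    push_cast at h2 ⊢
    exact mul_le_mul h3 (add_le_add h2 h1) (by positivity) (by positivity)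
  have h6 : (1 : ℝ) ≤ ((n : ℝ) + 1) ^ 11 * codeBase ^ n := one_le_mul_of_one_le_of_one_le h4 h1
  linarith

theorem Progress.lists {n : ℕ} {G : SimpleGraph (Fin n)} {M : ℕ} {s : State}
    (h : Progress G M 0 s) : ListsPotentialMaximalCliques G s.out := by
  refine ⟨h.nodup, fun k => ⟨fun hk => ?_, ?_⟩⟩
  · obtain ⟨Ω, hΩ, hk⟩ := h.sound k hk
    exact ⟨Ω, isPotentialMaximalClique_iff.2 hΩ, hk⟩
  · rintro ⟨Ω, hΩ, rfl⟩
    obtain ⟨R, hR, hdec⟩ := eval_decode h.holds.pos (isPotentialMaximalClique_iff.1 hΩ)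
    exact h.complete Ω R (Nat.zero_le _) hR fun m hm => hdec M m hm

/-- The empty set is the only potential maximal clique of the empty graph, and its code is `0`. This
case is separate because `Holds` needs a vertex. -/
theorem exec_listCliques_zero (G : SimpleGraph (Fin 0)) :
    ∃ s, Exec listCliques (graphInput G) 4 s ∧ ListsPotentialMaximalCliques G s.out := by
  refine ⟨_, Exec.cond_false (t := 2) (by simp [Expr.eval, graphInput]) (Exec.write _ _),
    by simp [graphInput], fun k => ?_⟩
  have hc : G.IsPotentialMaximalClique ((∅ : Finset (Fin 0)) : Set (Fin 0)) := by
    refine isPotentialMaximalClique_iff.2 ⟨fun C hC => ?_, by simp⟩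
    obtain ⟨v, _⟩ := hC.1.1
    exact v.elim0
  simp only [graphInput, Expr.eval, List.nil_append, List.mem_singleton]
  constructor
  · rintro rfl
    exact ⟨∅, hc, setCode_empty⟩
  · rintro ⟨Ω, _, rfl⟩
    rw [Subsingleton.elim Ω ∅, setCode_empty]

theorem exec_listCliques {K K' : ℕ} (hK : Computes Tm.codes K) (hK' : Computes Tm.decode K')
    {n : ℕ} (hn : 0 < n) (G : SimpleGraph (Fin n)) :
    ∃ T s, Exec listCliques (graphInput G) T s ∧ ListsPotentialMaximalCliques G s.out ∧
      T ≤ (600 + 100 * K + 5300 * (K' + 1) * K) * (n + 1) ^ (K + K' + 2) * (codes n + 1) := by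
  set s₀ := graphInput G with hs₀
  have h0 : s₀.reg 0 = n := by simp [hs₀, graphInput]
  set s₁ : State := { s₀ with reg := Function.update s₀.reg 1 1 } with hs₁
  have e1 : Exec (.assign 1 (.lit 1)) s₀ ((Expr.lit 1).cost s₀ + 1) s₁ := Exec.assign _ _ _
  have h10 : s₁.reg 0 = n := by simp [hs₁, h0]
  set s₂ : State := { s₁ with reg := Function.update s₁.reg 2 n } with hs₂
  have e2 : Exec (.assign 2 (.reg 0)) s₁ ((Expr.reg 0).cost s₁ + 1) s₂ := by
    have := Exec.assign s₁ 2 (.reg 0)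
    rwa [show (Expr.reg 0).eval s₁ = n from h10] at this
  obtain ⟨T₃, s₃, e3, t3, r30, r31, m3, o3⟩ := exec_modulusLoop (n := n) n s₂ (by simp [hs₂, h10])
    (by simp [hs₂]) le_rfl (by simp [hs₂, hs₁])
  have m3' : s₃.mem = s₀.mem := m3
  have o3' : s₃.out = [] := o3
  set M := 2 ^ (100 * n) with hM
  have holds : Holds G M s₃.mem :=
    ⟨hn, le_rfl, fun i j => by rw [m3']; exact graphInput_mem_ne_zero G i j⟩
  have hnM : n < 2 ^ (100 * n) := Nat.lt_two_pow_self.trans_le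
    (Nat.pow_le_pow_right (by norm_num) (by omega))
  have F : Frame n M (100 * n) [] [] 2 s₃ := by
    refine ⟨le_rfl, by simp, rfl, r30, r31, hnM, le_rfl, by positivity, by omega, by simp, ?_⟩
    intro a
    have := graphInput_mem_le G a
    have : 2 ^ 1 ≤ 2 ^ (100 * n) := Nat.pow_le_pow_right (by norm_num) (by omega)
    rw [m3', hs₀]
    omega
  obtain ⟨hv, T₄, s₄, e4, t4, r4, ag⟩ := hK.2 n M (100 * n) [] [] 2 s₃ F
  rw [eval_codes holds] at hv r4
  have hle : 100 * n ≤ K * (100 * n) := Nat.le_mul_of_pos_left _ hK.1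
  have hpow : 2 ^ (100 * n) ≤ 2 ^ (K * (100 * n)) := Nat.pow_le_pow_right (by norm_num) hle
  have m4 : s₄.mem = s₀.mem := ag.2.1.trans m3'
  have o4 : s₄.out = [] := ag.2.2.trans o3'
  have P : Progress G M (codes n) s₄ := by
    refine ⟨by rw [ag.1 0 (by norm_num), r30], by rw [ag.1 1 (by norm_num), r31], r4,
      by rw [ag.2.1]; exact holds, fun a => by rw [m4]; exact graphInput_mem_le G a, fun y => ?_,
      by simp [o4], by simp [o4], fun Ω R h h' => by omega⟩
    rw [m4, o4, hs₀, graphInput_mem_of_le G (by omega)]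
    simp
  -- The bit length is raised from `100 * n` to `K * (100 * n)`, because the counter starts at
  -- `codes n`, for which `Computes` guarantees only that length.
  obtain ⟨T₅, s₅, e5, t5, P'⟩ := Progress.loop hK' (by omega) (hnM.trans_le hpow) hpow (codes n) s₄
    P hv
  refine ⟨_, s₅, Exec.cond_true (by simp only [Expr.eval, h0]; omega) (Exec.seq e1 (Exec.seq e2
    (Exec.seq e3 (Exec.seq e4 e5)))), P'.lists, ?_⟩
  have z := size_le_self n
  have c0 : (Expr.reg 0).cost s₀ ≤ 1 + n := by simp only [Expr.cost, h0]; omega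
  have c1 : (Expr.lit 1).cost s₀ = 2 := by simp [Expr.cost]
  have c2 : (Expr.reg 0).cost s₁ ≤ 1 + n := by simp only [Expr.cost, h10]; omega
  set N := n + 1 with hN
  have hN1 : 1 ≤ N := by omega
  set E := K + K' + 2 with hE
  have b1 : N * N ≤ N ^ E := by
    rw [← sq]
    exact Nat.pow_le_pow_right hN1 (by omega)
  have b2 : N ≤ N * N := Nat.le_mul_of_pos_left _ hN1
  have b3 : N ^ K * N ≤ N ^ E := by
    rw [← pow_succ]
    exact Nat.pow_le_pow_right hN1 (by omega)
  have b4 : N ^ K' * N ≤ N ^ E := by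
    rw [← pow_succ]
    exact Nat.pow_le_pow_right hN1 (by omega)
  have t3' : T₃ ≤ 500 * N ^ E := by
    refine t3.trans ?_
    rw [mul_left_comm]
    exact Nat.mul_le_mul_left _ b1
  have t4' : T₄ ≤ 100 * K * N ^ E := by
    refine t4.trans ?_
    calc K * (100 * n) * N ^ K ≤ K * (100 * N) * N ^ K := by gcongr; omega
      _ = 100 * K * (N ^ K * N) := by ring
      _ ≤ _ := Nat.mul_le_mul_left _ b3
  have t5' : T₅ ≤ (codes n + 1) * (5300 * (K' + 1) * K * N ^ E) := by
    refine t5.trans (Nat.mul_le_mul_left _ ?_)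
    calc 53 * (K' + 1) * (K * (100 * n)) * N ^ K' ≤ 53 * (K' + 1) * (K * (100 * N)) * N ^ K' := by
          gcongr; omega
      _ = 5300 * (K' + 1) * K * (N ^ K' * N) := by ring
      _ ≤ _ := Nat.mul_le_mul_left _ b4
  have hsum : (600 + 100 * K + 5300 * (K' + 1) * K) * N ^ E * (codes n + 1) =
      100 * N ^ E + 500 * N ^ E + 100 * K * N ^ E + (600 * N ^ E + 100 * K * N ^ E) * codes n +
        (codes n + 1) * (5300 * (K' + 1) * K * N ^ E) := by ring
  rw [hsum]
  have := Nat.zero_le ((600 * N ^ E + 100 * K * N ^ E) * codes n)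
  clear_value N E
  omega

end RAM

theorem mainTheorem2 :
    ∃ (p : RAM.Program) (C : ℝ), ∀ (n : ℕ) (G : SimpleGraph (Fin n)),
      ∃ (t : ℕ) (s : RAM.State), RAM.Exec p (RAM.graphInput G) t s ∧
        RAM.ListsPotentialMaximalCliques G s.out ∧
        (t : ℝ) ≤ C * (1.734601 : ℝ) ^ n := by
  obtain ⟨K, hK⟩ := RAM.exists_computes RAM.Tm.codes
  obtain ⟨K', hK'⟩ := RAM.exists_computes RAM.Tm.decode
  set A := 600 + 100 * K + 5300 * (K' + 1) * K with hA
  obtain ⟨C, hC⟩ := RAM.exists_polynomial_bound (K + K' + 2 + 11)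
  -- The `4` is the cost of the run on the empty graph.
  refine ⟨RAM.listCliques, max 4 (A * 3 * C), fun n G => ?_⟩
  rcases Nat.eq_zero_or_pos n with rfl | hn
  · obtain ⟨s, he, hs⟩ := RAM.exec_listCliques_zero G
    exact ⟨4, s, he, hs, by simp⟩
  · obtain ⟨T, s, he, hs, hT⟩ := RAM.exec_listCliques hK hK' hn G
    refine ⟨T, s, he, hs, ?_⟩
    have h1 : (T : ℝ) ≤ A * ((n : ℝ) + 1) ^ (K + K' + 2) * ((RAM.codes n : ℝ) + 1) := by
      exact_mod_cast hT
    calc (T : ℝ) ≤ A * ((n : ℝ) + 1) ^ (K + K' + 2) * ((RAM.codes n : ℝ) + 1) := h1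
      _ ≤ A * ((n : ℝ) + 1) ^ (K + K' + 2) *
          (3 * (((n : ℝ) + 1) ^ 11 * codeBase ^ n)) :=
        mul_le_mul_of_nonneg_left (RAM.codes_add_one_le n) (by positivity)
      _ = A * 3 * (((n : ℝ) + 1) ^ (K + K' + 2 + 11) * codeBase ^ n) := by
        rw [pow_add _ (K + K' + 2) 11]
        ring
      _ ≤ A * 3 * (C * (1.734601 : ℝ) ^ n) := mul_le_mul_of_nonneg_left (hC n) (by positivity)
      _ = A * 3 * C * (1.734601 : ℝ) ^ n := by ring
      _ ≤ max 4 (A * 3 * C) * (1.734601 : ℝ) ^ n :=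
        mul_le_mul_of_nonneg_right (le_max_right _ _) (by positivity)
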